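/- Let $\mathbb D$ be the open unit disc, $\mathbb T$ the unit circle, $m$ normalized Lebesgue measure on $\mathbb T$, $dA=\frac{dx\,dy}{\pi}$, and let $\mu$ be a finite positive Borel measure on $\mathbb D$. Put $$G_\mu(z)=\int_{\mathbb D}\log\left|\frac{1-\overline w z}{z-w}\right|d\mu(w),\qquad \mathcal D_\mu=\Big\{f\in H^2:\ \mathcal D_\mu(f):=\int_{\mathbb D}|f'(z)|^2G_\mu(z)\,dA(z)<\infty\Big\},$$ with norm $\|f\|_{\mathcal D_\mu}^2=\|f\|_{H^2}^2+\mathcal D_\mu(f)$. For $f\in\mathcal D_\mu$ let $[f]_{\mathcal D_\mu}$ be the smallest closed subspace of $\mathcal D_\mu$ that contains $f$ and is invariant under multiplication by $z$; $f$ is called cyclic in $\mathcal D_\mu$ if $[f]_{\mathcal D_\mu}=\mathcal D_\mu$. A function $f\in H^1$ is called outer if $f(z)=\alpha\exp\left(\int_{\mathbb T}\frac{\zeta+z}{\zeta-z}h(\zeta)\,dm(\zeta)\right)$ on $\mathbb D$ for some real-valued $h\in L^1(\mathbb T)$ and some $|\alpha|=1$. Put $\mathcal Z(f)=\{\zeta\in\mathbb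 T:\lim_{r\to1^-}f(r\zeta)=0\}$. For $g\in L^2(\mathbb T)$ let $$\mathcal D_\mu^h(g)=\int_{\mathbb T}\int_{\mathbb T}|g(\zeta)-g(\lambda)|^2A_\mu(\zeta,\lambda)\,dm(\zeta)\,dm(\lambda),\qquad A_\mu(\zeta,\lambda)=\int_{\mathbb D}\frac{1-|z|^2}{|\zeta-z|^2}\,\frac{1-|z|^2}{|\lambda-z|^2}\,d\mu(z),$$ and for $E\subset\mathbb T$ let $c_\mu(E)$ be the infimum of $\|g\|_{L^2(\mathbb T)}^2+\mathcal D^h_\mu(g)$ over all $g\in L^2(\mathbb T)$ with $\mathcal D^h_\mu(g)<\infty$ and $|g|\ge1$ $m$-a.e. on a neighbourhood of $E$. Then: 1. for every $f\in\mathcal D_\mu$, $f$ is cyclic in $\mathcal D_\mu$ if and only if $f$ is outer; 2. (the Brown–Shields conjecture for $\mathcal D_\mu$) for every $f\in\mathcal D_\mu$, $f$ is cyclic in $\mathcal D_\mu$ if and only if $f$ is outer and $c_\mu(\mathcal Z(f))=0$; 3. for every $E\subset\mathbb T$, $c_\mu(E)=0$ if and only if $E$ is Lebesgue-null. -/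

import Mathlib

open MeasureTheory Set Filter Topology
open scoped ENNReal ComplexConjugate

/-! Functions on the unit disc `𝔻 = Metric.ball 0 1` are represented by functions `ℂ → ℂ`; only the
values on `𝔻` enter the definitions below, so two functions that agree on `𝔻` are identified by all
of them (their difference has norm `0`). Likewise, functions on the unit circle
`𝕋 = Metric.sphere 0 1` are represented by functions `ℂ → ℂ`, considered almost everywhere with
respect to the normalized arc length measure `arcLength`, which is carried by `𝕋`. -/

namespace BrownShields

/-- Normalized Lebesgue measure `m` on the unit circle, as a measure on `ℂ`: the image of
`dθ / (2π)` on `(0, 2π]` under `θ ↦ e^{iθ}`. -/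
noncomputable def arcLength : Measure ℂ :=
  Measure.map (circleMap 0 1)
    ((ENNReal.ofReal (2 * Real.pi))⁻¹ • volume.restrict (Ioc 0 (2 * Real.pi)))

/-- Normalized area measure `dA = dx dy / π` on the unit disc. -/
noncomputable def discArea : Measure ℂ :=
  (ENNReal.ofReal Real.pi)⁻¹ • volume.restrict (Metric.ball 0 1)

/-- The Hardy norm `sup_{0 ≤ r < 1} (∫_𝕋 |f(rζ)|^p dm(ζ))^{1/p}`. -/
noncomputable def hardyNorm (p : ℝ≥0∞) (f : ℂ → ℂ) : ℝ≥0∞ :=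
  ⨆ r ∈ Ico (0 : ℝ) 1, eLpNorm (fun ζ : ℂ => f (r * ζ)) p arcLength

/-- Membership in the Hardy space `H^p` of the unit disc. -/
def MemHardy (p : ℝ≥0∞) (f : ℂ → ℂ) : Prop :=
  DifferentiableOn ℂ f (Metric.ball 0 1) ∧ hardyNorm p f < ∞

/-- Outer functions: elements of `H^1` of the form
`f(z) = α exp (∫_𝕋 (ζ + z) / (ζ - z) h(ζ) dm(ζ))` with `h` real-valued and integrable, `|α| = 1`. -/
def IsOuter (f : ℂ → ℂ) : Prop :=
  MemHardy 1 f ∧ ∃ (α : ℂ) (h : ℂ → ℝ), ‖α‖ = 1 ∧ Integrable h arcLength ∧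
    ∀ z ∈ Metric.ball (0 : ℂ) 1,
      f z = α * Complex.exp (∫ ζ, (ζ + z) / (ζ - z) * (h ζ : ℂ) ∂arcLength)

open Classical in
/-- The Green kernel `log |(1 - \bar w z) / (z - w)|` of the unit disc, with value `∞` at `z = w`. -/
noncomputable def greenKernel (z w : ℂ) : ℝ≥0∞ :=
  if z = w then ∞ else ENNReal.ofReal (Real.log ‖(1 - conj w * z) / (z - w)‖)

/-- The Green potential `G_μ` of a measure `μ` on the unit disc. -/
noncomputable def greenPotential (μ : Measure ℂ) (z : ℂ) : ℝ≥0∞ :=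
  ∫⁻ w, greenKernel z w ∂μ

/-- The weighted Dirichlet integral `𝓓_μ(f) = ∫_𝔻 |f'|² G_μ dA`. -/
noncomputable def dirichletIntegral (μ : Measure ℂ) (f : ℂ → ℂ) : ℝ≥0∞ :=
  ∫⁻ z, ‖deriv f z‖ₑ ^ 2 * greenPotential μ z ∂discArea

/-- The square of the norm of `𝓓_μ`: `‖f‖² = ‖f‖²_{H²} + 𝓓_μ(f)`. -/
noncomputable def dirichletNormSq (μ : Measure ℂ) (f : ℂ → ℂ) : ℝ≥0∞ :=
  hardyNorm 2 f ^ 2 + dirichletIntegral μ f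

theorem measurable_greenPotential (μ : Measure ℂ) [SFinite μ] :
    Measurable (greenPotential μ) := by
  refine Measurable.lintegral_prod_right' (f := fun p : ℂ × ℂ => greenKernel p.1 p.2) ?_
  unfold greenKernel
  refine Measurable.ite (measurableSet_eq_fun measurable_fst measurable_snd) measurable_const ?_
  have h : Measurable fun p : ℂ × ℂ => (1 - conj p.2 * p.1) / (p.1 - p.2) := by
    refine Measurable.div ?_ (measurable_fst.sub measurable_snd)
    exact (by fun_prop : Continuous fun p : ℂ × ℂ => 1 - conj p.2 * p.1).measurable
  exact (Real.measurable_log.comp h.norm).ennreal_ofReal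

theorem arcLength_compl_sphere : arcLength (Metric.sphere (0 : ℂ) 1)ᶜ = 0 := by
  rw [arcLength, Measure.map_apply (continuous_circleMap 0 1).measurable
    (Metric.isClosed_sphere.measurableSet.compl)]
  have : circleMap 0 1 ⁻¹' (Metric.sphere (0 : ℂ) 1)ᶜ = ∅ := by
    ext θ
    simp
  simp [this]

theorem aestronglyMeasurable_dilation {f : ℂ → ℂ}
    (hf : DifferentiableOn ℂ f (Metric.ball 0 1)) {r : ℝ} (hr : r ∈ Ico (0 : ℝ) 1) :
    AEStronglyMeasurable (fun ζ : ℂ => f (r * ζ)) arcLength := by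
  have h : ContinuousOn (fun ζ : ℂ => f (r * ζ)) (Metric.sphere 0 1) := by
    refine hf.continuousOn.comp (by fun_prop) ?_
    intro ζ hζ
    have : ‖ζ‖ = 1 := by simpa using hζ
    simp [this, abs_of_nonneg hr.1, hr.2]
  have h2 : arcLength.restrict (Metric.sphere (0 : ℂ) 1) = arcLength :=
    Measure.restrict_eq_self_of_ae_mem arcLength_compl_sphere
  rw [← h2]
  exact h.aestronglyMeasurable Metric.isClosed_sphere.measurableSet

theorem MemHardy.add {f g : ℂ → ℂ} (hf : MemHardy 2 f) (hg : MemHardy 2 g) :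
    MemHardy 2 (f + g) := by
  refine ⟨hf.1.add hg.1, lt_of_le_of_lt ?_ (ENNReal.add_lt_top.2 ⟨hf.2, hg.2⟩)⟩
  refine iSup₂_le fun r hr => ?_
  refine (eLpNorm_add_le (aestronglyMeasurable_dilation hf.1 hr)
    (aestronglyMeasurable_dilation hg.1 hr) (by norm_num)).trans ?_
  exact add_le_add (le_iSup₂_of_le r hr le_rfl) (le_iSup₂_of_le r hr le_rfl)

theorem MemHardy.const_smul {f : ℂ → ℂ} (c : ℂ) (hf : MemHardy 2 f) : MemHardy 2 (c • f) := by
  refine ⟨hf.1.const_smul c, lt_of_le_of_lt ?_ (ENNReal.mul_lt_top (enorm_lt_top (x := c)) hf.2)⟩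
  refine iSup₂_le fun r hr => ?_
  refine (eLpNorm_const_smul_le (c := c) (f := fun ζ : ℂ => f (r * ζ))).trans ?_
  gcongr
  exact le_iSup₂_of_le r hr le_rfl

theorem dirichletIntegral_add_lt_top {μ : Measure ℂ} [SFinite μ] {f g : ℂ → ℂ}
    (hf : DifferentiableOn ℂ f (Metric.ball 0 1)) (hg : DifferentiableOn ℂ g (Metric.ball 0 1))
    (hf' : dirichletIntegral μ f < ∞) (hg' : dirichletIntegral μ g < ∞) :
    dirichletIntegral μ (f + g) < ∞ := by
  have hmeas : Measurable fun z => 2 * (‖deriv f z‖ₑ ^ 2 * greenPotential μ z) :=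
    (((measurable_deriv f).enorm.pow_const 2).mul (measurable_greenPotential μ)).const_mul 2
  have hle : dirichletIntegral μ (f + g) ≤
      ∫⁻ z, 2 * (‖deriv f z‖ₑ ^ 2 * greenPotential μ z) +
        2 * (‖deriv g z‖ₑ ^ 2 * greenPotential μ z) ∂discArea := by
    refine lintegral_mono_ae ?_
    have hball : ∀ᵐ z ∂discArea, z ∈ Metric.ball (0 : ℂ) 1 :=
      Measure.ae_smul_measure (ae_restrict_mem Metric.isOpen_ball.measurableSet) _
    filter_upwards [hball] with z hz
    rw [deriv_add (hf.differentiableAt (Metric.isOpen_ball.mem_nhds hz))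
      (hg.differentiableAt (Metric.isOpen_ball.mem_nhds hz)), ← mul_add, ← add_mul, ← mul_assoc]
    gcongr
    have h1 : ‖deriv f z + deriv g z‖ ^ 2 ≤ 2 * (‖deriv f z‖ ^ 2 + ‖deriv g z‖ ^ 2) := by
      nlinarith [norm_add_le (deriv f z) (deriv g z), norm_nonneg (deriv f z + deriv g z),
        sq_nonneg (‖deriv f z‖ - ‖deriv g z‖)]
    simp only [← ofReal_norm]
    rw [← ENNReal.ofReal_pow (norm_nonneg _), ← ENNReal.ofReal_pow (norm_nonneg _),
      ← ENNReal.ofReal_pow (norm_nonneg _), ← ENNReal.ofReal_add (by positivity) (by positivity),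
      ← ENNReal.ofReal_ofNat 2, ← ENNReal.ofReal_mul (by norm_num)]
    exact ENNReal.ofReal_le_ofReal h1
  refine hle.trans_lt ?_
  rw [lintegral_add_left hmeas, lintegral_const_mul' _ _ (by simp),
    lintegral_const_mul' _ _ (by simp)]
  exact ENNReal.add_lt_top.2 ⟨ENNReal.mul_lt_top (by simp) hf', ENNReal.mul_lt_top (by simp) hg'⟩

theorem dirichletIntegral_const_smul_lt_top {μ : Measure ℂ} {f : ℂ → ℂ} (c : ℂ)
    (hf' : dirichletIntegral μ f < ∞) : dirichletIntegral μ (c • f) < ∞ := by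
  have : dirichletIntegral μ (c • f) = ‖c‖ₑ ^ 2 * dirichletIntegral μ f := by
    unfold dirichletIntegral
    rw [← lintegral_const_mul' _ _ (by simp)]
    refine lintegral_congr fun z => ?_
    rw [deriv_const_smul_field, enorm_smul, mul_pow, mul_assoc]
  rw [this]
  exact ENNReal.mul_lt_top (by simp) hf'

/-- The Dirichlet space `𝓓_μ = {f ∈ H² : 𝓓_μ(f) < ∞}`. -/
def dirichletSpace (μ : Measure ℂ) [SFinite μ] : Submodule ℂ (ℂ → ℂ) where
  carrier := {f | MemHardy 2 f ∧ dirichletIntegral μ f < ∞}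
  add_mem' hf hg := ⟨hf.1.add hg.1, dirichletIntegral_add_lt_top hf.1.1 hg.1.1 hf.2 hg.2⟩
  zero_mem' := by
    refine ⟨⟨differentiableOn_const 0, ?_⟩, ?_⟩
    · simp [hardyNorm]
    · have h : deriv (0 : ℂ → ℂ) = 0 := by
        ext z
        exact deriv_const z 0
      simp [dirichletIntegral, h]
  smul_mem' c _ hf := ⟨hf.1.const_smul c, dirichletIntegral_const_smul_lt_top c hf.2⟩

/-- `M` is a closed subspace of `𝓓_μ`, invariant under the shift `g ↦ z g`. -/
structure IsClosedInvariant (μ : Measure ℂ) [SFinite μ] (M : Submodule ℂ (ℂ → ℂ)) : Prop where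
  le : M ≤ dirichletSpace μ
  closed : ∀ g ∈ dirichletSpace μ,
    (∀ ε : ℝ≥0∞, 0 < ε → ∃ u ∈ M, dirichletNormSq μ (g - u) < ε) → g ∈ M
  shift : ∀ g ∈ M, (fun z => z * g z) ∈ M

/-- `[f]`, the smallest closed invariant subspace of `𝓓_μ` that contains `f`. -/
def generatedSubspace (μ : Measure ℂ) [SFinite μ] (f : ℂ → ℂ) : Submodule ℂ (ℂ → ℂ) :=
  sInf {M | IsClosedInvariant μ M ∧ f ∈ M}

/-- `f` is cyclic in `𝓓_μ`: it belongs to `𝓓_μ` and `[f] = 𝓓_μ`. -/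
def IsCyclic (μ : Measure ℂ) [SFinite μ] (f : ℂ → ℂ) : Prop :=
  f ∈ dirichletSpace μ ∧ generatedSubspace μ f = dirichletSpace μ

/-- `A_μ(ζ, λ) = ∫_𝔻 (1 - |z|²) / |ζ - z|² · (1 - |z|²) / |λ - z|² dμ(z)`. -/
noncomputable def douglasKernel (μ : Measure ℂ) (ζ l : ℂ) : ℝ≥0∞ :=
  ∫⁻ z, ENNReal.ofReal
    ((1 - ‖z‖ ^ 2) / ‖ζ - z‖ ^ 2 * ((1 - ‖z‖ ^ 2) / ‖l - z‖ ^ 2)) ∂μ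

/-- The Dirichlet integral `∫_𝕋 ∫_𝕋 |g(ζ) - g(λ)|² A_μ(ζ, λ) dm(ζ) dm(λ)` of the harmonic
version `𝓓_μ^h` of `𝓓_μ`. -/
noncomputable def harmonicDirichletIntegral (μ : Measure ℂ) (g : ℂ → ℂ) : ℝ≥0∞ :=
  ∫⁻ l, ∫⁻ ζ, ‖g ζ - g l‖ₑ ^ 2 * douglasKernel μ ζ l ∂arcLength ∂arcLength

/-- Membership in `𝓓_μ^h = {g ∈ L²(𝕋) : 𝓓_μ^h(g) < ∞}`. -/
def MemHarmonicDirichlet (μ : Measure ℂ) (g : ℂ → ℂ) : Prop :=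
  MemLp g 2 arcLength ∧ harmonicDirichletIntegral μ g < ∞

/-- The capacity `c_μ(E)` of `E ⊆ 𝕋`: the infimum of `‖g‖²_{L²(𝕋)} + 𝓓_μ^h(g)` over all
`g ∈ 𝓓_μ^h` with `|g| ≥ 1` almost everywhere on `U ∩ 𝕋` for some open `U ⊇ E`. -/
noncomputable def capacity (μ : Measure ℂ) (E : Set ℂ) : ℝ≥0∞ :=
  ⨅ (g : ℂ → ℂ) (_ : MemHarmonicDirichlet μ g)
    (_ : ∃ U : Set ℂ, IsOpen U ∧ E ⊆ U ∧ ∀ᵐ ζ ∂arcLength, ζ ∈ U → 1 ≤ ‖g ζ‖),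
    eLpNorm g 2 arcLength ^ 2 + harmonicDirichletIntegral μ g

/-- `Z(f)`, the set of points of `𝕋` at which `f` has radial limit `0`. -/
def radialZeroSet (f : ℂ → ℂ) : Set ℂ :=
  {ζ | ζ ∈ Metric.sphere (0 : ℂ) 1 ∧ Tendsto (fun r : ℝ => f (r * ζ)) (𝓝[<] 1) (𝓝 0)}

end BrownShields

/-! By Fubini, `𝓓_μ(f)` is the `μ`-average of the local Dirichlet integrals `D_w(f)` (the case of a
unit point mass at `w`), and a Möbius change of variables gives
`D_w(f) = ½ (1 - |w|²) ‖(f - f(w)) / (z - w)‖²_{H²}`. Hence bounded holomorphic functions lie in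
`𝓓_μ`, and `ψ f ∈ [f]` whenever `ψ` is bounded and `ψ f ∈ 𝓓_μ`. If `f` is outer, with
`log |f| = h` on the circle, the outer functions `ψ_n` with modulus `exp (-max h (-n))` satisfy
`|ψ_n f| ≤ 1` and `ψ_n f → 1`, so `1 ∈ [f]`.

Conversely, if `f` is cyclic, then `p_n f → 1` in `H²` for some polynomials `p_n`, and Jensen's
inequality for `p_n` yields `∫ log |F| dm ≤ log |f(0)|` for the boundary function `F` of `f`.
Fatou's lemma bounds `log |f|` by the Poisson integral of `log |F|`, so the quotient of `f` by the
outer function with boundary modulus `|F|` is bounded by `1` and attains this bound at `0`: it is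
constant.

For an open set `U`, the integral `𝓓_μ^h(1_U)` is at most twice the mass that the balayage of `μ`
gives to `U`, and this balayage is absolutely continuous; so null sets have capacity zero. A
zero-free `H²` function has a null radial zero set, again by Fatou's lemma applied to `log |f|`. -/

namespace BrownShields

local notation "𝔻" => Metric.ball (0 : ℂ) 1

/-! ### Integration over the unit circle -/

section ArcLength

variable {E : Type*} [NormedAddCommGroup E]

instance : IsProbabilityMeasure arcLength := by
  constructor
  rw [arcLength, Measure.map_apply (continuous_circleMap 0 1).measurable MeasurableSet.univ]
  simp only [preimage_univ, Measure.smul_apply, Measure.restrict_apply MeasurableSet.univ,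
    univ_inter, Real.volume_Ioc, sub_zero, smul_eq_mul]
  exact ENNReal.inv_mul_cancel (by simp [Real.pi_pos]) ENNReal.ofReal_ne_top

lemma ae_norm_eq_one : ∀ᵐ ζ ∂arcLength, ‖ζ‖ = 1 := by
  filter_upwards [mem_ae_iff.2 arcLength_compl_sphere] with ζ hζ
  simpa using hζ

lemma aestronglyMeasurable_of_continuousOn_sphere {f : ℂ → E}
    (hf : ContinuousOn f (Metric.sphere 0 1)) : AEStronglyMeasurable f arcLength := by
  rw [← Measure.restrict_eq_self_of_ae_mem arcLength_compl_sphere]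
  exact hf.aestronglyMeasurable_of_isCompact (isCompact_sphere _ _)
    Metric.isClosed_sphere.measurableSet

lemma memLp_of_continuousOn_sphere (p : ℝ≥0∞) {f : ℂ → E}
    (hf : ContinuousOn f (Metric.sphere 0 1)) : MemLp f p arcLength := by
  obtain ⟨C, hC⟩ := (isCompact_sphere (0 : ℂ) 1).exists_bound_of_continuousOn hf
  refine .of_bound (aestronglyMeasurable_of_continuousOn_sphere hf) C ?_
  filter_upwards [ae_norm_eq_one] with ζ hζ
  exact hC ζ (by simpa using hζ)

lemma integrable_of_continuousOn_sphere {f : ℂ → E}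
    (hf : ContinuousOn f (Metric.sphere 0 1)) : Integrable f arcLength :=
  memLp_one_iff_integrable.1 (memLp_of_continuousOn_sphere 1 hf)

lemma integral_arcLength_eq_circleAverage [NormedSpace ℝ E] {f : ℂ → E}
    (hf : AEStronglyMeasurable f arcLength) :
    ∫ ζ, f ζ ∂arcLength = Real.circleAverage f 0 1 := by
  rw [arcLength] at hf ⊢
  rw [integral_map (continuous_circleMap 0 1).aemeasurable hf, integral_smul_measure,
    Real.circleAverage_def, intervalIntegral.integral_of_le Real.two_pi_pos.le]
  simp [Real.pi_pos.le]

lemma integrable_arcLength_iff_circleIntegrable {f : ℂ → E}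
    (hf : AEStronglyMeasurable f arcLength) :
    Integrable f arcLength ↔ CircleIntegrable f 0 1 := by
  rw [arcLength] at hf ⊢
  rw [integrable_map_measure hf (continuous_circleMap 0 1).aemeasurable, CircleIntegrable,
    intervalIntegrable_iff_integrableOn_Ioc_of_le Real.two_pi_pos.le,
    integrable_smul_measure (ENNReal.inv_ne_zero.2 ENNReal.ofReal_ne_top)
      (by simp [Real.pi_pos])]
  rfl

lemma lintegral_arcLength {g : ℂ → ℝ≥0∞} (hg : Measurable g) :
    ∫⁻ ζ, g ζ ∂arcLength =
      (ENNReal.ofReal (2 * Real.pi))⁻¹ *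
        ∫⁻ θ in Ioo (-Real.pi) Real.pi, g (circleMap 0 1 θ) := by
  rw [arcLength, lintegral_map hg (continuous_circleMap 0 1).measurable, lintegral_smul_measure,
    smul_eq_mul]
  congr 1
  have hIoc (t : ℝ) := isAddFundamentalDomain_Ioc Real.two_pi_pos t
  have hshift := (hIoc 0).setLIntegral_eq (hIoc (-Real.pi)) (fun θ => g (circleMap 0 1 θ)) (by
    rintro ⟨x, hx⟩ θ
    obtain ⟨n, rfl⟩ := AddSubgroup.mem_zmultiples_iff.1 hx
    rw [AddSubgroup.mk_vadd, vadd_eq_add, add_comm, (periodic_circleMap 0 1).zsmul n θ])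
  have hπ : -Real.pi + 2 * Real.pi = Real.pi := by ring
  rw [zero_add, hπ] at hshift
  rw [hshift, setLIntegral_congr Ioo_ae_eq_Ioc.symm]

end ArcLength

lemma ofReal_mul_mem_disc {r : ℝ} {z : ℂ} (h0 : 0 ≤ r) (h1 : r < 1) (hz : ‖z‖ ≤ 1) :
    (r : ℂ) * z ∈ 𝔻 := by
  have : ‖(r : ℂ) * z‖ = r * ‖z‖ := by simp [abs_of_nonneg h0]
  simp only [mem_ball_zero_iff, this]
  nlinarith [norm_nonneg z]

lemma tendsto_ofReal_mul (z : ℂ) : Tendsto (fun r : ℝ => (r : ℂ) * z) (𝓝[<] 1) (𝓝 z) := by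
  have hcont : Continuous fun r : ℝ => (r : ℂ) * z := by fun_prop
  simpa using (hcont.continuousWithinAt (s := Iio 1) (x := 1)).tendsto

lemma one_sub_norm_sq_pos {w : ℂ} (hw : w ∈ 𝔻) : 0 < 1 - ‖w‖ ^ 2 := by
  have : ‖w‖ < 1 := by simpa using hw
  nlinarith [norm_nonneg w]

lemma sub_ne_zero_of_mem_disc {ζ z : ℂ} (hζ : ‖ζ‖ = 1) (hz : z ∈ 𝔻) : ζ - z ≠ 0 := by
  rw [sub_ne_zero]
  rintro rfl
  simp [hζ] at hz

lemma diffContOnCl_of_differentiableOn_closedBall {F : ℂ → ℂ}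
    (hF : DifferentiableOn ℂ F (Metric.closedBall 0 1)) : DiffContOnCl ℂ F 𝔻 :=
  DifferentiableOn.diffContOnCl (by rwa [closure_ball _ one_ne_zero])

lemma diffContOnCl_dilation {f : ℂ → ℂ} (hf : DifferentiableOn ℂ f 𝔻) {r : ℝ}
    (h0 : 0 ≤ r) (h1 : r < 1) : DiffContOnCl ℂ (fun z => f (r * z)) 𝔻 :=
  diffContOnCl_of_differentiableOn_closedBall <|
    hf.comp (by fun_prop) fun z hz => ofReal_mul_mem_disc h0 h1 (by simpa using hz)

lemma continuousOn_sphere_of_diffContOnCl {f : ℂ → ℂ} (hf : DiffContOnCl ℂ f 𝔻) :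
    ContinuousOn f (Metric.sphere 0 1) :=
  hf.continuousOn.mono (by
    rw [closure_ball _ one_ne_zero]
    exact Metric.sphere_subset_closedBall)

lemma continuousOn_sphere_dilation {f : ℂ → ℂ} (hf : DifferentiableOn ℂ f 𝔻) {r : ℝ}
    (h0 : 0 ≤ r) (h1 : r < 1) : ContinuousOn (fun ζ : ℂ => f (r * ζ)) (Metric.sphere 0 1) :=
  continuousOn_sphere_of_diffContOnCl (diffContOnCl_dilation hf h0 h1)

lemma integral_arcLength_eq_apply_zero {f : ℂ → ℂ} (hf : DiffContOnCl ℂ f 𝔻) :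
    ∫ ζ, f ζ ∂arcLength = f 0 := by
  rw [integral_arcLength_eq_circleAverage
    (aestronglyMeasurable_of_continuousOn_sphere (continuousOn_sphere_of_diffContOnCl hf))]
  exact DiffContOnCl.circleAverage (by simpa using hf)

lemma integral_pow_arcLength (k : ℕ) : ∫ ζ, ζ ^ k ∂arcLength = if k = 0 then 1 else 0 := by
  rw [integral_arcLength_eq_apply_zero (f := fun ζ => ζ ^ k)
    (Differentiable.diffContOnCl (by fun_prop))]
  exact zero_pow_eq k

/-- The Poisson kernel of the unit disc, for `w ∈ 𝔻` and `‖ζ‖ = 1`. On the circle it agrees with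
`poissonKernel 0 w ζ`; this form is the one that enters `douglasKernel`. -/
noncomputable def poisson (w ζ : ℂ) : ℝ := (1 - ‖w‖ ^ 2) / ‖ζ - w‖ ^ 2

lemma poisson_eq_poissonKernel {ζ : ℂ} (hζ : ‖ζ‖ = 1) (w : ℂ) :
    poisson w ζ = poissonKernel 0 w ζ := by
  simp [poisson, poissonKernel_def, hζ]

lemma poisson_nonneg {w : ℂ} (hw : w ∈ 𝔻) (ζ : ℂ) : 0 ≤ poisson w ζ :=
  div_nonneg (one_sub_norm_sq_pos hw).le (sq_nonneg _)

lemma measurable_poisson : Measurable fun p : ℂ × ℂ => poisson p.1 p.2 := by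
  unfold poisson
  fun_prop

lemma continuousOn_poisson {w : ℂ} (hw : w ∈ 𝔻) :
    ContinuousOn (poisson w) (Metric.sphere 0 1) :=
  ContinuousOn.div (by fun_prop) (by fun_prop) fun ζ hζ =>
    pow_ne_zero 2 (norm_ne_zero_iff.2 (sub_ne_zero_of_mem_disc (by simpa using hζ) hw))

lemma integral_poisson_smul {f : ℂ → ℂ} (hf : DiffContOnCl ℂ f 𝔻) {w : ℂ} (hw : w ∈ 𝔻) :
    ∫ ζ, poisson w ζ • f ζ ∂arcLength = f w := by
  rw [integral_arcLength_eq_circleAverage, ← hf.circleAverage_poissonKernel_smul' hw]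
  · refine Real.circleAverage_congr_sphere fun ζ hζ => ?_
    have : ‖ζ‖ = 1 := by simpa using hζ
    simp [poisson, this]
  · exact aestronglyMeasurable_of_continuousOn_sphere
      ((continuousOn_poisson hw).smul (continuousOn_sphere_of_diffContOnCl hf))

lemma integral_poisson {w : ℂ} (hw : w ∈ 𝔻) : ∫ ζ, poisson w ζ ∂arcLength = 1 := by
  have h := integral_poisson_smul (f := fun _ => 1) diffContOnCl_const hw
  simp only [Complex.real_smul, mul_one] at h
  rwa [integral_complex_ofReal, Complex.ofReal_eq_one] at h

lemma lintegral_poisson {w : ℂ} (hw : w ∈ 𝔻) :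
    ∫⁻ ζ, ENNReal.ofReal (poisson w ζ) ∂arcLength = 1 := by
  rw [← ofReal_integral_eq_lintegral_ofReal
    (integrable_of_continuousOn_sphere (continuousOn_poisson hw))
    (ae_of_all _ (poisson_nonneg hw)), integral_poisson hw, ENNReal.ofReal_one]

section Parseval

variable {X : Type*} [MeasurableSpace X] {ν : Measure X} {e : X → ℂ}

lemma integral_pow_mul_conj_pow (he : ∀ᵐ x ∂ν, ‖e x‖ = 1)
    (hν : ∀ k : ℕ, ∫ x, e x ^ k ∂ν = if k = 0 then 1 else 0) (n m : ℕ) :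
    ∫ x, e x ^ n * conj (e x ^ m) ∂ν = if n = m then 1 else 0 := by
  wlog h : m ≤ n generalizing n m
  · have := this m n (le_of_not_ge h)
    rw [← Complex.conj_conj (∫ x, e x ^ n * conj (e x ^ m) ∂ν), ← integral_conj]
    simp only [map_mul, Complex.conj_conj]
    simp_rw [mul_comm (conj _) (_ ^ m), this, eq_comm (a := n)]
    split_ifs <;> simp
  obtain ⟨k, rfl⟩ := Nat.exists_eq_add_of_le h
  have hcancel : ∫ x, e x ^ (m + k) * conj (e x ^ m) ∂ν = ∫ x, e x ^ k ∂ν := by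
    refine integral_congr_ae ?_
    filter_upwards [he] with x hx
    rw [pow_add, mul_right_comm, Complex.mul_conj]
    simp [Complex.normSq_eq_norm_sq, hx]
  rw [hcancel, hν]
  simp

lemma integral_norm_sq_sum_mul_pow [IsFiniteMeasure ν] (hm : AEStronglyMeasurable e ν)
    (he : ∀ᵐ x ∂ν, ‖e x‖ = 1) (hν : ∀ k : ℕ, ∫ x, e x ^ k ∂ν = if k = 0 then 1 else 0)
    (c : ℕ → ℂ) (s : Finset ℕ) :
    ∫ x, ‖∑ n ∈ s, c n * e x ^ n‖ ^ 2 ∂ν = ∑ n ∈ s, ‖c n‖ ^ 2 := by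
  have hexpand (x : X) : ((‖∑ n ∈ s, c n * e x ^ n‖ ^ 2 : ℝ) : ℂ) =
      ∑ n ∈ s, ∑ m ∈ s, c n * conj (c m) * (e x ^ n * conj (e x ^ m)) := by
    rw [Complex.ofReal_pow, ← Complex.mul_conj', map_sum, Finset.sum_mul_sum]
    refine Finset.sum_congr rfl fun n _ => Finset.sum_congr rfl fun m _ => ?_
    rw [map_mul]
    ring
  have hint (n m : ℕ) : Integrable (fun x => c n * conj (c m) * (e x ^ n * conj (e x ^ m))) ν := by
    refine Integrable.const_mul (Integrable.of_bound
      ((hm.pow n).mul (Complex.continuous_conj.comp_aestronglyMeasurable (hm.pow m))) 1 ?_) _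
    filter_upwards [he] with x hx
    simp [hx]
  apply Complex.ofReal_injective
  rw [← integral_complex_ofReal]
  simp_rw [hexpand]
  rw [integral_finsetSum _ fun n _ => integrable_finsetSum _ fun m _ => hint n m]
  simp_rw [integral_finsetSum _ fun m _ => hint _ m, integral_const_mul,
    integral_pow_mul_conj_pow he hν, mul_ite, mul_one, mul_zero]
  simp +contextual [Complex.mul_conj']

lemma lintegral_enorm_sq_tsum_mul_pow [IsFiniteMeasure ν] (hm : AEStronglyMeasurable e ν)
    (he : ∀ᵐ x ∂ν, ‖e x‖ = 1) (hν : ∀ k : ℕ, ∫ x, e x ^ k ∂ν = if k = 0 then 1 else 0)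
    {c : ℕ → ℂ} (hc : Summable fun n => ‖c n‖) :
    ∫⁻ x, ‖∑' n, c n * e x ^ n‖ₑ ^ 2 ∂ν = ∑' n, ‖c n‖ₑ ^ 2 := by
  have hsummable : ∀ᵐ x ∂ν, Summable fun n => ‖c n * e x ^ n‖ := by
    filter_upwards [he] with x hx
    simpa [hx] using hc
  have hpartial (N : ℕ) : AEStronglyMeasurable
      (fun x => ∑ n ∈ Finset.range N, c n * e x ^ n) ν :=
    Finset.aestronglyMeasurable_fun_sum _ fun n _ => (hm.pow n).const_mul _
  have hlim : Tendsto (fun N => ∫⁻ x, ‖∑ n ∈ Finset.range N, c n * e x ^ n‖ₑ ^ 2 ∂ν) atTop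
      (𝓝 (∫⁻ x, ‖∑' n, c n * e x ^ n‖ₑ ^ 2 ∂ν)) := by
    refine tendsto_lintegral_of_dominated_convergence' (fun _ => (∑' n, ‖c n‖ₑ) ^ 2)
      (fun N => (hpartial N).enorm.pow_const 2) (fun N => ?_) ?_ ?_
    · filter_upwards [he] with x hx
      gcongr
      refine (enorm_sum_le _ _).trans ?_
      simpa [enorm_mul, ← ofReal_norm, hx] using
        ENNReal.sum_le_tsum (f := fun n => ENNReal.ofReal ‖c n‖) (Finset.range N)
    · rw [lintegral_const]
      refine ENNReal.mul_ne_top (ENNReal.pow_ne_top ?_) (measure_ne_top ν _)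
      simpa only [ofReal_norm] using hc.tsum_ofReal_ne_top
    · filter_upwards [hsummable] with x hx
      exact (ENNReal.continuous_pow 2).continuousAt.tendsto.comp
        hx.of_norm.hasSum.tendsto_sum_nat.enorm
  have hfinite (N : ℕ) : ∫⁻ x, ‖∑ n ∈ Finset.range N, c n * e x ^ n‖ₑ ^ 2 ∂ν =
      ∑ n ∈ Finset.range N, ‖c n‖ₑ ^ 2 := by
    have hint : Integrable (fun x => ‖∑ n ∈ Finset.range N, c n * e x ^ n‖ ^ 2) ν := by
      refine Integrable.of_bound ((hpartial N).norm.pow 2)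
        ((∑ n ∈ Finset.range N, ‖c n‖) ^ 2) ?_
      filter_upwards [he] with x hx
      rw [norm_pow, norm_norm]
      gcongr
      exact norm_sum_le_of_le _ fun n _ => by simp [hx]
    have h := ofReal_integral_eq_lintegral_ofReal hint (ae_of_all _ fun x => sq_nonneg _)
    rw [integral_norm_sq_sum_mul_pow hm he hν,
      ENNReal.ofReal_sum_of_nonneg fun n _ => sq_nonneg _] at h
    simpa only [ENNReal.ofReal_pow (norm_nonneg _), ofReal_norm] using h.symm
  simp_rw [hfinite] at hlim
  exact tendsto_nhds_unique hlim ENNReal.summable.hasSum.tendsto_sum_nat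

end Parseval

lemma eLpNorm_two_sq {X E : Type*} [MeasurableSpace X] [NormedAddCommGroup E] {ν : Measure X}
    (f : X → E) : eLpNorm f 2 ν ^ 2 = ∫⁻ x, ‖f x‖ₑ ^ 2 ∂ν := by
  simpa using eLpNorm_nnreal_pow_eq_lintegral (f := f) (μ := ν) (p := 2) two_ne_zero

lemma sq_le_iff_le_rpow_half {a C : ℝ≥0∞} : a ^ 2 ≤ C ↔ a ≤ C ^ (1 / 2 : ℝ) := by
  rw [one_div, ENNReal.le_rpow_inv_iff (by norm_num), ENNReal.rpow_two]

lemma add_sq_le_two_mul (a b : ℝ≥0∞) : (a + b) ^ 2 ≤ 2 * a ^ 2 + 2 * b ^ 2 := by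
  have := ENNReal.rpow_add_le_mul_rpow_add_rpow a b (p := 2) (by norm_num)
  norm_num at this
  rwa [mul_add] at this

lemma tendsto_zero_of_tendsto_sq_zero {ι : Type*} {l : Filter ι} {u : ι → ℝ≥0∞}
    (h : Tendsto (fun i => u i ^ 2) l (𝓝 0)) : Tendsto u l (𝓝 0) := by
  rw [ENNReal.tendsto_nhds_zero] at h ⊢
  intro ε hε
  filter_upwards [h (ε ^ 2) (ENNReal.pow_pos hε 2)] with i hi
  exact (ENNReal.pow_le_pow_left_iff two_ne_zero).1 hi

lemma tsum_mul_sq_le (a b : ℕ → ℝ≥0∞) :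
    (∑' n, a n * b n) ^ 2 ≤ (∑' n, a n ^ 2) * ∑' n, b n ^ 2 := by
  have h := ENNReal.lintegral_mul_le_Lp_mul_Lq Measure.count Real.HolderConjugate.two_two
    (Measurable.of_discrete (f := a)).aemeasurable (Measurable.of_discrete (f := b)).aemeasurable
  simp only [lintegral_count, Pi.mul_apply, ENNReal.rpow_two] at h
  rwa [← ENNReal.mul_rpow_of_nonneg _ _ (by norm_num), ← sq_le_iff_le_rpow_half] at h

/-! ### The Hardy norm -/

section HardyNorm

variable {p : ℝ≥0∞} {f g : ℂ → ℂ}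

lemma eLpNorm_dilation_le_hardyNorm (p : ℝ≥0∞) (f : ℂ → ℂ) {r : ℝ} (hr : r ∈ Ico (0 : ℝ) 1) :
    eLpNorm (fun ζ : ℂ => f (r * ζ)) p arcLength ≤ hardyNorm p f :=
  le_iSup₂_of_le r hr le_rfl

lemma hardyNorm_sq_le_iff {C : ℝ≥0∞} :
    hardyNorm 2 f ^ 2 ≤ C ↔
      ∀ r ∈ Ico (0 : ℝ) 1, ∫⁻ ζ, ‖f (r * ζ)‖ₑ ^ 2 ∂arcLength ≤ C := by
  simp_rw [sq_le_iff_le_rpow_half, hardyNorm, iSup₂_le_iff, ← sq_le_iff_le_rpow_half,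
    eLpNorm_two_sq]

lemma lintegral_dilation_le_hardyNorm_sq (f : ℂ → ℂ) {r : ℝ} (hr : r ∈ Ico (0 : ℝ) 1) :
    ∫⁻ ζ, ‖f (r * ζ)‖ₑ ^ 2 ∂arcLength ≤ hardyNorm 2 f ^ 2 :=
  hardyNorm_sq_le_iff.1 le_rfl r hr

lemma hardyNorm_congr (h : EqOn f g 𝔻) : hardyNorm p f = hardyNorm p g := by
  refine iSup_congr fun r => iSup_congr fun hr => eLpNorm_congr_ae ?_
  filter_upwards [ae_norm_eq_one] with ζ hζ
  exact h (ofReal_mul_mem_disc hr.1 hr.2 hζ.le)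

lemma hardyNorm_add_le (hp : 1 ≤ p) (hf : DifferentiableOn ℂ f 𝔻) (hg : DifferentiableOn ℂ g 𝔻) :
    hardyNorm p (f + g) ≤ hardyNorm p f + hardyNorm p g :=
  iSup₂_le fun _ hr =>
    (eLpNorm_add_le (aestronglyMeasurable_dilation hf hr)
      (aestronglyMeasurable_dilation hg hr) hp).trans
      (add_le_add (eLpNorm_dilation_le_hardyNorm p f hr) (eLpNorm_dilation_le_hardyNorm p g hr))

lemma hardyNorm_neg (f : ℂ → ℂ) : hardyNorm p (-f) = hardyNorm p f :=
  iSup_congr fun r => iSup_congr fun _ => eLpNorm_neg (fun ζ : ℂ => f (r * ζ)) p arcLength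

lemma hardyNorm_sub_comm (f g : ℂ → ℂ) : hardyNorm p (f - g) = hardyNorm p (g - f) := by
  rw [← hardyNorm_neg, neg_sub]

lemma hardyNorm_sub_le (hp : 1 ≤ p) (hf : DifferentiableOn ℂ f 𝔻) (hg : DifferentiableOn ℂ g 𝔻) :
    hardyNorm p (f - g) ≤ hardyNorm p f + hardyNorm p g := by
  rw [sub_eq_add_neg, ← hardyNorm_neg g]
  exact hardyNorm_add_le hp hf hg.neg

lemma hardyNorm_const_mul (c : ℂ) (f : ℂ → ℂ) :
    hardyNorm p (fun z => c * f z) = ‖c‖ₑ * hardyNorm p f := by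
  simp only [hardyNorm, ENNReal.mul_iSup]
  exact iSup_congr fun r => iSup_congr fun _ =>
    eLpNorm_const_smul c (fun ζ : ℂ => f (r * ζ)) p arcLength

lemma hardyNorm_mul_le {ψ : ℂ → ℂ} {A : ℝ} (hψ : ∀ z ∈ 𝔻, ‖ψ z‖ ≤ A) :
    hardyNorm p (ψ * f) ≤ ENNReal.ofReal A * hardyNorm p f := by
  refine iSup₂_le fun r hr => (eLpNorm_le_mul_eLpNorm_of_ae_le_mul ?_ p).trans
    (mul_le_mul_right (eLpNorm_dilation_le_hardyNorm p f hr) _)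
  filter_upwards [ae_norm_eq_one] with ζ hζ
  rw [Pi.mul_apply, norm_mul]
  gcongr
  exact hψ _ (ofReal_mul_mem_disc hr.1 hr.2 hζ.le)

lemma hardyNorm_const_le (c : ℂ) : hardyNorm p (fun _ => c) ≤ ‖c‖ₑ := by
  refine iSup₂_le fun r _ => ?_
  rcases eq_or_ne p 0 with rfl | hp
  · simp
  · simp [eLpNorm_const _ hp (NeZero.ne arcLength)]

lemma hardyNorm_le_of_bound {A : ℝ} (hf : ∀ z ∈ 𝔻, ‖f z‖ ≤ A) :
    hardyNorm p f ≤ ENNReal.ofReal A :=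
  calc hardyNorm p f = hardyNorm p (f * fun _ => 1) := hardyNorm_congr fun z _ => by simp
    _ ≤ ENNReal.ofReal A * hardyNorm p (fun _ => 1) := hardyNorm_mul_le hf
    _ ≤ ENNReal.ofReal A * 1 := by
      gcongr
      simpa using hardyNorm_const_le (p := p) 1
    _ = ENNReal.ofReal A := mul_one _

lemma hardyNorm_le_of_tendsto {ι : Type*} {l : Filter ι} [l.NeBot] [l.IsCountablyGenerated]
    {F : ι → ℂ → ℂ} {C : ℝ≥0∞} (hF : ∀ᶠ i in l, DifferentiableOn ℂ (F i) 𝔻 ∧ hardyNorm p (F i) ≤ C)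
    (hlim : ∀ z ∈ 𝔻, Tendsto (fun i => F i z) l (𝓝 (f z))) : hardyNorm p f ≤ C := by
  obtain ⟨i, hi, hFi⟩ := exists_seq_forall_of_frequently hF.frequently
  refine iSup₂_le fun r hr => ?_
  refine (Lp.eLpNorm_lim_le_liminf_eLpNorm (f := fun n (ζ : ℂ) => F (i n) (r * ζ))
    (fun n => aestronglyMeasurable_dilation (hFi n).1 hr) _ ?_).trans ?_
  · filter_upwards [ae_norm_eq_one] with ζ hζ
    exact (hlim _ (ofReal_mul_mem_disc hr.1 hr.2 hζ.le)).comp hi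
  · exact liminf_le_of_frequently_le' (Frequently.of_forall fun n =>
      (eLpNorm_dilation_le_hardyNorm p (F (i n)) hr).trans (hFi n).2)

lemma hardyNorm_dilation_le (f : ℂ → ℂ) {s : ℝ} (hs : 0 ≤ s) (hs' : s ≤ 1) :
    hardyNorm p (fun z => f (s * z)) ≤ hardyNorm p f := by
  refine iSup₂_le fun r hr => ?_
  refine le_iSup₂_of_le (s * r) ⟨mul_nonneg hs hr.1, ?_⟩ (by simp [mul_assoc])
  nlinarith [hr.1, hr.2]

lemma differentiableOn_dilation (hf : DifferentiableOn ℂ f 𝔻) {s : ℝ} (hs : 0 ≤ s) (hs' : s ≤ 1) :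
    DifferentiableOn ℂ (fun z => f (s * z)) 𝔻 := by
  refine hf.comp (by fun_prop) fun z hz => ?_
  simp only [mem_ball_zero_iff, norm_mul, Complex.norm_real, Real.norm_eq_abs,
    abs_of_nonneg hs] at hz ⊢
  nlinarith [norm_nonneg z]

end HardyNorm

section PowerSeries

variable {f : ℂ → ℂ} {a : ℕ → ℂ}

lemma exists_hasSum_mul_pow (hf : DifferentiableOn ℂ f 𝔻) :
    ∃ a : ℕ → ℂ, ∀ z ∈ 𝔻, HasSum (fun n => a n * z ^ n) (f z) := by
  refine ⟨fun n => (n.factorial : ℂ)⁻¹ * iteratedDeriv n f 0, fun z hz => ?_⟩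
  have := Complex.hasSum_taylorSeries_on_ball (c := 0) (r := 1) hf (z := z) (by simpa using hz)
  refine this.congr_fun fun n => ?_
  simp [mul_comm, mul_left_comm]

lemma lintegral_dilation_eq_tsum {r : ℝ} (hr : 0 ≤ r)
    (hf : ∀ z : ℂ, ‖z‖ = r → HasSum (fun n => a n * z ^ n) (f z)) :
    ∫⁻ ζ, ‖f (r * ζ)‖ₑ ^ 2 ∂arcLength = ∑' n, ‖a n * r ^ n‖ₑ ^ 2 := by
  rw [← lintegral_enorm_sq_tsum_mul_pow aestronglyMeasurable_id ae_norm_eq_one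
    integral_pow_arcLength (hf r (by simp [abs_of_nonneg hr])).summable.norm]
  refine lintegral_congr_ae ?_
  filter_upwards [ae_norm_eq_one] with ζ hζ
  rw [← (hf (r * ζ) (by simp [hζ, abs_of_nonneg hr])).tsum_eq]
  simp [mul_pow, mul_assoc]

lemma hardyNorm_sq_eq_tsum (hf : ∀ z ∈ 𝔻, HasSum (fun n => a n * z ^ n) (f z)) :
    hardyNorm 2 f ^ 2 = ∑' n, ‖a n‖ₑ ^ 2 := by
  have hdil (r : ℝ) (hr : r ∈ Ico (0 : ℝ) 1) :
      ∫⁻ ζ, ‖f (r * ζ)‖ₑ ^ 2 ∂arcLength = ∑' n, ‖a n * r ^ n‖ₑ ^ 2 :=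
    lintegral_dilation_eq_tsum hr.1 fun z hz => hf z (by simp [hz, hr.2])
  apply le_antisymm
  · rw [hardyNorm_sq_le_iff]
    intro r hr
    rw [hdil r hr]
    refine ENNReal.tsum_le_tsum fun n => ?_
    gcongr
    rw [enorm_mul, enorm_pow]
    refine mul_le_of_le_one_right' (pow_le_one' ?_ n)
    rw [← ofReal_norm, ENNReal.ofReal_le_one]
    simpa [abs_of_nonneg hr.1] using hr.2.le
  · refine ENNReal.tsum_le_of_sum_range_le fun k => ?_
    have hcont : Continuous fun r : ℝ => ∑ n ∈ Finset.range k, ‖a n * r ^ n‖ₑ ^ 2 := by fun_prop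
    have hlim := (hcont.continuousWithinAt (s := Iio 1) (x := 1)).tendsto
    simp only [Complex.ofReal_one, one_pow, mul_one] at hlim
    refine le_of_tendsto hlim ?_
    filter_upwards [Ico_mem_nhdsLT zero_lt_one] with r hr
    exact ((ENNReal.sum_le_tsum _).trans_eq (hdil r hr).symm).trans
      (lintegral_dilation_le_hardyNorm_sq f hr)

lemma lintegral_dilation_mono (hf : DifferentiableOn ℂ f 𝔻) {r s : ℝ} (hr : 0 ≤ r)
    (hrs : r ≤ s) (hs : s < 1) :
    ∫⁻ ζ, ‖f (r * ζ)‖ₑ ^ 2 ∂arcLength ≤ ∫⁻ ζ, ‖f (s * ζ)‖ₑ ^ 2 ∂arcLength := by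
  obtain ⟨a, ha⟩ := exists_hasSum_mul_pow hf
  rw [lintegral_dilation_eq_tsum hr fun z hz => ha z (by simp [hz, hrs.trans_lt hs]),
    lintegral_dilation_eq_tsum (hr.trans hrs) fun z hz => ha z (by simp [hz, hs])]
  refine ENNReal.tsum_le_tsum fun n => ?_
  gcongr ?_ ^ 2
  rw [enorm_le_iff_norm_le]
  simp only [norm_mul, norm_pow, Complex.norm_real, Real.norm_eq_abs]
  gcongr

lemma hardyNorm_sq_le_of_tendsto (hf : DifferentiableOn ℂ f 𝔻) {C : ℝ → ℝ≥0∞} {C₀ : ℝ≥0∞}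
    (h : ∀ᶠ s : ℝ in 𝓝[<] 1, ∫⁻ ζ, ‖f (s * ζ)‖ₑ ^ 2 ∂arcLength ≤ C s)
    (hC : Tendsto C (𝓝[<] 1) (𝓝 C₀)) : hardyNorm 2 f ^ 2 ≤ C₀ := by
  rw [hardyNorm_sq_le_iff]
  intro r hr
  refine ge_of_tendsto hC ?_
  filter_upwards [h, Ioo_mem_nhdsLT hr.2] with s hs hrs
  exact (lintegral_dilation_mono hf hr.1 hrs.1.le hrs.2).trans hs

lemma hardyNorm_dilation_sub_sq_eq_tsum (hf : ∀ z ∈ 𝔻, HasSum (fun n => a n * z ^ n) (f z))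
    {s : ℝ} (hs : s ∈ Ico (0 : ℝ) 1) :
    hardyNorm 2 ((fun z => f (s * z)) - f) ^ 2 = ∑' n, ‖a n * (s ^ n - 1)‖ₑ ^ 2 := by
  refine hardyNorm_sq_eq_tsum fun z hz => ?_
  have hsz := hf (s * z) (ofReal_mul_mem_disc hs.1 hs.2 (mem_ball_zero_iff.1 hz).le)
  refine (hsz.sub (hf z hz)).congr_fun fun n => ?_
  ring

lemma tendsto_hardyNorm_dilation_sub (hf : MemHardy 2 f) :
    Tendsto (fun s : ℝ => hardyNorm 2 ((fun z => f (s * z)) - f)) (𝓝[<] 1) (𝓝 0) := by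
  obtain ⟨a, ha⟩ := exists_hasSum_mul_pow hf.1
  have hfin : ∑' n, ‖a n‖ₑ ^ 2 ≠ ∞ := by
    rw [← hardyNorm_sq_eq_tsum ha]
    exact ENNReal.pow_ne_top hf.2.ne
  have hradii : ∀ᶠ s : ℝ in 𝓝[<] 1, s ∈ Ico (0 : ℝ) 1 := Ico_mem_nhdsLT zero_lt_one
  have hbound (s : ℝ) (hs : s ∈ Ico (0 : ℝ) 1) (n : ℕ) :
      ‖a n * ((s : ℂ) ^ n - 1)‖ₑ ^ 2 ≤ ‖a n‖ₑ ^ 2 := by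
    have hsn : ‖(s : ℂ) ^ n - 1‖ ≤ 1 := by
      have : (s : ℂ) ^ n - 1 = ((s ^ n - 1 : ℝ) : ℂ) := by push_cast; ring
      rw [this, Complex.norm_real, Real.norm_eq_abs, abs_le]
      constructor <;> linarith [pow_le_one₀ hs.1 hs.2.le (n := n), pow_nonneg hs.1 n]
    gcongr
    rw [enorm_mul]
    exact mul_le_of_le_one_right' (by simpa [← ofReal_norm] using hsn)
  have hlim : Tendsto (fun s : ℝ => ∫⁻ n, ‖a n * ((s : ℂ) ^ n - 1)‖ₑ ^ 2 ∂Measure.count)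
      (𝓝[<] 1) (𝓝 (∫⁻ _, 0 ∂(Measure.count : Measure ℕ))) := by
    refine tendsto_lintegral_filter_of_dominated_convergence (fun n => ‖a n‖ₑ ^ 2)
      (Eventually.of_forall fun _ => Measurable.of_discrete)
      (hradii.mono fun s hs => ae_of_all _ (hbound s hs)) (by rwa [lintegral_count])
      (ae_of_all _ fun n => ?_)
    have hcont : Continuous fun s : ℝ => ‖a n * ((s : ℂ) ^ n - 1)‖ₑ ^ 2 := by fun_prop
    simpa using (hcont.continuousWithinAt (s := Iio 1) (x := 1)).tendsto
  rw [lintegral_zero] at hlim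
  refine tendsto_zero_of_tendsto_sq_zero (hlim.congr' ?_)
  filter_upwards [hradii] with s hs
  rw [lintegral_count, hardyNorm_dilation_sub_sq_eq_tsum ha hs]

lemma enorm_sq_mul_le_hardyNorm_sq (hf : DifferentiableOn ℂ f 𝔻) {w : ℂ} (hw : w ∈ 𝔻) :
    ‖f w‖ₑ ^ 2 * ENNReal.ofReal (1 - ‖w‖ ^ 2) ≤ hardyNorm 2 f ^ 2 := by
  obtain ⟨a, ha⟩ := exists_hasSum_mul_pow hf
  have hpos := one_sub_norm_sq_pos hw
  have hgeometric : ∑' n, (‖w‖ₑ ^ n) ^ 2 = (ENNReal.ofReal (1 - ‖w‖ ^ 2))⁻¹ := by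
    simp_rw [← pow_mul, mul_comm _ 2, pow_mul]
    rw [ENNReal.tsum_geometric, ENNReal.ofReal_sub _ (sq_nonneg _),
      ENNReal.ofReal_pow (norm_nonneg _), ofReal_norm, ENNReal.ofReal_one]
  have hle : ‖f w‖ₑ ≤ ∑' n, ‖a n‖ₑ * ‖w‖ₑ ^ n := by
    rw [← (ha w hw).tsum_eq]
    simpa [enorm_mul, enorm_pow] using enorm_tsum_le_tsum_enorm (f := fun n => a n * w ^ n)
  calc ‖f w‖ₑ ^ 2 * ENNReal.ofReal (1 - ‖w‖ ^ 2)
      ≤ (∑' n, ‖a n‖ₑ ^ 2) * (ENNReal.ofReal (1 - ‖w‖ ^ 2))⁻¹ *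
          ENNReal.ofReal (1 - ‖w‖ ^ 2) := by
        gcongr
        exact (pow_le_pow_left' hle 2).trans ((tsum_mul_sq_le _ _).trans_eq (by rw [hgeometric]))
    _ = hardyNorm 2 f ^ 2 := by
        rw [mul_assoc, ENNReal.inv_mul_cancel (by simpa using hpos) ENNReal.ofReal_ne_top, mul_one,
          hardyNorm_sq_eq_tsum ha]

end PowerSeries

/-! ### Difference quotients -/

section Dslope

variable {f q : ℂ → ℂ} {w : ℂ}

lemma differentiableOn_dslope_disc (hf : DifferentiableOn ℂ f 𝔻) (hw : w ∈ 𝔻) :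
    DifferentiableOn ℂ (dslope f w) 𝔻 :=
  (Complex.differentiableOn_dslope (Metric.isOpen_ball.mem_nhds hw)).2 hf

lemma eq_add_sub_mul_dslope (f : ℂ → ℂ) (w z : ℂ) : f z = f w + (z - w) * dslope f w z := by
  linear_combination -sub_smul_dslope f w z

lemma norm_dslope_of_ne {z : ℂ} (h : z ≠ w) : ‖dslope f w z‖ = ‖f z - f w‖ / ‖z - w‖ := by
  rw [dslope_of_ne f h, slope_def_field, norm_div]

lemma dslope_eqOn {c : ℂ} (hw : w ∈ 𝔻) (hq : DifferentiableOn ℂ q 𝔻)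
    (h : ∀ z ∈ 𝔻, f z = c + (z - w) * q z) : EqOn (dslope f w) q 𝔻 := by
  intro z hz
  rcases eq_or_ne z w with rfl | hzw
  · have hderiv : HasDerivAt (fun y => c + (y - z) * q y) (1 * q z + (z - z) * deriv q z) z :=
      (((hasDerivAt_id z).sub_const z).mul
        (hq.differentiableAt (Metric.isOpen_ball.mem_nhds hz)).hasDerivAt).const_add c
    have hlocal : f =ᶠ[𝓝 z] fun y => c + (y - z) * q y := by
      filter_upwards [Metric.isOpen_ball.mem_nhds hz] using h
    rw [dslope_same, hlocal.deriv_eq, hderiv.deriv]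
    simp
  · rw [dslope_of_ne f hzw, slope_def_field, h z hz, h w hw]
    field_simp [sub_ne_zero.2 hzw]
    ring

lemma ofReal_mul_ne_of_norm_lt {ζ : ℂ} {s : ℝ} (hζ : ‖ζ‖ = 1) (hs : ‖w‖ < s) :
    (s : ℂ) * ζ ≠ w := by
  rintro rfl
  rw [norm_mul, hζ, mul_one, Complex.norm_real, Real.norm_eq_abs] at hs
  exact hs.not_ge (le_abs_self s)

lemma lintegral_inv_norm_sub_sq {s : ℝ} (hs : ‖w‖ < s) :
    ∫⁻ ζ, ENNReal.ofReal (1 / ‖s * ζ - w‖ ^ 2) ∂arcLength =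
      ENNReal.ofReal (1 / (s ^ 2 - ‖w‖ ^ 2)) := by
  have hs0 : 0 < s := (norm_nonneg w).trans_lt hs
  have hws : ‖w / s‖ = ‖w‖ / s := by simp [abs_of_pos hs0]
  have hmem : w / s ∈ 𝔻 := by rwa [mem_ball_zero_iff, hws, div_lt_one hs0]
  have hpos : 0 < s ^ 2 - ‖w‖ ^ 2 := by nlinarith [norm_nonneg w]
  rw [← mul_one (ENNReal.ofReal (1 / (s ^ 2 - ‖w‖ ^ 2))), ← lintegral_poisson hmem,
    ← lintegral_const_mul' _ _ ENNReal.ofReal_ne_top]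
  refine lintegral_congr_ae ?_
  filter_upwards [ae_norm_eq_one] with ζ hζ
  have hne : ‖s * ζ - w‖ ≠ 0 := by
    rw [norm_ne_zero_iff, sub_ne_zero]
    exact ofReal_mul_ne_of_norm_lt hζ hs
  have hscale : ‖ζ - w / s‖ = ‖s * ζ - w‖ / s := by
    have hsC : (s : ℂ) ≠ 0 := by exact_mod_cast hs0.ne'
    rw [show ζ - w / s = (s * ζ - w) / s by field_simp, norm_div, Complex.norm_real,
      Real.norm_eq_abs, abs_of_pos hs0]
  rw [← ENNReal.ofReal_mul (by positivity), poisson, hws, hscale]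
  congr 1
  field_simp

lemma hardyNorm_dslope_sq_le_of_bound (hf : DifferentiableOn ℂ f 𝔻) {A : ℝ}
    (hA : ∀ z ∈ 𝔻, ‖f z‖ ≤ A) (hw : w ∈ 𝔻) :
    hardyNorm 2 (dslope f w) ^ 2 ≤ ENNReal.ofReal (4 * A ^ 2 / (1 - ‖w‖ ^ 2)) := by
  have hw1 : ‖w‖ < 1 := by simpa using hw
  refine hardyNorm_sq_le_of_tendsto (differentiableOn_dslope_disc hf hw)
    (C := fun s => ENNReal.ofReal (4 * A ^ 2 / (s ^ 2 - ‖w‖ ^ 2))) ?_ ?_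
  · filter_upwards [Ioo_mem_nhdsLT hw1] with s hs
    have hs0 : 0 ≤ s := (norm_nonneg w).trans hs.1.le
    calc ∫⁻ ζ, ‖dslope f w (s * ζ)‖ₑ ^ 2 ∂arcLength
        ≤ ∫⁻ ζ, ENNReal.ofReal (4 * A ^ 2) *
            ENNReal.ofReal (1 / ‖s * ζ - w‖ ^ 2) ∂arcLength := by
          refine lintegral_mono_ae ?_
          filter_upwards [ae_norm_eq_one] with ζ hζ
          have hdiff : ‖f (s * ζ) - f w‖ ≤ 2 * A := by
            linarith [norm_sub_le (f (s * ζ)) (f w), hA w hw,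
              hA _ (ofReal_mul_mem_disc hs0 hs.2 hζ.le)]
          rw [← ENNReal.ofReal_mul (by positivity), ← ofReal_norm,
            ← ENNReal.ofReal_pow (norm_nonneg _),
            norm_dslope_of_ne (ofReal_mul_ne_of_norm_lt hζ hs.1), div_pow, mul_one_div,
            show 4 * A ^ 2 = (2 * A) ^ 2 by ring]
          gcongr
      _ = _ := by
          rw [lintegral_const_mul' _ _ ENNReal.ofReal_ne_top, lintegral_inv_norm_sub_sq hs.1,
            ← ENNReal.ofReal_mul (by positivity), mul_one_div]
  · have hcont : Continuous fun s : ℝ => s ^ 2 - ‖w‖ ^ 2 := by fun_prop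
    have hlim := (hcont.continuousWithinAt (s := Iio 1) (x := 1)).tendsto
    rw [one_pow] at hlim
    exact ENNReal.tendsto_ofReal (tendsto_const_nhds.div hlim (one_sub_norm_sq_pos hw).ne')

lemma mul_eLpNorm_dilation_le (hq : DifferentiableOn ℂ q 𝔻) {c : ℂ}
    (h : ∀ z ∈ 𝔻, f z = c + z * q z) {r : ℝ} (hr : r ∈ Ico (0 : ℝ) 1) :
    ENNReal.ofReal r * eLpNorm (fun ζ : ℂ => q (r * ζ)) 2 arcLength ≤
      eLpNorm (fun ζ : ℂ => f (r * ζ)) 2 arcLength := by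
  obtain ⟨a, ha⟩ := exists_hasSum_mul_pow hq
  obtain ⟨b, hb0, hb⟩ : ∃ b : ℕ → ℂ, b 0 = c ∧ ∀ n, b (n + 1) = a n :=
    ⟨fun n => n.casesOn c a, rfl, fun _ => rfl⟩
  have hfb (z : ℂ) (hz : z ∈ 𝔻) : HasSum (fun n => b n * z ^ n) (f z) := by
    have hshift : HasSum (fun n => b (n + 1) * z ^ (n + 1)) (z * q z) :=
      ((ha z hz).mul_left z).congr_fun fun n => by rw [hb]; ring
    rw [h z hz, add_comm]
    simpa [hb0] using (hasSum_nat_add_iff (f := fun n => b n * z ^ n) 1).1 hshift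
  have hnorm : ENNReal.ofReal r = ‖(r : ℂ)‖ₑ := by
    rw [← ofReal_norm, Complex.norm_real, Real.norm_of_nonneg hr.1]
  rw [← ENNReal.pow_le_pow_left_iff two_ne_zero, mul_pow, eLpNorm_two_sq, eLpNorm_two_sq,
    lintegral_dilation_eq_tsum hr.1 fun z hz => ha z (by simp [hz, hr.2]),
    lintegral_dilation_eq_tsum hr.1 fun z hz => hfb z (by simp [hz, hr.2]),
    ← ENNReal.tsum_mul_left]
  calc ∑' n, ENNReal.ofReal r ^ 2 * ‖a n * r ^ n‖ₑ ^ 2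
      = ∑' n, ‖b (n + 1) * r ^ (n + 1)‖ₑ ^ 2 :=
        tsum_congr fun n => by
          rw [hnorm, ← mul_pow, ← enorm_mul, hb, pow_succ' (r : ℂ), mul_left_comm]
    _ ≤ ∑' n, ‖b n * r ^ n‖ₑ ^ 2 :=
        ENNReal.tsum_comp_le_tsum_of_injective (add_left_injective 1) _

/- With `q = dslope f w` one has `f + w q = f w + z q`, and the shift is isometric, so
`‖q‖ ≤ ‖f‖ + ‖w‖ ‖q‖`. Dilations make `‖q‖` finite. -/
lemma hardyNorm_dslope_le (hf : DifferentiableOn ℂ f 𝔻) (hw : w ∈ 𝔻) :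
    ENNReal.ofReal (1 - ‖w‖) * hardyNorm 2 (dslope f w) ≤ hardyNorm 2 f := by
  have hq := differentiableOn_dslope_disc hf hw
  set q := dslope f w
  let M : ℝ → ℝ≥0∞ := fun r => eLpNorm (fun ζ : ℂ => q (r * ζ)) 2 arcLength
  have hfinite (r : ℝ) (hr : r ∈ Ico (0 : ℝ) 1) : M r ≠ ∞ :=
    (memLp_of_continuousOn_sphere 2 (continuousOn_sphere_dilation hq hr.1 hr.2)).eLpNorm_ne_top
  have hshift (s : ℝ) (hs : s ∈ Ico (0 : ℝ) 1) :
      ENNReal.ofReal (s - ‖w‖) * M s ≤ hardyNorm 2 f := by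
    rw [ENNReal.ofReal_sub _ (norm_nonneg w), ENNReal.sub_mul fun _ _ => hfinite s hs,
      tsub_le_iff_right]
    calc ENNReal.ofReal s * M s
        ≤ eLpNorm (fun ζ : ℂ => f (s * ζ) + w * q (s * ζ)) 2 arcLength :=
          mul_eLpNorm_dilation_le (f := fun z => f z + w * q z) hq (c := f w)
            (fun z _ => by linear_combination eq_add_sub_mul_dslope f w z) hs
      _ ≤ eLpNorm (fun ζ : ℂ => f (s * ζ)) 2 arcLength +
          eLpNorm (w • fun ζ : ℂ => q (s * ζ)) 2 arcLength :=
          eLpNorm_add_le (aestronglyMeasurable_dilation hf hs)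
            ((aestronglyMeasurable_dilation hq hs).const_smul w) one_le_two
      _ ≤ hardyNorm 2 f + ENNReal.ofReal ‖w‖ * M s := by
          rw [eLpNorm_const_smul, ofReal_norm]
          gcongr
          exact eLpNorm_dilation_le_hardyNorm 2 f hs
  simp_rw [hardyNorm.eq_1 2 q, ENNReal.mul_iSup]
  refine iSup₂_le fun r hr => ?_
  have hcont : Continuous fun s : ℝ => ENNReal.ofReal (s - ‖w‖) :=
    ENNReal.continuous_ofReal.comp (by fun_prop)
  have hlim := (hcont.continuousWithinAt (s := Iio 1) (x := 1)).tendsto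
  refine le_of_tendsto (ENNReal.Tendsto.mul_const hlim (.inr (hfinite r hr))) ?_
  filter_upwards [Ioo_mem_nhdsLT hr.2] with s hs
  refine le_trans ?_ (hshift s ⟨hr.1.trans hs.1.le, hs.2⟩)
  gcongr
  rw [← ENNReal.pow_le_pow_left_iff two_ne_zero, eLpNorm_two_sq, eLpNorm_two_sq]
  exact lintegral_dilation_mono hq hr.1 hs.1.le hs.2

lemma dslope_add_sub_mul (hf : DifferentiableOn ℂ f 𝔻) (hw : w ∈ 𝔻) {u : ℂ} (hu : u ∈ 𝔻) :
    EqOn (dslope f u) (dslope f w + (fun _ => u - w) * dslope (dslope f w) u) 𝔻 := by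
  have hq := differentiableOn_dslope_disc hf hw
  refine dslope_eqOn (c := f u) hu
    (hq.add ((differentiableOn_const _).mul (differentiableOn_dslope_disc hq hu))) fun z _ => ?_
  simp only [Pi.add_apply, Pi.mul_apply]
  linear_combination eq_add_sub_mul_dslope f w z - eq_add_sub_mul_dslope f w u +
    (u - w) * eq_add_sub_mul_dslope (dslope f w) u z

lemma dslope_dilation (hf : DifferentiableOn ℂ f 𝔻) (hw : w ∈ 𝔻) {r : ℝ} (h0 : 0 ≤ r)
    (h1 : r < 1) :
    EqOn (dslope (fun z => f (r * z)) w)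
      ((fun _ => (r : ℂ)) * fun z => dslope f (r * w) (r * z)) 𝔻 := by
  have hu : (r : ℂ) * w ∈ 𝔻 := ofReal_mul_mem_disc h0 h1 (mem_ball_zero_iff.1 hw).le
  refine dslope_eqOn (c := f (r * w)) hw ((differentiableOn_const _).mul
    (differentiableOn_dilation (differentiableOn_dslope_disc hf hu) h0 h1.le)) fun z _ => ?_
  simp only [Pi.mul_apply]
  linear_combination eq_add_sub_mul_dslope f (r * w) (r * z)

lemma hardyNorm_dslope_dilation_le (hf : DifferentiableOn ℂ f 𝔻) (hw : w ∈ 𝔻) {r : ℝ}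
    (h0 : 0 ≤ r) (h1 : r < 1) :
    hardyNorm 2 (dslope (fun z => f (r * z)) w) ≤ 2 * hardyNorm 2 (dslope f w) := by
  have hw1 : ‖w‖ < 1 := by simpa using hw
  set u : ℂ := r * w with hu_def
  have hu : u ∈ 𝔻 := ofReal_mul_mem_disc h0 h1 hw1.le
  have hq := differentiableOn_dslope_disc hf hw
  have hsub : ‖u - w‖ ≤ 1 - ‖u‖ := by
    have hnorm_u : ‖u‖ = r * ‖w‖ := by simp [hu_def, abs_of_nonneg h0]
    have hnorm_sub : ‖u - w‖ = (1 - r) * ‖w‖ := by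
      rw [norm_sub_rev, hu_def, show w - r * w = ((1 - r : ℝ) : ℂ) * w by push_cast; ring,
        norm_mul, Complex.norm_real, Real.norm_of_nonneg (sub_nonneg.2 h1.le)]
    rw [hnorm_u, hnorm_sub]
    linarith
  calc hardyNorm 2 (dslope (fun z => f (r * z)) w)
      = hardyNorm 2 ((fun _ => (r : ℂ)) * fun z => dslope f u (r * z)) :=
        hardyNorm_congr (dslope_dilation hf hw h0 h1)
    _ ≤ ENNReal.ofReal 1 * hardyNorm 2 (fun z => dslope f u (r * z)) :=
        hardyNorm_mul_le fun z _ => by simpa [abs_of_nonneg h0] using h1.le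
    _ ≤ hardyNorm 2 (dslope f u) := by
        rw [ENNReal.ofReal_one, one_mul]
        exact hardyNorm_dilation_le _ h0 h1.le
    _ = hardyNorm 2 (dslope f w + (fun _ => u - w) * dslope (dslope f w) u) :=
        hardyNorm_congr (dslope_add_sub_mul hf hw hu)
    _ ≤ hardyNorm 2 (dslope f w) + hardyNorm 2 ((fun _ => u - w) * dslope (dslope f w) u) :=
        hardyNorm_add_le one_le_two hq
          ((differentiableOn_const _).mul (differentiableOn_dslope_disc hq hu))
    _ ≤ hardyNorm 2 (dslope f w) +
          ENNReal.ofReal (1 - ‖u‖) * hardyNorm 2 (dslope (dslope f w) u) := by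
        gcongr
        exact hardyNorm_mul_le fun _ _ => hsub
    _ ≤ hardyNorm 2 (dslope f w) + hardyNorm 2 (dslope f w) := by
        gcongr
        exact hardyNorm_dslope_le hq hu
    _ = 2 * hardyNorm 2 (dslope f w) := (two_mul _).symm

end Dslope

/-! ### Möbius involutions -/

/-- The involutive automorphism `z ↦ (w - z) / (1 - \bar w z)` of the disc. -/
noncomputable def mobius (w z : ℂ) : ℂ := (w - z) / (1 - conj w * z)

/-- The weighted composition operator `q ↦ √(1 - |w|²) / (1 - \bar w z) · q ∘ mobius w`, an
isometric involution of the Hardy space. -/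
noncomputable def mobiusLift (w : ℂ) (q : ℂ → ℂ) (z : ℂ) : ℂ :=
  (√(1 - ‖w‖ ^ 2) : ℝ) / (1 - conj w * z) * q (mobius w z)

section Mobius

variable {w z : ℂ}

lemma one_sub_conj_mul_ne_zero (hw : w ∈ 𝔻) (hz : ‖z‖ ≤ 1) : 1 - conj w * z ≠ 0 := by
  intro h
  have hone : ‖w‖ * ‖z‖ = 1 := by
    rw [← RCLike.norm_conj w, ← norm_mul, ← sub_eq_zero.1 h, norm_one]
  have hw1 : ‖w‖ < 1 := by simpa using hw
  nlinarith [norm_nonneg w, norm_nonneg z]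

lemma norm_one_sub_conj_mul {ζ : ℂ} (hζ : ‖ζ‖ = 1) : ‖1 - conj w * ζ‖ = ‖ζ - w‖ := by
  have hfactor : 1 - conj w * ζ = ζ * conj (ζ - w) := by
    have : ζ * conj ζ = 1 := by simp [Complex.mul_conj', hζ]
    rw [map_sub]
    linear_combination -this
  rw [hfactor, norm_mul, hζ, one_mul, RCLike.norm_conj]

lemma mobius_sub (hw : w ∈ 𝔻) (hz : ‖z‖ ≤ 1) :
    mobius w z - w = -(z * ((1 - ‖w‖ ^ 2) / (1 - conj w * z))) := by
  have hne := one_sub_conj_mul_ne_zero hw hz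
  rw [mobius, ← Complex.conj_mul' w, div_sub' hne, mul_div_assoc', ← neg_div]
  ring

lemma one_sub_conj_mul_mobius (hw : w ∈ 𝔻) (hz : ‖z‖ ≤ 1) :
    1 - conj w * mobius w z = (1 - ‖w‖ ^ 2) / (1 - conj w * z) := by
  have hne := one_sub_conj_mul_ne_zero hw hz
  rw [mobius, ← Complex.conj_mul' w, mul_div_assoc', one_sub_div hne]
  ring

lemma one_sub_norm_mobius_sq (hw : w ∈ 𝔻) (hz : ‖z‖ ≤ 1) :
    1 - ‖mobius w z‖ ^ 2 = (1 - ‖w‖ ^ 2) * (1 - ‖z‖ ^ 2) / ‖1 - conj w * z‖ ^ 2 := by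
  have hne := pow_ne_zero 2 (norm_ne_zero_iff.2 (one_sub_conj_mul_ne_zero hw hz))
  rw [mobius, norm_div, div_pow, one_sub_div hne]
  simp only [← Complex.normSq_eq_norm_sq, Complex.normSq_apply]
  simp
  ring

lemma norm_mobius_le_one (hw : w ∈ 𝔻) (hz : ‖z‖ ≤ 1) : ‖mobius w z‖ ≤ 1 := by
  have hnonneg : 0 ≤ 1 - ‖mobius w z‖ ^ 2 := by
    rw [one_sub_norm_mobius_sq hw hz]
    have := (one_sub_norm_sq_pos hw).le
    have : 0 ≤ 1 - ‖z‖ ^ 2 := by nlinarith [norm_nonneg z]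
    positivity
  nlinarith [norm_nonneg (mobius w z)]

lemma mobius_mem_disc (hw : w ∈ 𝔻) (hz : z ∈ 𝔻) : mobius w z ∈ 𝔻 := by
  have hz1 : ‖z‖ ≤ 1 := (mem_ball_zero_iff.1 hz).le
  have hpos : 0 < 1 - ‖mobius w z‖ ^ 2 := by
    rw [one_sub_norm_mobius_sq hw hz1]
    have := one_sub_norm_sq_pos hw
    have := one_sub_norm_sq_pos hz
    have := norm_pos_iff.2 (one_sub_conj_mul_ne_zero hw hz1)
    positivity
  rw [mem_ball_zero_iff]
  nlinarith [norm_nonneg (mobius w z)]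

lemma norm_mobius_eq_one (hw : w ∈ 𝔻) (hz : ‖z‖ = 1) : ‖mobius w z‖ = 1 := by
  have h := one_sub_norm_mobius_sq hw hz.le
  rw [hz, one_pow, sub_self, mul_zero, zero_div, sub_eq_zero] at h
  exact (pow_eq_one_iff_of_nonneg (norm_nonneg _) two_ne_zero).1 h.symm

lemma mobius_mobius (hw : w ∈ 𝔻) (hz : ‖z‖ ≤ 1) : mobius w (mobius w z) = z := by
  have hne := one_sub_conj_mul_ne_zero hw hz
  have hw' : (1 - (‖w‖ : ℂ) ^ 2) ≠ 0 := by exact_mod_cast (one_sub_norm_sq_pos hw).ne'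
  rw [mobius, one_sub_conj_mul_mobius hw hz, ← neg_sub, mobius_sub hw hz, neg_neg]
  exact mul_div_cancel_right₀ z (div_ne_zero hw' hne)

lemma hasDerivAt_mobius (hw : w ∈ 𝔻) (hz : ‖z‖ ≤ 1) :
    HasDerivAt (mobius w) (-((1 - ‖w‖ ^ 2) / (1 - conj w * z) ^ 2)) z := by
  have hnum : HasDerivAt (fun z => w - z) (-1) z := (hasDerivAt_id z).const_sub w
  have hden : HasDerivAt (fun z => 1 - conj w * z) (-conj w) z := by
    simpa using ((hasDerivAt_id z).const_mul (conj w)).const_sub 1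
  refine (hnum.div hden (one_sub_conj_mul_ne_zero hw hz)).congr_deriv ?_
  rw [← Complex.conj_mul' w, ← neg_div]
  ring

lemma differentiableOn_mobius (hw : w ∈ 𝔻) :
    DifferentiableOn ℂ (mobius w) (Metric.closedBall 0 1) := fun z hz =>
  (hasDerivAt_mobius hw (by simpa using hz)).differentiableAt.differentiableWithinAt

lemma measurable_mobius (w : ℂ) : Measurable (mobius w) := by
  unfold mobius
  fun_prop

lemma lintegral_poisson_mul_enorm_sq_tsum (hw : w ∈ 𝔻) {c : ℕ → ℂ}
    (hc : Summable fun n => ‖c n‖) :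
    ∫⁻ ζ, ENNReal.ofReal (poisson w ζ) * ‖∑' n, c n * mobius w ζ ^ n‖ₑ ^ 2 ∂arcLength =
      ∑' n, ‖c n‖ₑ ^ 2 := by
  have hmeas : Measurable fun ζ => ENNReal.ofReal (poisson w ζ) :=
    (measurable_poisson.comp (measurable_const.prodMk measurable_id)).ennreal_ofReal
  have hfinite : ∀ᵐ ζ ∂arcLength, ENNReal.ofReal (poisson w ζ) < ∞ :=
    ae_of_all _ fun _ => ENNReal.ofReal_lt_top
  set ν := arcLength.withDensity fun ζ => ENNReal.ofReal (poisson w ζ)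
  have : IsFiniteMeasure ν := isFiniteMeasure_withDensity (by simp [lintegral_poisson hw])
  have hunimodular : ∀ᵐ ζ ∂ν, ‖mobius w ζ‖ = 1 := by
    refine (withDensity_absolutelyContinuous _ _).ae_le ?_
    filter_upwards [ae_norm_eq_one] with ζ hζ using norm_mobius_eq_one hw hζ
  have hmoment (k : ℕ) : ∫ ζ, mobius w ζ ^ k ∂ν = if k = 0 then 1 else 0 := by
    have hdiff : DiffContOnCl ℂ (fun ζ => mobius w ζ ^ k) 𝔻 :=
      diffContOnCl_of_differentiableOn_closedBall ((differentiableOn_mobius hw).pow k)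
    rw [integral_withDensity_eq_integral_toReal_smul hmeas hfinite]
    simp_rw [ENNReal.toReal_ofReal (poisson_nonneg hw _)]
    rw [integral_poisson_smul hdiff hw, mobius, sub_self, zero_div, zero_pow_eq]
  rw [← lintegral_enorm_sq_tsum_mul_pow (measurable_mobius w).aestronglyMeasurable hunimodular
    hmoment hc, lintegral_withDensity_eq_lintegral_mul_non_measurable _ hmeas hfinite]
  rfl

lemma hardyNorm_sq_le_lintegral {F : ℂ → ℂ} (hF : DiffContOnCl ℂ F 𝔻) :
    hardyNorm 2 F ^ 2 ≤ ∫⁻ ζ, ‖F ζ‖ₑ ^ 2 ∂arcLength := by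
  have hcont : ContinuousOn F (Metric.closedBall 0 1) := by
    simpa [closure_ball _ one_ne_zero] using hF.continuousOn
  obtain ⟨A, hA⟩ := (isCompact_closedBall (0 : ℂ) 1).exists_bound_of_continuousOn hcont
  have hradii : ∀ᶠ s : ℝ in 𝓝[<] 1, s ∈ Ico (0 : ℝ) 1 := Ico_mem_nhdsLT zero_lt_one
  have hmem {s : ℝ} (hs : s ∈ Ico (0 : ℝ) 1) {ζ : ℂ} (hζ : ‖ζ‖ = 1) :
      (s : ℂ) * ζ ∈ Metric.closedBall (0 : ℂ) 1 :=
    Metric.ball_subset_closedBall (ofReal_mul_mem_disc hs.1 hs.2 hζ.le)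
  refine hardyNorm_sq_le_of_tendsto hF.differentiableOn (Eventually.of_forall fun s => le_rfl) ?_
  refine tendsto_lintegral_filter_of_dominated_convergence' (fun _ => ENNReal.ofReal (A ^ 2))
    ?_ ?_ (by simp) ?_
  · filter_upwards [hradii] with s hs
    exact (aestronglyMeasurable_dilation hF.differentiableOn hs).enorm.pow_const 2
  · filter_upwards [hradii] with s hs
    filter_upwards [ae_norm_eq_one] with ζ hζ
    rw [← ofReal_norm, ← ENNReal.ofReal_pow (norm_nonneg _)]
    gcongr
    exact hA _ (hmem hs hζ)
  · filter_upwards [ae_norm_eq_one] with ζ hζ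
    have hradial : Tendsto (fun s : ℝ => (s : ℂ) * ζ) (𝓝[<] 1)
        (𝓝[Metric.closedBall (0 : ℂ) 1] ζ) :=
      tendsto_nhdsWithin_iff.2 ⟨tendsto_ofReal_mul ζ, hradii.mono fun s hs => hmem hs hζ⟩
    exact ((ENNReal.continuous_pow 2).tendsto _).comp
      ((hcont ζ (by simp [hζ])).tendsto.comp hradial).enorm

variable {q : ℂ → ℂ}

lemma ofReal_sqrt_one_sub_norm_sq_sq (hw : w ∈ 𝔻) :
    ((√(1 - ‖w‖ ^ 2) : ℝ) : ℂ) ^ 2 = 1 - (‖w‖ : ℂ) ^ 2 := by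
  rw [← Complex.ofReal_pow, Real.sq_sqrt (one_sub_norm_sq_pos hw).le]
  push_cast
  rfl

lemma mobiusLift_mobiusLift (hw : w ∈ 𝔻) (q : ℂ → ℂ) :
    EqOn (mobiusLift w (mobiusLift w q)) q 𝔻 := by
  intro z hz
  have hz1 : ‖z‖ ≤ 1 := (mem_ball_zero_iff.1 hz).le
  have hne := one_sub_conj_mul_ne_zero hw hz1
  have hw' : (1 - (‖w‖ : ℂ) ^ 2) ≠ 0 := by exact_mod_cast (one_sub_norm_sq_pos hw).ne'
  rw [mobiusLift, mobiusLift, mobius_mobius hw hz1, one_sub_conj_mul_mobius hw hz1]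
  field_simp
  rw [ofReal_sqrt_one_sub_norm_sq_sq hw]

lemma differentiableOn_mobiusLift (hw : w ∈ 𝔻) {s : Set ℂ} (hs : s ⊆ Metric.closedBall 0 1)
    (hq : DifferentiableOn ℂ (q ∘ mobius w) s) : DifferentiableOn ℂ (mobiusLift w q) s :=
  ((differentiableOn_const _).div (by fun_prop) fun z hz =>
    one_sub_conj_mul_ne_zero hw (by simpa using hs hz)).mul hq

lemma diffContOnCl_mobiusLift_dilation (hw : w ∈ 𝔻) (hq : DifferentiableOn ℂ q 𝔻) {r : ℝ}
    (hr : r ∈ Ico (0 : ℝ) 1) : DiffContOnCl ℂ (mobiusLift w fun z => q (r * z)) 𝔻 := by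
  refine diffContOnCl_of_differentiableOn_closedBall (differentiableOn_mobiusLift hw subset_rfl ?_)
  exact hq.comp ((differentiableOn_mobius hw).const_mul _) fun z hz =>
    ofReal_mul_mem_disc hr.1 hr.2 (norm_mobius_le_one hw (by simpa using hz))

lemma enorm_sq_mobiusLift (hw : w ∈ 𝔻) (q : ℂ → ℂ) {ζ : ℂ} (hζ : ‖ζ‖ = 1) :
    ‖mobiusLift w q ζ‖ₑ ^ 2 = ENNReal.ofReal (poisson w ζ) * ‖q (mobius w ζ)‖ₑ ^ 2 := by
  rw [mobiusLift, enorm_mul, mul_pow, ← ofReal_norm (_ / _), norm_div, norm_one_sub_conj_mul hζ,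
    ← ENNReal.ofReal_pow (by positivity), div_pow, Complex.norm_real, Real.norm_eq_abs, sq_abs,
    Real.sq_sqrt (one_sub_norm_sq_pos hw).le, poisson]

lemma hardyNorm_mobiusLift_dilation_le (hw : w ∈ 𝔻) (hq : DifferentiableOn ℂ q 𝔻) {r : ℝ}
    (hr : r ∈ Ico (0 : ℝ) 1) :
    hardyNorm 2 (mobiusLift w fun z => q (r * z)) ≤ hardyNorm 2 q := by
  obtain ⟨a, ha⟩ := exists_hasSum_mul_pow hq
  have hsummable : Summable fun n => ‖a n * (r : ℂ) ^ n‖ :=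
    (ha r (by simpa [abs_of_nonneg hr.1] using hr.2)).summable.norm
  refine (ENNReal.pow_le_pow_left_iff two_ne_zero).1 ?_
  calc hardyNorm 2 (mobiusLift w fun z => q (r * z)) ^ 2
      ≤ ∫⁻ ζ, ‖mobiusLift w (fun z => q (r * z)) ζ‖ₑ ^ 2 ∂arcLength :=
        hardyNorm_sq_le_lintegral (diffContOnCl_mobiusLift_dilation hw hq hr)
    _ = ∫⁻ ζ, ENNReal.ofReal (poisson w ζ) *
          ‖∑' n, (a n * (r : ℂ) ^ n) * mobius w ζ ^ n‖ₑ ^ 2 ∂arcLength := by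
        refine lintegral_congr_ae ?_
        filter_upwards [ae_norm_eq_one] with ζ hζ
        rw [enorm_sq_mobiusLift hw _ hζ, ← (ha (r * mobius w ζ)
          (ofReal_mul_mem_disc hr.1 hr.2 (norm_mobius_le_one hw hζ.le))).tsum_eq]
        simp only [mul_pow, mul_assoc]
    _ = ∑' n, ‖a n * (r : ℂ) ^ n‖ₑ ^ 2 := lintegral_poisson_mul_enorm_sq_tsum hw hsummable
    _ = ∫⁻ ζ, ‖q (r * ζ)‖ₑ ^ 2 ∂arcLength :=
        (lintegral_dilation_eq_tsum hr.1 fun z hz => ha z (by simp [hz, hr.2])).symm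
    _ ≤ hardyNorm 2 q ^ 2 := lintegral_dilation_le_hardyNorm_sq q hr

lemma hardyNorm_mobiusLift_le (hw : w ∈ 𝔻) (hq : DifferentiableOn ℂ q 𝔻) :
    hardyNorm 2 (mobiusLift w q) ≤ hardyNorm 2 q := by
  refine hardyNorm_le_of_tendsto (l := 𝓝[<] (1 : ℝ))
    (F := fun r => mobiusLift w fun z => q (r * z)) ?_ fun z hz => ?_
  · filter_upwards [Ico_mem_nhdsLT zero_lt_one] with r hr
    exact ⟨(diffContOnCl_mobiusLift_dilation hw hq hr).differentiableOn,
      hardyNorm_mobiusLift_dilation_le hw hq hr⟩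
  · have hcont := (hq.differentiableAt (Metric.isOpen_ball.mem_nhds
      (mobius_mem_disc hw hz))).continuousAt
    exact (hcont.tendsto.comp (tendsto_ofReal_mul _)).const_mul _

lemma hardyNorm_mobiusLift (hw : w ∈ 𝔻) (hq : DifferentiableOn ℂ q 𝔻) :
    hardyNorm 2 (mobiusLift w q) = hardyNorm 2 q := by
  refine le_antisymm (hardyNorm_mobiusLift_le hw hq) ?_
  rw [← hardyNorm_congr (mobiusLift_mobiusLift hw q)]
  refine hardyNorm_mobiusLift_le hw
    (differentiableOn_mobiusLift hw Metric.ball_subset_closedBall ?_)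
  exact hq.comp ((differentiableOn_mobius hw).mono Metric.ball_subset_closedBall)
    fun z hz => mobius_mem_disc hw hz

end Mobius

/-! ### The local Dirichlet integral -/

lemma measurable_greenKernel : Measurable fun p : ℂ × ℂ => greenKernel p.1 p.2 := by
  unfold greenKernel
  refine Measurable.ite (measurableSet_eq_fun measurable_fst measurable_snd) measurable_const ?_
  exact ((Real.measurable_log.comp (Measurable.norm (by fun_prop))).ennreal_ofReal)

lemma measurable_greenKernel_left (w : ℂ) : Measurable fun z => greenKernel z w :=
  measurable_greenKernel.comp (measurable_id.prodMk measurable_const)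

lemma polarCoord_symm_eq_mul_circleMap (r θ : ℝ) :
    Complex.polarCoord.symm (r, θ) = r * circleMap 0 1 θ := by
  simp [Complex.polarCoord_symm_apply, circleMap, Complex.exp_mul_I]

lemma setLIntegral_disc {g : ℂ → ℝ≥0∞} (hg : Measurable g) :
    ∫⁻ z in 𝔻, g z = ∫⁻ r in Ioo (0 : ℝ) 1, ENNReal.ofReal r *
      ∫⁻ θ in Ioo (-Real.pi) Real.pi, g (r * circleMap 0 1 θ) := by
  have hmeas : Measurable fun p : ℝ × ℝ =>
      ENNReal.ofReal p.1 * (𝔻).indicator g (p.1 * circleMap 0 1 p.2) :=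
    measurable_fst.ennreal_ofReal.mul ((hg.indicator measurableSet_ball).comp
      (by fun_prop : Continuous fun p : ℝ × ℝ => (p.1 : ℂ) * circleMap 0 1 p.2).measurable)
  have hindicator (r : ℝ) (hr : 0 < r) (θ : ℝ) : (𝔻).indicator g (r * circleMap 0 1 θ) =
      (Iio (1 : ℝ)).indicator (fun r => g (r * circleMap 0 1 θ)) r := by
    classical simp [indicator_apply, abs_of_pos hr]
  calc ∫⁻ z in 𝔻, g z
      = ∫⁻ p in Ioi (0 : ℝ) ×ˢ Ioo (-Real.pi) Real.pi,
          ENNReal.ofReal p.1 * (𝔻).indicator g (p.1 * circleMap 0 1 p.2) := by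
        rw [← lintegral_indicator measurableSet_ball, ← Complex.lintegral_comp_polarCoord_symm]
        simp [← polarCoord_symm_eq_mul_circleMap, polarCoord_target]
    _ = ∫⁻ r in Ioi (0 : ℝ), ∫⁻ θ in Ioo (-Real.pi) Real.pi,
          ENNReal.ofReal r * (𝔻).indicator g (r * circleMap 0 1 θ) := by
        rw [Measure.volume_eq_prod, setLIntegral_prod _ hmeas.aemeasurable]
    _ = ∫⁻ r in Ioi (0 : ℝ), (Iio (1 : ℝ)).indicator (fun r => ENNReal.ofReal r *
          ∫⁻ θ in Ioo (-Real.pi) Real.pi, g (r * circleMap 0 1 θ)) r := by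
        refine setLIntegral_congr_fun measurableSet_Ioi fun r hr => ?_
        simp only [lintegral_const_mul' _ _ ENNReal.ofReal_ne_top, hindicator r hr, indicator_apply]
        split_ifs <;> simp
    _ = _ := by
        rw [lintegral_indicator measurableSet_Iio, Measure.restrict_restrict measurableSet_Iio,
          inter_comm, Ioi_inter_Iio]

lemma lintegral_discArea {g : ℂ → ℝ≥0∞} (hg : Measurable g) :
    ∫⁻ z, g z ∂discArea = ∫⁻ r in Ioo (0 : ℝ) 1, ENNReal.ofReal (2 * r) *
      ∫⁻ ζ, g (r * ζ) ∂arcLength := by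
  have hpi : ENNReal.ofReal Real.pi ≠ 0 := by simp [Real.pi_pos]
  have hconst : ENNReal.ofReal 2 * (ENNReal.ofReal (2 * Real.pi))⁻¹ =
      (ENNReal.ofReal Real.pi)⁻¹ := by
    rw [ENNReal.ofReal_mul two_pos.le, ENNReal.mul_inv (by simp) (by simp), ← mul_assoc,
      ENNReal.mul_inv_cancel (by simp) ENNReal.ofReal_ne_top, one_mul]
  rw [discArea, lintegral_smul_measure, smul_eq_mul, setLIntegral_disc hg,
    ← lintegral_const_mul' _ _ (ENNReal.inv_ne_top.2 hpi)]
  refine setLIntegral_congr_fun measurableSet_Ioo fun r _ => ?_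
  rw [lintegral_arcLength (g := fun ζ => g (r * ζ)) (by fun_prop), ← hconst,
    ENNReal.ofReal_mul (q := r) two_pos.le]
  ring

lemma hasDerivAt_antideriv_pow_mul_neg_log (n : ℕ) {r : ℝ} (hr : r ≠ 0) :
    HasDerivAt (fun r : ℝ => r ^ (n + 2) / (n + 2) ^ 2 - r ^ (n + 1) * (r * Real.log r) / (n + 2))
      (r ^ (n + 1) * -Real.log r) r := by
  refine (((hasDerivAt_pow (n + 2) r).div_const _).sub
    (((hasDerivAt_pow (n + 1) r).mul (Real.hasDerivAt_mul_log hr)).div_const _)).congr_deriv ?_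
  simp only [Nat.add_succ_sub_one]
  push_cast
  field_simp
  ring

lemma lintegral_pow_mul_neg_log (n : ℕ) :
    ∫⁻ r in Ioo (0 : ℝ) 1, ENNReal.ofReal (r ^ (n + 1) * -Real.log r) =
      ENNReal.ofReal (1 / (n + 2) ^ 2) := by
  have hcont : Continuous fun r : ℝ => r ^ (n + 1) * -Real.log r := by
    have : (fun r : ℝ => r ^ (n + 1) * -Real.log r) = fun r => -(r ^ n * (r * Real.log r)) := by
      ext r
      ring
    rw [this]
    fun_prop
  have hint := intervalIntegral.integral_eq_sub_of_hasDerivAt_of_le (zero_le_one' ℝ)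
    (by fun_prop) (fun r hr => hasDerivAt_antideriv_pow_mul_neg_log n hr.1.ne')
    (hcont.intervalIntegrable 0 1)
  rw [intervalIntegral.integral_of_le zero_le_one, integral_Ioc_eq_integral_Ioo] at hint
  rw [← ofReal_integral_eq_lintegral_ofReal, hint]
  · simp
  · exact (hcont.continuousOn.integrableOn_Icc (a := 0) (b := 1)).mono_set Ioo_subset_Icc_self
  · refine (ae_restrict_mem measurableSet_Ioo).mono fun r hr => ?_
    exact mul_nonneg (pow_nonneg hr.1.le _) (neg_nonneg.2 (Real.log_nonpos hr.1.le hr.2.le))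

/-- The local Dirichlet integral of `f` at `w`, i.e. the Dirichlet integral `𝓓_μ(f)` for the unit
point mass `μ` at `w`. -/
noncomputable def localDirichlet (w : ℂ) (f : ℂ → ℂ) : ℝ≥0∞ :=
  ∫⁻ z, ‖deriv f z‖ₑ ^ 2 * greenKernel z w ∂discArea

lemma exists_hasSum_mul_deriv {k : ℂ → ℂ} (hk : DifferentiableOn ℂ k 𝔻) :
    ∃ a : ℕ → ℂ, ∀ z ∈ 𝔻, HasSum (fun n => a n * z ^ n) (k z) ∧
      HasSum (fun n => n * a n * z ^ n) (z * deriv k z) := by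
  have taylor {f : ℂ → ℂ} (hf : DifferentiableOn ℂ f 𝔻) {z : ℂ} (hz : z ∈ 𝔻) :
      HasSum (fun n => (n.factorial : ℂ)⁻¹ * iteratedDeriv n f 0 * z ^ n) (f z) := by
    simpa [mul_comm, mul_left_comm] using
      Complex.hasSum_taylorSeries_on_ball (c := 0) (r := 1) hf (z := z) (by simpa using hz)
  refine ⟨_, fun z hz => ⟨taylor hk hz, (hasSum_nat_add_iff' 1).1 ?_⟩⟩
  have hderiv := (taylor (hk.deriv Metric.isOpen_ball) hz).mul_left z
  simp only [Finset.range_one, Finset.sum_singleton, Nat.cast_zero, zero_mul, sub_zero]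
  refine hderiv.congr_fun fun n => ?_
  have hn : (n.factorial : ℂ) ≠ 0 := by exact_mod_cast n.factorial_ne_zero
  have hn' : (n : ℂ) + 1 ≠ 0 := by exact_mod_cast n.succ_ne_zero
  rw [iteratedDeriv_succ', Nat.factorial_succ]
  push_cast
  field_simp
  ring

lemma exists_hasSum_deriv {F k : ℂ → ℂ} {c : ℂ} (hk : DifferentiableOn ℂ k 𝔻)
    (hF : ∀ z ∈ 𝔻, F z = c + z * k z) :
    ∃ a : ℕ → ℂ, (∀ z ∈ 𝔻, HasSum (fun n => a n * z ^ n) (k z)) ∧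
      ∀ z ∈ 𝔻, HasSum (fun n : ℕ => (n + 1) * a n * z ^ n) (deriv F z) := by
  obtain ⟨a, ha⟩ := exists_hasSum_mul_deriv hk
  refine ⟨a, fun z hz => (ha z hz).1, fun z hz => ?_⟩
  have hnhds := Metric.isOpen_ball.mem_nhds hz
  have hderiv : deriv F z = z * deriv k z + k z := by
    rw [EventuallyEq.deriv_eq (Filter.eventually_of_mem hnhds hF), deriv_const_add]
    simpa [add_comm] using
      ((hasDerivAt_id' z).fun_mul (hk.differentiableAt hnhds).hasDerivAt).deriv
  rw [hderiv]
  refine ((ha z hz).2.add (ha z hz).1).congr_fun fun n => ?_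
  ring

lemma greenKernel_zero_right {z : ℂ} (hz : z ≠ 0) :
    greenKernel z 0 = ENNReal.ofReal (-Real.log ‖z‖) := by
  simp [greenKernel, hz]

lemma lintegral_deriv_mul_greenKernel_zero {G : ℂ → ℂ} {a : ℕ → ℂ}
    (hG : ∀ z ∈ 𝔻, HasSum (fun n : ℕ => (n + 1) * a n * z ^ n) (G z)) {r : ℝ}
    (hr : r ∈ Ioo (0 : ℝ) 1) :
    ENNReal.ofReal (2 * r) * ∫⁻ ζ, ‖G (r * ζ)‖ₑ ^ 2 * greenKernel (r * ζ) 0 ∂arcLength =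
      ∑' n : ℕ, ENNReal.ofReal (r ^ (2 * n + 1) * -Real.log r) *
        (ENNReal.ofReal (2 * (n + 1) ^ 2) * ‖a n‖ₑ ^ 2) := by
  have hgreen : ∫⁻ ζ, ‖G (r * ζ)‖ₑ ^ 2 * greenKernel (r * ζ) 0 ∂arcLength =
      (∫⁻ ζ, ‖G (r * ζ)‖ₑ ^ 2 ∂arcLength) * ENNReal.ofReal (-Real.log r) := by
    rw [← lintegral_mul_const' _ _ ENNReal.ofReal_ne_top]
    refine lintegral_congr_ae ?_
    filter_upwards [ae_norm_eq_one] with ζ hζ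
    have hnorm : ‖(r : ℂ) * ζ‖ = r := by simp [hζ, abs_of_pos hr.1]
    rw [greenKernel_zero_right (norm_ne_zero_iff.1 (hnorm.trans_ne hr.1.ne')), hnorm]
  rw [hgreen, lintegral_dilation_eq_tsum hr.1.le fun z hz => hG z (by simp [hz, hr.2]),
    ← ENNReal.tsum_mul_right, ← ENNReal.tsum_mul_left]
  refine tsum_congr fun n => ?_
  have hn : ‖(n : ℂ) + 1‖ₑ = ENNReal.ofReal (n + 1) := by
    rw [← ofReal_norm, ← Nat.cast_succ, Complex.norm_natCast, Nat.cast_succ]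
  have hr' : ‖(r : ℂ)‖ₑ = ENNReal.ofReal r := by
    rw [← ofReal_norm, Complex.norm_real, Real.norm_of_nonneg hr.1.le]
  rw [enorm_mul, enorm_mul, enorm_pow, hn, hr', ENNReal.ofReal_mul two_pos.le,
    ENNReal.ofReal_mul (pow_nonneg hr.1.le _), ENNReal.ofReal_pow hr.1.le,
    ENNReal.ofReal_mul two_pos.le, ENNReal.ofReal_pow (by positivity)]
  ring

lemma localDirichlet_zero {F k : ℂ → ℂ} {c : ℂ} (hk : DifferentiableOn ℂ k 𝔻)
    (hF : ∀ z ∈ 𝔻, F z = c + z * k z) :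
    localDirichlet 0 F = 2⁻¹ * hardyNorm 2 k ^ 2 := by
  obtain ⟨a, ha, hderiv⟩ := exists_hasSum_deriv hk hF
  have hmeas : Measurable fun z => ‖deriv F z‖ₑ ^ 2 * greenKernel z 0 :=
    ((measurable_deriv F).enorm.pow_const 2).mul (measurable_greenKernel_left 0)
  rw [localDirichlet, lintegral_discArea hmeas,
    setLIntegral_congr_fun measurableSet_Ioo fun r hr =>
      lintegral_deriv_mul_greenKernel_zero hderiv hr,
    lintegral_tsum, hardyNorm_sq_eq_tsum ha, ← ENNReal.tsum_mul_left]
  · refine tsum_congr fun n => ?_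
    have hfin : ENNReal.ofReal (2 * ((n : ℝ) + 1) ^ 2) * ‖a n‖ₑ ^ 2 ≠ ∞ :=
      ENNReal.mul_ne_top ENNReal.ofReal_ne_top (by simp)
    have hcoeff : 1 / ((2 * n : ℕ) + 2 : ℝ) ^ 2 * (2 * (n + 1) ^ 2) = 2⁻¹ := by
      push_cast
      field_simp
    rw [lintegral_mul_const' _ _ hfin, lintegral_pow_mul_neg_log, ← mul_assoc,
      ← ENNReal.ofReal_mul (by positivity), hcoeff, ENNReal.ofReal_inv_of_pos two_pos,
      ENNReal.ofReal_ofNat]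
  · exact fun n => Measurable.aemeasurable (by fun_prop)

lemma greenKernel_mobius {w z : ℂ} (hw : w ∈ 𝔻) (hz : z ∈ 𝔻) :
    greenKernel (mobius w z) w = greenKernel z 0 := by
  have hz1 : ‖z‖ ≤ 1 := (mem_ball_zero_iff.1 hz).le
  rcases eq_or_ne z 0 with rfl | hz0
  · simp [mobius, greenKernel]
  have hc : (1 - (‖w‖ : ℂ) ^ 2) / (1 - conj w * z) ≠ 0 :=
    div_ne_zero (by exact_mod_cast (one_sub_norm_sq_pos hw).ne') (one_sub_conj_mul_ne_zero hw hz1)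
  have hne : mobius w z ≠ w := by
    rw [← sub_ne_zero, mobius_sub hw hz1]
    exact neg_ne_zero.2 (mul_ne_zero hz0 hc)
  rw [greenKernel_zero_right hz0, greenKernel, if_neg hne, one_sub_conj_mul_mobius hw hz1,
    mobius_sub hw hz1, div_neg, norm_neg, ← div_div, div_right_comm, div_self hc, norm_div,
    norm_one, one_div, Real.log_inv]

lemma image_mobius {w : ℂ} (hw : w ∈ 𝔻) : mobius w '' 𝔻 = 𝔻 :=
  Subset.antisymm (image_subset_iff.2 fun _ hz => mobius_mem_disc hw hz) fun z hz =>
    ⟨mobius w z, mobius_mem_disc hw hz, mobius_mobius hw (mem_ball_zero_iff.1 hz).le⟩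

lemma injOn_mobius {w : ℂ} (hw : w ∈ 𝔻) : InjOn (mobius w) 𝔻 :=
  LeftInvOn.injOn (f₁' := mobius w) fun _ hz => mobius_mobius hw (mem_ball_zero_iff.1 hz).le

lemma det_smul_one (c : ℂ) : (c • (1 : ℂ →L[ℝ] ℂ)).det = ‖c‖ ^ 2 := by
  have hmul : ((c • (1 : ℂ →L[ℝ] ℂ) : ℂ →L[ℝ] ℂ) : ℂ →ₗ[ℝ] ℂ) = Algebra.lmul ℝ ℂ c := by
    ext
    all_goals simp
  rw [ContinuousLinearMap.det, hmul, ← Algebra.norm_apply, Algebra.norm_complex_apply,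
    Complex.normSq_eq_norm_sq]

lemma lintegral_image_eq_lintegral_enorm_deriv_sq {φ φ' : ℂ → ℂ} {s : Set ℂ}
    (hs : MeasurableSet s) (hφ : ∀ z ∈ s, HasDerivAt φ (φ' z) z) (hinj : InjOn φ s)
    (g : ℂ → ℝ≥0∞) : ∫⁻ z in φ '' s, g z = ∫⁻ z in s, ‖φ' z‖ₑ ^ 2 * g (φ z) := by
  rw [lintegral_image_eq_lintegral_abs_det_fderiv_mul volume hs
    (fun z hz => (hφ z hz).complexToReal_fderiv.hasFDerivWithinAt) hinj g]
  simp only [det_smul_one, abs_sq, ENNReal.ofReal_pow (norm_nonneg _), ofReal_norm]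

lemma localDirichlet_comp_mobius {F : ℂ → ℂ} (hF : DifferentiableOn ℂ F 𝔻) {w : ℂ}
    (hw : w ∈ 𝔻) : localDirichlet 0 (F ∘ mobius w) = localDirichlet w F := by
  have hmobius (z : ℂ) (hz : z ∈ 𝔻) :=
    hasDerivAt_mobius hw (mem_ball_zero_iff.1 hz).le
  have hchange := lintegral_image_eq_lintegral_enorm_deriv_sq measurableSet_ball hmobius
    (injOn_mobius hw) fun z => ‖deriv F z‖ₑ ^ 2 * greenKernel z w
  rw [localDirichlet, localDirichlet, discArea, lintegral_smul_measure, lintegral_smul_measure]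
  rw [image_mobius hw] at hchange
  rw [hchange]
  congr 1
  refine setLIntegral_congr_fun measurableSet_ball fun z hz => ?_
  have hFz := (hF.differentiableAt
    (Metric.isOpen_ball.mem_nhds (mobius_mem_disc hw hz))).hasDerivAt
  rw [(hFz.comp z (hmobius z hz)).deriv, greenKernel_mobius hw hz, enorm_mul]
  ring

theorem localDirichlet_eq {F : ℂ → ℂ} (hF : DifferentiableOn ℂ F 𝔻) {w : ℂ} (hw : w ∈ 𝔻) :
    localDirichlet w F =
      2⁻¹ * (ENNReal.ofReal (1 - ‖w‖ ^ 2) * hardyNorm 2 (dslope F w) ^ 2) := by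
  have hslope := differentiableOn_dslope_disc hF hw
  have hlift : DifferentiableOn ℂ (mobiusLift w (dslope F w)) 𝔻 :=
    differentiableOn_mobiusLift hw Metric.ball_subset_closedBall <|
      hslope.comp ((differentiableOn_mobius hw).mono Metric.ball_subset_closedBall)
        fun z hz => mobius_mem_disc hw hz
  have hfactor (z : ℂ) (hz : z ∈ 𝔻) : (F ∘ mobius w) z =
      F w + z * (-(√(1 - ‖w‖ ^ 2) : ℝ) * mobiusLift w (dslope F w) z) := by
    rw [Function.comp_apply, eq_add_sub_mul_dslope F w (mobius w z),
      mobius_sub hw (mem_ball_zero_iff.1 hz).le, mobiusLift, ← ofReal_sqrt_one_sub_norm_sq_sq hw]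
    ring
  have hconst : ‖-((√(1 - ‖w‖ ^ 2) : ℝ) : ℂ)‖ₑ ^ 2 = ENNReal.ofReal (1 - ‖w‖ ^ 2) := by
    rw [← ofReal_norm, ← ENNReal.ofReal_pow (norm_nonneg _), norm_neg, Complex.norm_real,
      Real.norm_of_nonneg (Real.sqrt_nonneg _), Real.sq_sqrt (one_sub_norm_sq_pos hw).le]
  rw [← localDirichlet_comp_mobius hF hw, localDirichlet_zero (hlift.const_mul _) hfactor,
    hardyNorm_const_mul, hardyNorm_mobiusLift hw hslope, mul_pow, hconst]

section

variable {f g ψ : ℂ → ℂ} {w : ℂ} {A : ℝ}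

lemma localDirichlet_const_mul (w c : ℂ) (f : ℂ → ℂ) :
    localDirichlet w (fun z => c * f z) = ‖c‖ₑ ^ 2 * localDirichlet w f := by
  rw [localDirichlet, localDirichlet, ← lintegral_const_mul' _ _ (by simp)]
  simp only [deriv_const_mul_field, enorm_mul, mul_pow, mul_assoc]

lemma localDirichlet_neg (w : ℂ) (f : ℂ → ℂ) : localDirichlet w (-f) = localDirichlet w f := by
  simp [localDirichlet]

lemma localDirichlet_add_le (hf : DifferentiableOn ℂ f 𝔻) (hg : DifferentiableOn ℂ g 𝔻)
    (hw : w ∈ 𝔻) : localDirichlet w (f + g) ≤ 2 * localDirichlet w f + 2 * localDirichlet w g := by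
  have hf' := differentiableOn_dslope_disc hf hw
  have hg' := differentiableOn_dslope_disc hg hw
  have hslope : EqOn (dslope (f + g) w) (dslope f w + dslope g w) 𝔻 :=
    dslope_eqOn (c := f w + g w) hw (hf'.add hg') fun z _ => by
      simp only [Pi.add_apply]
      linear_combination eq_add_sub_mul_dslope f w z + eq_add_sub_mul_dslope g w z
  rw [localDirichlet_eq hf hw, localDirichlet_eq hg hw, localDirichlet_eq (hf.add hg) hw,
    hardyNorm_congr hslope]
  calc _ ≤ 2⁻¹ * (ENNReal.ofReal (1 - ‖w‖ ^ 2) *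
        (2 * hardyNorm 2 (dslope f w) ^ 2 + 2 * hardyNorm 2 (dslope g w) ^ 2)) := by
        gcongr
        exact (pow_le_pow_left' (hardyNorm_add_le one_le_two hf' hg') 2).trans
          (add_sq_le_two_mul _ _)
    _ = _ := by ring

lemma localDirichlet_sub_le (hf : DifferentiableOn ℂ f 𝔻) (hg : DifferentiableOn ℂ g 𝔻)
    (hw : w ∈ 𝔻) : localDirichlet w (f - g) ≤ 2 * localDirichlet w f + 2 * localDirichlet w g := by
  rw [sub_eq_add_neg, ← localDirichlet_neg w g]
  exact localDirichlet_add_le hf hg.neg hw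

lemma localDirichlet_mul_sub_le (hf : DifferentiableOn ℂ f 𝔻) (hψ : DifferentiableOn ℂ ψ 𝔻)
    (hA : ∀ z ∈ 𝔻, ‖ψ z‖ ≤ A) (hw : w ∈ 𝔻) :
    localDirichlet w (ψ * fun z => f z - f w) ≤ ENNReal.ofReal A ^ 2 * localDirichlet w f := by
  have hslope : EqOn (dslope (ψ * fun z => f z - f w) w) (ψ * dslope f w) 𝔻 :=
    dslope_eqOn (c := 0) hw (hψ.mul (differentiableOn_dslope_disc hf hw)) fun z _ => by
      simp only [Pi.mul_apply]
      linear_combination ψ z * eq_add_sub_mul_dslope f w z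
  rw [localDirichlet_eq (hψ.mul (hf.sub_const _)) hw, localDirichlet_eq hf hw,
    hardyNorm_congr hslope]
  calc _ ≤ 2⁻¹ * (ENNReal.ofReal (1 - ‖w‖ ^ 2) *
        (ENNReal.ofReal A * hardyNorm 2 (dslope f w)) ^ 2) := by
        gcongr
        exact hardyNorm_mul_le hA
    _ = _ := by ring

lemma localDirichlet_mul_le (hf : DifferentiableOn ℂ f 𝔻) (hψ : DifferentiableOn ℂ ψ 𝔻)
    (hA : ∀ z ∈ 𝔻, ‖ψ z‖ ≤ A) (hw : w ∈ 𝔻) :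
    localDirichlet w (ψ * f) ≤ 2 * (ENNReal.ofReal A ^ 2 * localDirichlet w f) +
      2 * (‖f w‖ₑ ^ 2 * localDirichlet w ψ) := by
  have hsplit : ψ * f = (ψ * fun z => f z - f w) + fun z => f w * ψ z := by
    ext z
    simp only [Pi.mul_apply, Pi.add_apply]
    ring
  rw [hsplit, ← localDirichlet_const_mul]
  refine (localDirichlet_add_le (hψ.mul (hf.sub_const _)) (hψ.const_mul _) hw).trans ?_
  gcongr
  exact localDirichlet_mul_sub_le hf hψ hA hw

lemma enorm_sq_mul_localDirichlet_le (hf : DifferentiableOn ℂ f 𝔻) (hψ : DifferentiableOn ℂ ψ 𝔻)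
    (hA : ∀ z ∈ 𝔻, ‖ψ z‖ ≤ A) (hw : w ∈ 𝔻) :
    ‖f w‖ₑ ^ 2 * localDirichlet w ψ ≤
      2 * localDirichlet w (ψ * f) + 2 * (ENNReal.ofReal A ^ 2 * localDirichlet w f) := by
  have hsplit : (fun z => f w * ψ z) = ψ * f - ψ * fun z => f z - f w := by
    ext z
    simp only [Pi.mul_apply, Pi.sub_apply]
    ring
  rw [← localDirichlet_const_mul, hsplit]
  refine (localDirichlet_sub_le (hψ.mul hf) (hψ.mul (hf.sub_const _)) hw).trans ?_
  gcongr
  exact localDirichlet_mul_sub_le hf hψ hA hw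

lemma localDirichlet_le_mul_hardyNorm_dslope_sq (hf : DifferentiableOn ℂ f 𝔻) (hw : w ∈ 𝔻) :
    localDirichlet w f ≤ ENNReal.ofReal (1 - ‖w‖ ^ 2) * hardyNorm 2 (dslope f w) ^ 2 := by
  rw [localDirichlet_eq hf hw]
  exact mul_le_of_le_one_left' (by simp)

lemma localDirichlet_le_of_bound (hf : DifferentiableOn ℂ f 𝔻) (hA : ∀ z ∈ 𝔻, ‖f z‖ ≤ A)
    (hw : w ∈ 𝔻) : localDirichlet w f ≤ ENNReal.ofReal (4 * A ^ 2) := by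
  have hpos := one_sub_norm_sq_pos hw
  calc localDirichlet w f
      ≤ ENNReal.ofReal (1 - ‖w‖ ^ 2) * hardyNorm 2 (dslope f w) ^ 2 :=
        localDirichlet_le_mul_hardyNorm_dslope_sq hf hw
    _ ≤ ENNReal.ofReal (1 - ‖w‖ ^ 2) * ENNReal.ofReal (4 * A ^ 2 / (1 - ‖w‖ ^ 2)) := by
        gcongr
        exact hardyNorm_dslope_sq_le_of_bound hf hA hw
    _ = ENNReal.ofReal (4 * A ^ 2) := by
        rw [← ENNReal.ofReal_mul hpos.le, mul_div_cancel₀ _ hpos.ne']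

lemma localDirichlet_dilation_le (hf : DifferentiableOn ℂ f 𝔻) (hw : w ∈ 𝔻) {r : ℝ} (h0 : 0 ≤ r)
    (h1 : r < 1) : localDirichlet w (fun z => f (r * z)) ≤ 4 * localDirichlet w f := by
  rw [localDirichlet_eq hf hw, localDirichlet_eq (differentiableOn_dilation hf h0 h1.le) hw]
  calc _ ≤ 2⁻¹ * (ENNReal.ofReal (1 - ‖w‖ ^ 2) * (2 * hardyNorm 2 (dslope f w)) ^ 2) := by
        gcongr
        exact hardyNorm_dslope_dilation_le hf hw h0 h1
    _ = _ := by ring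

lemma localDirichlet_le_mul_hardyNorm_sq (hf : DifferentiableOn ℂ f 𝔻) (hw : w ∈ 𝔻) :
    localDirichlet w f ≤
      ENNReal.ofReal (1 - ‖w‖ ^ 2) * (ENNReal.ofReal (1 - ‖w‖))⁻¹ ^ 2 * hardyNorm 2 f ^ 2 := by
  have hw1 : ENNReal.ofReal (1 - ‖w‖) ≠ 0 := by simpa using hw
  have hslope : hardyNorm 2 (dslope f w) ≤ (ENNReal.ofReal (1 - ‖w‖))⁻¹ * hardyNorm 2 f :=
    (ENNReal.mul_le_iff_le_inv hw1 ENNReal.ofReal_ne_top).1 (hardyNorm_dslope_le hf hw)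
  calc localDirichlet w f
      ≤ ENNReal.ofReal (1 - ‖w‖ ^ 2) * ((ENNReal.ofReal (1 - ‖w‖))⁻¹ * hardyNorm 2 f) ^ 2 :=
        (localDirichlet_le_mul_hardyNorm_dslope_sq hf hw).trans (by gcongr)
    _ = _ := by ring

lemma hardyNorm_dslope_le_of_lipschitz (hL : ∀ z ∈ 𝔻, ∀ w ∈ 𝔻, ‖ψ z - ψ w‖ ≤ A * ‖z - w‖)
    (hA : 0 ≤ A) (hw : w ∈ 𝔻) : hardyNorm 2 (dslope ψ w) ≤ ENNReal.ofReal A := by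
  refine hardyNorm_le_of_bound fun z hz => ?_
  rcases eq_or_ne z w with rfl | hzw
  · rw [dslope_same]
    refine norm_deriv_le_of_lip' hA ?_
    filter_upwards [Metric.isOpen_ball.mem_nhds hz] with y hy using hL y hy z hz
  · rw [norm_dslope_of_ne hzw, div_le_iff₀ (norm_pos_iff.2 (sub_ne_zero.2 hzw))]
    exact hL z hz w hw

lemma localDirichlet_mul_le_of_lipschitz (hf : DifferentiableOn ℂ f 𝔻)
    (hψ : DifferentiableOn ℂ ψ 𝔻) (hA : ∀ z ∈ 𝔻, ‖ψ z‖ ≤ A)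
    (hL : ∀ z ∈ 𝔻, ∀ w ∈ 𝔻, ‖ψ z - ψ w‖ ≤ A * ‖z - w‖) (hw : w ∈ 𝔻) :
    localDirichlet w (ψ * f) ≤
      ENNReal.ofReal A ^ 2 * (2 * localDirichlet w f + hardyNorm 2 f ^ 2) := by
  have hψw : 2 * localDirichlet w ψ ≤ ENNReal.ofReal (1 - ‖w‖ ^ 2) * ENNReal.ofReal A ^ 2 := by
    rw [localDirichlet_eq hψ hw, ← mul_assoc, ENNReal.mul_inv_cancel two_ne_zero
      ENNReal.ofNat_ne_top, one_mul]
    gcongr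
    exact hardyNorm_dslope_le_of_lipschitz hL ((norm_nonneg _).trans (hA w hw)) hw
  calc localDirichlet w (ψ * f)
      ≤ 2 * (ENNReal.ofReal A ^ 2 * localDirichlet w f) +
          ‖f w‖ₑ ^ 2 * (2 * localDirichlet w ψ) :=
        (localDirichlet_mul_le hf hψ hA hw).trans_eq (by ring)
    _ ≤ 2 * (ENNReal.ofReal A ^ 2 * localDirichlet w f) +
          ‖f w‖ₑ ^ 2 * (ENNReal.ofReal (1 - ‖w‖ ^ 2) * ENNReal.ofReal A ^ 2) := by gcongr
    _ = ENNReal.ofReal A ^ 2 *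
          (2 * localDirichlet w f + ‖f w‖ₑ ^ 2 * ENNReal.ofReal (1 - ‖w‖ ^ 2)) := by ring
    _ ≤ _ := by
        gcongr
        exact enorm_sq_mul_le_hardyNorm_sq hf hw

end

/-! ### The space `𝓓_μ` and its closed invariant subspaces -/

instance : IsFiniteMeasure discArea where
  measure_univ_lt_top := by
    rw [discArea]
    simp only [Measure.smul_apply, Measure.restrict_apply MeasurableSet.univ, univ_inter,
      smul_eq_mul]
    exact ENNReal.mul_lt_top (by simp [Real.pi_pos]) measure_ball_lt_top

lemma measurable_localDirichlet (f : ℂ → ℂ) : Measurable fun w => localDirichlet w f := by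
  refine Measurable.lintegral_prod_right'
    (f := fun p : ℂ × ℂ => ‖deriv f p.2‖ₑ ^ 2 * greenKernel p.2 p.1) ?_
  exact (((measurable_deriv f).comp measurable_snd).enorm.pow_const 2).mul
    (measurable_greenKernel.comp measurable_swap)

theorem dirichletIntegral_eq_lintegral_localDirichlet (μ : Measure ℂ) [SFinite μ] (f : ℂ → ℂ) :
    dirichletIntegral μ f = ∫⁻ w, localDirichlet w f ∂μ := by
  have hmeas : Measurable fun p : ℂ × ℂ => ‖deriv f p.1‖ₑ ^ 2 * greenKernel p.1 p.2 :=
    (((measurable_deriv f).comp measurable_fst).enorm.pow_const 2).mul measurable_greenKernel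
  calc dirichletIntegral μ f
      = ∫⁻ z, ∫⁻ w, ‖deriv f z‖ₑ ^ 2 * greenKernel z w ∂μ ∂discArea :=
        lintegral_congr fun z => (lintegral_const_mul' _ _ (by simp)).symm
    _ = _ := lintegral_lintegral_swap hmeas.aemeasurable

lemma mem_dirichletSpace_iff {μ : Measure ℂ} [SFinite μ] {f : ℂ → ℂ} :
    f ∈ dirichletSpace μ ↔ DifferentiableOn ℂ f 𝔻 ∧ dirichletNormSq μ f < ∞ := by
  rw [dirichletNormSq, ENNReal.add_lt_top, ENNReal.pow_lt_top_iff]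
  simp only [OfNat.ofNat_ne_zero, or_false]
  exact and_assoc

section

variable {μ : Measure ℂ} {f ψ : ℂ → ℂ} {A : ℝ} {ι : Type*}

lemma lintegral_localDirichlet_ne_top [SFinite μ] (hf : f ∈ dirichletSpace μ) :
    ∫⁻ w, localDirichlet w f ∂μ ≠ ∞ := by
  rw [← dirichletIntegral_eq_lintegral_localDirichlet]
  exact hf.2.ne

lemma dirichletIntegral_le_lintegral [SFinite μ] (hμ : μ 𝔻ᶜ = 0) {Φ : ℂ → ℝ≥0∞}
    (h : ∀ w ∈ 𝔻, localDirichlet w f ≤ Φ w) : dirichletIntegral μ f ≤ ∫⁻ w, Φ w ∂μ := by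
  rw [dirichletIntegral_eq_lintegral_localDirichlet]
  refine lintegral_mono_ae ?_
  filter_upwards [mem_ae_iff.2 hμ] with w hw using h w hw

lemma tendsto_dirichletNormSq [SFinite μ] (hμ : μ 𝔻ᶜ = 0) {l : Filter ι}
    [l.IsCountablyGenerated] {u : ι → ℂ → ℂ} (hu : ∀ᶠ i in l, DifferentiableOn ℂ (u i) 𝔻)
    (hlim : Tendsto (fun i => hardyNorm 2 (u i)) l (𝓝 0)) {Φ : ℂ → ℝ≥0∞}
    (hΦ : ∫⁻ w, Φ w ∂μ ≠ ∞) (hle : ∀ᶠ i in l, ∀ w ∈ 𝔻, localDirichlet w (u i) ≤ Φ w) :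
    Tendsto (fun i => dirichletNormSq μ (u i)) l (𝓝 0) := by
  have hsq : Tendsto (fun i => hardyNorm 2 (u i) ^ 2) l (𝓝 0) := by
    simpa using ENNReal.Tendsto.pow (n := 2) hlim
  have hdisc : ∀ᵐ w ∂μ, w ∈ 𝔻 := mem_ae_iff.2 hμ
  have hint : Tendsto (fun i => dirichletIntegral μ (u i)) l (𝓝 0) := by
    simp only [dirichletIntegral_eq_lintegral_localDirichlet]
    rw [← lintegral_zero (μ := μ)]
    refine tendsto_lintegral_filter_of_dominated_convergence Φ
      (Eventually.of_forall fun i => measurable_localDirichlet _) ?_ hΦ ?_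
    · filter_upwards [hle] with i hi
      filter_upwards [hdisc] with w hw using hi w hw
    · filter_upwards [hdisc] with w hw
      have hconst : ENNReal.ofReal (1 - ‖w‖ ^ 2) * (ENNReal.ofReal (1 - ‖w‖))⁻¹ ^ 2 ≠ ∞ :=
        ENNReal.mul_ne_top ENNReal.ofReal_ne_top
          (ENNReal.pow_ne_top (ENNReal.inv_ne_top.2 (by simpa using hw)))
      refine tendsto_of_tendsto_of_tendsto_of_le_of_le' tendsto_const_nhds
        (by simpa using ENNReal.Tendsto.const_mul hsq (Or.inr hconst))
        (Eventually.of_forall fun _ => zero_le) ?_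
      filter_upwards [hu] with i hi using localDirichlet_le_mul_hardyNorm_sq hi hw
  simpa [dirichletNormSq] using hsq.add hint

variable [IsFiniteMeasure μ]

theorem mem_dirichletSpace_of_bound (hμ : μ 𝔻ᶜ = 0) (hf : DifferentiableOn ℂ f 𝔻)
    (hA : ∀ z ∈ 𝔻, ‖f z‖ ≤ A) : f ∈ dirichletSpace μ := by
  refine ⟨⟨hf, (hardyNorm_le_of_bound hA).trans_lt ENNReal.ofReal_lt_top⟩, ?_⟩
  refine (dirichletIntegral_le_lintegral hμ fun w hw =>
    localDirichlet_le_of_bound hf hA hw).trans_lt ?_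
  rw [lintegral_const]
  exact ENNReal.mul_lt_top ENNReal.ofReal_lt_top (measure_lt_top _ _)

lemma exists_dirichletNormSq_mul_le (hμ : μ 𝔻ᶜ = 0) (hf : f ∈ dirichletSpace μ) :
    ∃ K ≠ ∞, ∀ (ψ : ℂ → ℂ) (A : ℝ), DifferentiableOn ℂ ψ 𝔻 → (∀ z ∈ 𝔻, ‖ψ z‖ ≤ A) →
      (∀ z ∈ 𝔻, ∀ w ∈ 𝔻, ‖ψ z - ψ w‖ ≤ A * ‖z - w‖) →
      dirichletNormSq μ (ψ * f) ≤ ENNReal.ofReal A ^ 2 * K := by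
  have hfin : hardyNorm 2 f ^ 2 ≠ ∞ := ENNReal.pow_ne_top hf.1.2.ne
  refine ⟨hardyNorm 2 f ^ 2 + (2 * dirichletIntegral μ f + hardyNorm 2 f ^ 2 * μ univ),
    ENNReal.add_ne_top.2 ⟨hfin, ENNReal.add_ne_top.2 ⟨ENNReal.mul_ne_top (by simp) hf.2.ne,
      ENNReal.mul_ne_top hfin (measure_ne_top _ _)⟩⟩, fun ψ A hψ hA hL => ?_⟩
  have hint : dirichletIntegral μ (ψ * f) ≤
      ENNReal.ofReal A ^ 2 * (2 * dirichletIntegral μ f + hardyNorm 2 f ^ 2 * μ univ) := by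
    refine (dirichletIntegral_le_lintegral hμ fun w hw =>
      localDirichlet_mul_le_of_lipschitz hf.1.1 hψ hA hL hw).trans (le_of_eq ?_)
    rw [lintegral_const_mul' _ _ (by simp), lintegral_add_right _ measurable_const,
      lintegral_const_mul' _ _ (by simp), lintegral_const,
      ← dirichletIntegral_eq_lintegral_localDirichlet]
  rw [dirichletNormSq, mul_add, ← mul_pow]
  exact add_le_add (pow_le_pow_left' (hardyNorm_mul_le hA) 2) hint

lemma shift_mem_dirichletSpace (hμ : μ 𝔻ᶜ = 0) (hf : f ∈ dirichletSpace μ) :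
    (fun z => z * f z) ∈ dirichletSpace μ := by
  obtain ⟨K, hK, hle⟩ := exists_dirichletNormSq_mul_le hμ hf
  refine mem_dirichletSpace_iff.2 ⟨differentiableOn_id.mul hf.1.1, ?_⟩
  exact (hle id 1 differentiableOn_id (fun z hz => (mem_ball_zero_iff.1 hz).le)
    fun z _ w _ => by simp).trans_lt (ENNReal.mul_lt_top (by simp) hK.lt_top)

lemma isClosedInvariant_dirichletSpace (hμ : μ 𝔻ᶜ = 0) :
    IsClosedInvariant μ (dirichletSpace μ) :=
  ⟨le_rfl, fun _ hg _ => hg, fun _ hg => shift_mem_dirichletSpace hμ hg⟩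

end

lemma norm_pow_sub_pow_le {z w : ℂ} (hz : ‖z‖ ≤ 1) (hw : ‖w‖ ≤ 1) (n : ℕ) :
    ‖z ^ n - w ^ n‖ ≤ n * ‖z - w‖ := by
  induction n with
  | zero => simp
  | succ n ih =>
    calc ‖z ^ (n + 1) - w ^ (n + 1)‖ = ‖z * (z ^ n - w ^ n) + (z - w) * w ^ n‖ := by ring_nf
      _ ≤ ‖z‖ * ‖z ^ n - w ^ n‖ + ‖z - w‖ * ‖w‖ ^ n := by
        simpa only [norm_mul, norm_pow] using norm_add_le (z * (z ^ n - w ^ n)) ((z - w) * w ^ n)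
      _ ≤ 1 * (n * ‖z - w‖) + ‖z - w‖ * 1 := by
        gcongr
        exact pow_le_one₀ (norm_nonneg _) hw
      _ = (n + 1 : ℕ) * ‖z - w‖ := by push_cast; ring

section

variable {φ : ℂ → ℂ} {c : ℕ → ℂ} {k : ℕ → ℕ}

lemma norm_le_tsum_of_hasSum_pow (hc : Summable fun n => ((k n : ℝ) + 1) * ‖c n‖) {z : ℂ}
    (hz : z ∈ 𝔻) (hφ : HasSum (fun n => c n * z ^ k n) (φ z)) :
    ‖φ z‖ ≤ ∑' n, ((k n : ℝ) + 1) * ‖c n‖ := by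
  rw [← hφ.tsum_eq]
  refine tsum_of_norm_bounded hc.hasSum fun n => ?_
  have hpow : ‖z‖ ^ k n ≤ 1 := pow_le_one₀ (norm_nonneg _) (mem_ball_zero_iff.1 hz).le
  rw [norm_mul, norm_pow]
  nlinarith [norm_nonneg (c n), mul_nonneg (k n).cast_nonneg (norm_nonneg (c n))]

lemma norm_sub_le_tsum_of_hasSum_pow (hc : Summable fun n => ((k n : ℝ) + 1) * ‖c n‖)
    {z w : ℂ} (hz : z ∈ 𝔻) (hw : w ∈ 𝔻) (hφz : HasSum (fun n => c n * z ^ k n) (φ z))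
    (hφw : HasSum (fun n => c n * w ^ k n) (φ w)) :
    ‖φ z - φ w‖ ≤ (∑' n, ((k n : ℝ) + 1) * ‖c n‖) * ‖z - w‖ := by
  rw [← (hφz.sub hφw).tsum_eq]
  refine tsum_of_norm_bounded (hc.hasSum.mul_right _) fun n => ?_
  calc ‖c n * z ^ k n - c n * w ^ k n‖ = ‖c n‖ * ‖z ^ k n - w ^ k n‖ := by
        rw [← mul_sub, norm_mul]
    _ ≤ ‖c n‖ * ((k n + 1) * ‖z - w‖) := by
        gcongr
        exact (norm_pow_sub_pow_le (mem_ball_zero_iff.1 hz).le (mem_ball_zero_iff.1 hw).le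
          (k n)).trans (by gcongr; linarith)
    _ = _ := by ring

end

section

variable {μ : Measure ℂ} {M : Submodule ℂ (ℂ → ℂ)} {f ψ : ℂ → ℂ}

lemma IsClosedInvariant.mem_of_tendsto [SFinite μ] (hM : IsClosedInvariant μ M)
    (hf : f ∈ dirichletSpace μ) {ι : Type*} {l : Filter ι} [l.NeBot] {u : ι → ℂ → ℂ}
    (hu : ∀ᶠ i in l, u i ∈ M) (hlim : Tendsto (fun i => dirichletNormSq μ (f - u i)) l (𝓝 0)) :
    f ∈ M := by
  refine hM.closed f hf fun ε hε => ?_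
  obtain ⟨i, hi, hi'⟩ := (hu.and (hlim.eventually_lt_const hε)).exists
  exact ⟨u i, hi, hi'⟩

lemma IsClosedInvariant.sum_pow_mul_mem [SFinite μ] (hM : IsClosedInvariant μ M) (hf : f ∈ M)
    (c : ℕ → ℂ) (s : Finset ℕ) : (fun z => (∑ n ∈ s, c n * z ^ n) * f z) ∈ M := by
  have hpow (n : ℕ) : (fun z => z ^ n * f z) ∈ M := by
    induction n with
    | zero => simpa using hf
    | succ n ih =>
      have hshift := hM.shift _ ih
      simp only [← mul_assoc, ← pow_succ'] at hshift
      exact hshift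
  have hsum : (fun z => (∑ n ∈ s, c n * z ^ n) * f z) = ∑ n ∈ s, c n • fun z => z ^ n * f z := by
    ext z
    simp [Finset.sum_mul, mul_assoc]
  rw [hsum]
  exact M.sum_mem fun n _ => M.smul_mem _ (hpow n)

variable [IsFiniteMeasure μ]

lemma IsClosedInvariant.mul_mem_of_hasSum (hμ : μ 𝔻ᶜ = 0) (hM : IsClosedInvariant μ M)
    (hf : f ∈ M) {φ : ℂ → ℂ} (hφ : DifferentiableOn ℂ φ 𝔻) {c : ℕ → ℂ}
    (hc : Summable fun n : ℕ => ((n : ℝ) + 1) * ‖c n‖)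
    (hsum : ∀ z ∈ 𝔻, HasSum (fun n => c n * z ^ n) (φ z)) : φ * f ∈ M := by
  obtain ⟨K, hK, hmul⟩ := exists_dirichletNormSq_mul_le hμ (hM.le hf)
  set T : ℕ → ℝ := fun N => ∑' n : ℕ, (((n + N : ℕ) : ℝ) + 1) * ‖c (n + N)‖
  set p : ℕ → ℂ → ℂ := fun N z => ∑ n ∈ Finset.range N, c n * z ^ n
  have htail (N : ℕ) : dirichletNormSq μ ((φ - p N) * f) ≤ ENNReal.ofReal (T N) ^ 2 * K := by
    have hcN : Summable fun n : ℕ => (((n + N : ℕ) : ℝ) + 1) * ‖c (n + N)‖ :=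
      (summable_nat_add_iff N).2 hc
    have hsumN (z : ℂ) (hz : z ∈ 𝔻) : HasSum (fun n => c (n + N) * z ^ (n + N)) ((φ - p N) z) :=
      (hasSum_nat_add_iff' N).2 (hsum z hz)
    exact hmul _ _ (hφ.sub (by fun_prop))
      (fun z hz => norm_le_tsum_of_hasSum_pow hcN hz (hsumN z hz))
      fun z hz w hw => norm_sub_le_tsum_of_hasSum_pow hcN hz hw (hsumN z hz) (hsumN w hw)
  have hmem : φ * f ∈ dirichletSpace μ := by
    refine mem_dirichletSpace_iff.2 ⟨hφ.mul (hM.le hf).1.1, ?_⟩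
    have hp0 : φ - p 0 = φ := by ext z; simp [p]
    simpa only [hp0] using (htail 0).trans_lt (ENNReal.mul_lt_top (by simp) hK.lt_top)
  refine hM.mem_of_tendsto hmem (l := atTop) (u := fun N => p N * f)
    (Eventually.of_forall fun N => hM.sum_pow_mul_mem hf c _) ?_
  have hT : Tendsto (fun N => ENNReal.ofReal (T N) ^ 2 * K) atTop (𝓝 0) := by
    have hT0 := ENNReal.tendsto_ofReal (tendsto_sum_nat_add fun n : ℕ => ((n : ℝ) + 1) * ‖c n‖)
    simpa only [ENNReal.ofReal_zero, zero_pow two_ne_zero, zero_mul] using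
      ENNReal.Tendsto.mul_const (ENNReal.Tendsto.pow (n := 2) hT0) (Or.inr hK)
  refine tendsto_of_tendsto_of_tendsto_of_le_of_le tendsto_const_nhds hT (fun _ => zero_le)
    fun N => ?_
  simpa only [sub_mul] using htail N

lemma IsClosedInvariant.dilation_mul_mem (hμ : μ 𝔻ᶜ = 0) (hM : IsClosedInvariant μ M)
    (hf : f ∈ M) (hψ : DifferentiableOn ℂ ψ 𝔻) {r : ℝ} (h0 : 0 ≤ r) (h1 : r < 1) :
    (fun z => ψ (r * z)) * f ∈ M := by
  obtain ⟨a, ha, hderiv⟩ := exists_hasSum_deriv (F := fun z => 0 + z * ψ z) hψ fun z _ => rfl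
  have hr : (r : ℂ) ∈ 𝔻 := by simpa [abs_of_nonneg h0] using h1
  refine hM.mul_mem_of_hasSum hμ hf (differentiableOn_dilation hψ h0 h1.le)
    (c := fun n => a n * r ^ n) ?_ fun z hz => ?_
  · refine (hderiv r hr).summable.norm.congr fun n => ?_
    rw [mul_assoc, norm_mul]
    norm_cast
  · refine (ha (r * z) (ofReal_mul_mem_disc h0 h1 (mem_ball_zero_iff.1 hz).le)).congr_fun
      fun n => ?_
    rw [mul_pow, mul_assoc]

end

lemma hardyNorm_mul_sub_le {f ψ δ : ℂ → ℂ} (hf : DifferentiableOn ℂ f 𝔻)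
    (hψ : DifferentiableOn ℂ ψ 𝔻) (hδ : DifferentiableOn ℂ δ 𝔻) {A B : ℝ}
    (hA : ∀ z ∈ 𝔻, ‖ψ z‖ ≤ A) (hB : ∀ z ∈ 𝔻, ‖δ z‖ ≤ B) :
    hardyNorm 2 (ψ * f) ≤
      ENNReal.ofReal B * hardyNorm 2 ψ + ENNReal.ofReal A * hardyNorm 2 (δ - f) := by
  have hsplit : ψ * f = δ * ψ - ψ * (δ - f) := by ring
  rw [hsplit]
  exact (hardyNorm_sub_le one_le_two (hδ.mul hψ) (hψ.mul (hδ.sub hf))).trans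
    (add_le_add (hardyNorm_mul_le hB) (hardyNorm_mul_le hA))

lemma exists_bound_dilation {f : ℂ → ℂ} (hf : DifferentiableOn ℂ f 𝔻) {s : ℝ} (h0 : 0 ≤ s)
    (h1 : s < 1) : ∃ B, ∀ z ∈ 𝔻, ‖f (s * z)‖ ≤ B := by
  have hcont := (diffContOnCl_dilation hf h0 h1).continuousOn
  rw [closure_ball _ one_ne_zero] at hcont
  obtain ⟨B, hB⟩ := (isCompact_closedBall (0 : ℂ) 1).exists_bound_of_continuousOn hcont
  exact ⟨B, fun z hz => hB z (Metric.ball_subset_closedBall hz)⟩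

lemma tendsto_hardyNorm_sub_dilation_mul {f ψ : ℂ → ℂ} (hf : MemHardy 2 f)
    (hψ : DifferentiableOn ℂ ψ 𝔻) {A : ℝ} (hA : ∀ z ∈ 𝔻, ‖ψ z‖ ≤ A) :
    Tendsto (fun r : ℝ => hardyNorm 2 (ψ * f - (fun z => ψ (r * z)) * f)) (𝓝[<] 1) (𝓝 0) := by
  have hψH : MemHardy 2 ψ := ⟨hψ, (hardyNorm_le_of_bound hA).trans_lt ENNReal.ofReal_lt_top⟩
  have hIoo : ∀ᶠ r : ℝ in 𝓝[<] 1, r ∈ Ioo (0 : ℝ) 1 := Ioo_mem_nhdsLT zero_lt_one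
  rw [ENNReal.tendsto_nhds_zero]
  intro ε hε
  have hε2 : 0 < ε / 2 := ENNReal.half_pos hε.ne'
  have hf_lim : Tendsto (fun s : ℝ => ENNReal.ofReal (2 * A) *
      hardyNorm 2 ((fun z => f (s * z)) - f)) (𝓝[<] 1) (𝓝 0) := by
    simpa using ENNReal.Tendsto.const_mul (a := ENNReal.ofReal (2 * A))
      (tendsto_hardyNorm_dilation_sub hf) (Or.inr ENNReal.ofReal_ne_top)
  obtain ⟨s, hs, hs01⟩ := ((ENNReal.tendsto_nhds_zero.1 hf_lim _ hε2).and hIoo).exists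
  obtain ⟨B, hB⟩ := exists_bound_dilation hf.1 hs01.1.le hs01.2
  have hψ_lim : Tendsto (fun r : ℝ => ENNReal.ofReal B * hardyNorm 2 ((fun z => ψ (r * z)) - ψ))
      (𝓝[<] 1) (𝓝 0) := by
    simpa using ENNReal.Tendsto.const_mul (tendsto_hardyNorm_dilation_sub hψH)
      (Or.inr ENNReal.ofReal_ne_top)
  filter_upwards [ENNReal.tendsto_nhds_zero.1 hψ_lim _ hε2, hIoo] with r hr hr01
  rw [hardyNorm_sub_comm] at hr
  have hbound (z : ℂ) (hz : z ∈ 𝔻) : ‖(ψ - fun z => ψ (r * z)) z‖ ≤ 2 * A := by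
    have hrz := hA _ (ofReal_mul_mem_disc hr01.1.le hr01.2 (mem_ball_zero_iff.1 hz).le)
    exact (norm_sub_le _ _).trans (by linarith [hA z hz])
  rw [← sub_mul, ← ENNReal.add_halves ε]
  exact (hardyNorm_mul_sub_le hf.1 (hψ.sub (differentiableOn_dilation hψ hr01.1.le hr01.2.le))
    (differentiableOn_dilation hf.1 hs01.1.le hs01.2.le) hbound hB).trans (add_le_add hr hs)

section

variable {μ : Measure ℂ} [IsFiniteMeasure μ] {M : Submodule ℂ (ℂ → ℂ)} {f ψ : ℂ → ℂ} {A : ℝ}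

lemma localDirichlet_sub_dilation_mul_le (hf : DifferentiableOn ℂ f 𝔻)
    (hψ : DifferentiableOn ℂ ψ 𝔻) (hA : ∀ z ∈ 𝔻, ‖ψ z‖ ≤ A) {w : ℂ} (hw : w ∈ 𝔻) {r : ℝ}
    (h0 : 0 ≤ r) (h1 : r < 1) :
    localDirichlet w (ψ * f - (fun z => ψ (r * z)) * f) ≤
      34 * localDirichlet w (ψ * f) + 36 * ENNReal.ofReal A ^ 2 * localDirichlet w f := by
  have hψr := differentiableOn_dilation hψ h0 h1.le
  have hAr (z : ℂ) (hz : z ∈ 𝔻) : ‖ψ (r * z)‖ ≤ A :=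
    hA _ (ofReal_mul_mem_disc h0 h1 (mem_ball_zero_iff.1 hz).le)
  set C := ENNReal.ofReal A ^ 2
  have hmul : ‖f w‖ₑ ^ 2 * localDirichlet w (fun z => ψ (r * z)) ≤
      4 * (2 * localDirichlet w (ψ * f) + 2 * (C * localDirichlet w f)) :=
    calc _ ≤ ‖f w‖ₑ ^ 2 * (4 * localDirichlet w ψ) := by
          gcongr
          exact localDirichlet_dilation_le hψ hw h0 h1
      _ = 4 * (‖f w‖ₑ ^ 2 * localDirichlet w ψ) := by ring
      _ ≤ _ := by
          gcongr
          exact enorm_sq_mul_localDirichlet_le hf hψ hA hw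
  calc _ ≤ 2 * localDirichlet w (ψ * f) + 2 * localDirichlet w ((fun z => ψ (r * z)) * f) :=
        localDirichlet_sub_le (hψ.mul hf) (hψr.mul hf) hw
    _ ≤ 2 * localDirichlet w (ψ * f) + 2 * (2 * (C * localDirichlet w f) +
          2 * (4 * (2 * localDirichlet w (ψ * f) + 2 * (C * localDirichlet w f)))) := by
        gcongr
        exact (localDirichlet_mul_le hf hψr hAr hw).trans (by gcongr)
    _ = _ := by ring

theorem IsClosedInvariant.mul_mem_of_bound (hμ : μ 𝔻ᶜ = 0) (hM : IsClosedInvariant μ M)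
    (hf : f ∈ M) (hψ : DifferentiableOn ℂ ψ 𝔻) (hA : ∀ z ∈ 𝔻, ‖ψ z‖ ≤ A)
    (hψf : ψ * f ∈ dirichletSpace μ) : ψ * f ∈ M := by
  have hfD := hM.le hf
  have hIoo : ∀ᶠ r : ℝ in 𝓝[<] 1, r ∈ Ioo (0 : ℝ) 1 := Ioo_mem_nhdsLT zero_lt_one
  refine hM.mem_of_tendsto hψf (l := 𝓝[<] (1 : ℝ)) (u := fun r => (fun z => ψ (r * z)) * f)
    (hIoo.mono fun r hr => hM.dilation_mul_mem hμ hf hψ hr.1.le hr.2) ?_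
  have hdom : ∫⁻ w, (34 * localDirichlet w (ψ * f) +
      36 * ENNReal.ofReal A ^ 2 * localDirichlet w f) ∂μ ≠ ∞ := by
    rw [lintegral_add_left ((measurable_localDirichlet _).const_mul _),
      lintegral_const_mul _ (measurable_localDirichlet _),
      lintegral_const_mul _ (measurable_localDirichlet _)]
    exact ENNReal.add_ne_top.2
      ⟨ENNReal.mul_ne_top (by simp) (lintegral_localDirichlet_ne_top hψf),
        ENNReal.mul_ne_top (by simp [ENNReal.mul_eq_top]) (lintegral_localDirichlet_ne_top hfD)⟩
  exact tendsto_dirichletNormSq hμ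
    (hIoo.mono fun r hr => (hψ.mul hfD.1.1).sub
      ((differentiableOn_dilation hψ hr.1.le hr.2.le).mul hfD.1.1))
    (tendsto_hardyNorm_sub_dilation_mul hfD.1 hψ hA) hdom
    (hIoo.mono fun r hr w hw => localDirichlet_sub_dilation_mul_le hfD.1.1 hψ hA hw hr.1.le hr.2)

theorem IsClosedInvariant.dirichletSpace_le_of_one_mem (hμ : μ 𝔻ᶜ = 0)
    (hM : IsClosedInvariant μ M) (h1 : (1 : ℂ → ℂ) ∈ M) : dirichletSpace μ ≤ M := by
  intro f hf
  have hIoo : ∀ᶠ r : ℝ in 𝓝[<] 1, r ∈ Ioo (0 : ℝ) 1 := Ioo_mem_nhdsLT zero_lt_one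
  refine hM.mem_of_tendsto hf (l := 𝓝[<] (1 : ℝ)) (u := fun r z => f (r * z))
    (hIoo.mono fun r hr => ?_) ?_
  · simpa using hM.dilation_mul_mem hμ h1 hf.1.1 hr.1.le hr.2
  · refine tendsto_dirichletNormSq hμ (Φ := fun w => 10 * localDirichlet w f)
      (hIoo.mono fun r hr => hf.1.1.sub (differentiableOn_dilation hf.1.1 hr.1.le hr.2.le))
      ((tendsto_hardyNorm_dilation_sub hf.1).congr fun r => hardyNorm_sub_comm _ _) ?_
      (hIoo.mono fun r hr w hw => ?_)
    · rw [lintegral_const_mul _ (measurable_localDirichlet f)]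
      exact ENNReal.mul_ne_top (by simp) (lintegral_localDirichlet_ne_top hf)
    · calc _ ≤ 2 * localDirichlet w f + 2 * localDirichlet w (fun z => f (r * z)) :=
            localDirichlet_sub_le hf.1.1 (differentiableOn_dilation hf.1.1 hr.1.le hr.2.le) hw
        _ ≤ 2 * localDirichlet w f + 2 * (4 * localDirichlet w f) := by
            gcongr
            exact localDirichlet_dilation_le hf.1.1 hw hr.1.le hr.2
        _ = 10 * localDirichlet w f := by ring

end

/-! ### Outer functions are cyclic -/

/-- The Herglotz integral of `h`: the holomorphic function on `𝔻` whose real part is the Poisson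
integral of `h` and which is real at `0`. Outer functions are its exponentials, up to a
unimodular constant. -/
noncomputable def herglotz (h : ℂ → ℝ) (z : ℂ) : ℂ :=
  ∫ ζ, (ζ + z) / (ζ - z) * (h ζ : ℂ) ∂arcLength

lemma integrable_mul_of_continuousOn_sphere {E : Type*} [NormedRing E] {k g : ℂ → E}
    (hk : ContinuousOn k (Metric.sphere 0 1)) (hg : Integrable g arcLength) :
    Integrable (fun ζ => k ζ * g ζ) arcLength := by
  obtain ⟨C, hC⟩ := (isCompact_sphere (0 : ℂ) 1).exists_bound_of_continuousOn hk
  refine hg.bdd_mul (c := C) (aestronglyMeasurable_of_continuousOn_sphere hk) ?_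
  filter_upwards [ae_norm_eq_one] with ζ hζ
  exact hC ζ (by simpa using hζ)

section

variable {h k : ℂ → ℝ} {z : ℂ}

lemma integrable_herglotz (hh : Integrable h arcLength) (hz : z ∈ 𝔻) :
    Integrable (fun ζ : ℂ => (ζ + z) / (ζ - z) * (h ζ : ℂ)) arcLength := by
  refine integrable_mul_of_continuousOn_sphere ?_ hh.ofReal
  exact ContinuousOn.div (by fun_prop) (by fun_prop) fun ζ hζ =>
    sub_ne_zero_of_mem_disc (by simpa using hζ) hz

lemma integrable_poisson_mul (hh : Integrable h arcLength) (hz : z ∈ 𝔻) :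
    Integrable (fun ζ => poisson z ζ * h ζ) arcLength :=
  integrable_mul_of_continuousOn_sphere (continuousOn_poisson hz) hh

lemma differentiableOn_herglotz (hh : Integrable h arcLength) :
    DifferentiableOn ℂ (herglotz h) 𝔻 := by
  refine (differentiableOn_circleAverage_herglotzRieszKernel_smul (f := fun ζ => (h ζ : ℂ))
    ((integrable_arcLength_iff_circleIntegrable hh.ofReal.1).1 hh.ofReal)).congr fun z hz => ?_
  rw [herglotz, integral_arcLength_eq_circleAverage (integrable_herglotz hh hz).1]
  simp [herglotzRieszKernel_def]

lemma herglotz_zero (h : ℂ → ℝ) : herglotz h 0 = ((∫ ζ, h ζ ∂arcLength : ℝ) : ℂ) := by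
  rw [herglotz, ← integral_complex_ofReal]
  refine integral_congr_ae ?_
  filter_upwards [ae_norm_eq_one] with ζ hζ
  simp [norm_ne_zero_iff.1 (hζ ▸ one_ne_zero)]

lemma herglotz_sub (hh : Integrable h arcLength) (hk : Integrable k arcLength) (hz : z ∈ 𝔻) :
    herglotz (h - k) z = herglotz h z - herglotz k z := by
  rw [herglotz, herglotz, herglotz,
    ← integral_sub (integrable_herglotz hh hz) (integrable_herglotz hk hz)]
  congr 1
  ext ζ
  push_cast [Pi.sub_apply]
  ring

lemma re_herglotz (hh : Integrable h arcLength) (hz : z ∈ 𝔻) :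
    (herglotz h z).re = ∫ ζ, poisson z ζ * h ζ ∂arcLength := by
  rw [herglotz, ← Complex.reCLM_apply,
    ← Complex.reCLM.integral_comp_comm (integrable_herglotz hh hz)]
  refine integral_congr_ae ?_
  filter_upwards [ae_norm_eq_one] with ζ hζ
  have hre := congrFun (poissonKernel_eq_re_herglotzRieszKernel (c := 0) (w := z)) ζ
  rw [← poisson_eq_poissonKernel hζ] at hre
  rw [Complex.reCLM_apply, Complex.re_mul_ofReal, hre]
  simp [herglotzRieszKernel_def]

lemma le_re_herglotz (hh : Integrable h arcLength) {c : ℝ} (hc : ∀ ζ, c ≤ h ζ) (hz : z ∈ 𝔻) :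
    c ≤ (herglotz h z).re := by
  rw [re_herglotz hh hz]
  calc c = ∫ ζ, poisson z ζ * c ∂arcLength := by
        rw [integral_mul_const, integral_poisson hz, one_mul]
    _ ≤ ∫ ζ, poisson z ζ * h ζ ∂arcLength :=
        integral_mono (integrable_poisson_mul (integrable_const c) hz)
          (integrable_poisson_mul hh hz)
          fun ζ => mul_le_mul_of_nonneg_left (hc ζ) (poisson_nonneg hz ζ)

end

lemma norm_one_sub_sq_le {w : ℂ} (hw : ‖w‖ ≤ 1) : ‖1 - w‖ ^ 2 ≤ 2 - 2 * w.re := by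
  have hsq : ‖w‖ ^ 2 ≤ 1 := pow_le_one₀ (norm_nonneg _) hw
  rw [← Complex.normSq_eq_norm_sq, Complex.normSq_apply] at hsq ⊢
  simp only [Complex.sub_re, Complex.sub_im, Complex.one_re, Complex.one_im]
  nlinarith

lemma hardyNorm_one_sub_sq_le {g : ℂ → ℂ} (hg : DifferentiableOn ℂ g 𝔻)
    (h1 : ∀ z ∈ 𝔻, ‖g z‖ ≤ 1) :
    hardyNorm 2 (1 - g) ^ 2 ≤ ENNReal.ofReal (2 - 2 * (g 0).re) := by
  refine hardyNorm_sq_le_iff.2 fun r hr => ?_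
  have hdiff := diffContOnCl_dilation hg hr.1 hr.2
  have hint := integrable_of_continuousOn_sphere (continuousOn_sphere_of_diffContOnCl hdiff)
  have hpointwise : ∀ᵐ ζ ∂arcLength, ‖1 - g (r * ζ)‖ ^ 2 ≤ 2 - 2 * (g (r * ζ)).re := by
    filter_upwards [ae_norm_eq_one] with ζ hζ
    exact norm_one_sub_sq_le (h1 _ (ofReal_mul_mem_disc hr.1 hr.2 hζ.le))
  have hre : Integrable (fun ζ : ℂ => 2 * (g (r * ζ)).re) arcLength := hint.re.const_mul 2
  have hmean : ∫ ζ, (g (r * ζ)).re ∂arcLength = (g 0).re := by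
    have hcomm := Complex.reCLM.integral_comp_comm hint
    simpa [integral_arcLength_eq_apply_zero hdiff] using hcomm
  calc ∫⁻ ζ, ‖1 - g (r * ζ)‖ₑ ^ 2 ∂arcLength
      ≤ ∫⁻ ζ, ENNReal.ofReal (2 - 2 * (g (r * ζ)).re) ∂arcLength := by
        refine lintegral_mono_ae ?_
        filter_upwards [hpointwise] with ζ hζ
        rw [← ofReal_norm, ← ENNReal.ofReal_pow (norm_nonneg _)]
        exact ENNReal.ofReal_le_ofReal hζ
    _ = ENNReal.ofReal (∫ ζ, (2 - 2 * (g (r * ζ)).re) ∂arcLength) :=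
        (ofReal_integral_eq_lintegral_ofReal ((integrable_const _).sub hre)
          (hpointwise.mono fun ζ hζ => (sq_nonneg _).trans hζ)).symm
    _ = _ := by
        rw [integral_sub (integrable_const _) hre, integral_const_mul, hmean]
        simp

section

variable {k : ℂ → ℝ}

lemma norm_exp_neg_herglotz_le (hk : Integrable k arcLength) {c : ℝ} (hc : ∀ ζ, c ≤ k ζ) {z : ℂ}
    (hz : z ∈ 𝔻) : ‖Complex.exp (-herglotz k z)‖ ≤ Real.exp (-c) := by
  rw [Complex.norm_exp, Real.exp_le_exp, Complex.neg_re]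
  exact neg_le_neg (le_re_herglotz hk hc hz)

lemma hardyNorm_one_sub_exp_neg_herglotz_sq_le (hk : Integrable k arcLength)
    (hk0 : ∀ ζ, 0 ≤ k ζ) :
    hardyNorm 2 (1 - fun z => Complex.exp (-herglotz k z)) ^ 2 ≤
      ENNReal.ofReal (2 - 2 * Real.exp (-∫ ζ, k ζ ∂arcLength)) := by
  have hle := hardyNorm_one_sub_sq_le (g := fun z => Complex.exp (-herglotz k z))
    (differentiableOn_herglotz hk).neg.cexp
    fun z hz => by simpa using norm_exp_neg_herglotz_le hk hk0 hz
  rwa [herglotz_zero, ← Complex.ofReal_neg, ← Complex.ofReal_exp, Complex.ofReal_re] at hle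

lemma tendsto_hardyNorm_one_sub_exp_neg_herglotz {k : ℕ → ℂ → ℝ}
    (hk : ∀ n, Integrable (k n) arcLength) (hk0 : ∀ n ζ, 0 ≤ k n ζ)
    (hlim : Tendsto (fun n => ∫ ζ, k n ζ ∂arcLength) atTop (𝓝 0)) :
    Tendsto (fun n => hardyNorm 2 (1 - fun z => Complex.exp (-herglotz (k n) z))) atTop (𝓝 0) := by
  refine tendsto_zero_of_tendsto_sq_zero (tendsto_of_tendsto_of_tendsto_of_le_of_le
    tendsto_const_nhds ?_ (fun _ => zero_le)
    fun n => hardyNorm_one_sub_exp_neg_herglotz_sq_le (hk n) (hk0 n))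
  have hcont : Continuous fun x => ENNReal.ofReal (2 - 2 * Real.exp (-x)) :=
    ENNReal.continuous_ofReal.comp (by fun_prop)
  simpa [Function.comp_def] using (hcont.tendsto 0).comp hlim

end

lemma tendsto_integral_max_neg_sub {X : Type*} [MeasurableSpace X] {ν : Measure X}
    [IsFiniteMeasure ν] {h : X → ℝ} (hh : Integrable h ν) :
    Tendsto (fun n : ℕ => ∫ x, (max (h x) (-n) - h x) ∂ν) atTop (𝓝 0) := by
  rw [← integral_zero X ℝ (μ := ν)]
  refine tendsto_integral_of_dominated_convergence (fun x => |h x|)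
    (fun n => ((hh.sup (integrable_const _)).sub hh).1) hh.abs
    (fun n => ae_of_all _ fun x => ?_) (ae_of_all _ fun x => ?_)
  · rw [Real.norm_of_nonneg (sub_nonneg.2 (le_max_left _ _)), sub_le_iff_le_add]
    refine max_le (by linarith [abs_nonneg (h x)]) ?_
    linarith [neg_abs_le (h x), (Nat.cast_nonneg n : (0 : ℝ) ≤ n)]
  · refine tendsto_const_nhds.congr' ?_
    filter_upwards [tendsto_natCast_atTop_atTop.eventually_ge_atTop (-h x)] with n hn
    rw [max_eq_left (by linarith), sub_self]

section

variable {μ : Measure ℂ} [IsFiniteMeasure μ] {M : Submodule ℂ (ℂ → ℂ)} {f : ℂ → ℂ}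

lemma IsClosedInvariant.one_mem_of_tendsto (hμ : μ 𝔻ᶜ = 0) (hM : IsClosedInvariant μ M)
    (hf : f ∈ M) {ψ : ℕ → ℂ → ℂ} (hψ : ∀ n, DifferentiableOn ℂ (ψ n) 𝔻)
    (hbdd : ∀ n, ∃ A, ∀ z ∈ 𝔻, ‖ψ n z‖ ≤ A) (hψf : ∀ n, ∀ z ∈ 𝔻, ‖(ψ n * f) z‖ ≤ 1)
    (hlim : Tendsto (fun n => hardyNorm 2 (1 - ψ n * f)) atTop (𝓝 0)) : (1 : ℂ → ℂ) ∈ M := by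
  have hdiff (n : ℕ) : DifferentiableOn ℂ (ψ n * f) 𝔻 := (hψ n).mul (hM.le hf).1.1
  have hone : DifferentiableOn ℂ (1 : ℂ → ℂ) 𝔻 := differentiableOn_const 1
  have hmem (n : ℕ) : ψ n * f ∈ M := by
    obtain ⟨A, hA⟩ := hbdd n
    exact hM.mul_mem_of_bound hμ hf (hψ n) hA
      (mem_dirichletSpace_of_bound hμ (hdiff n) (hψf n))
  refine hM.mem_of_tendsto
    (mem_dirichletSpace_of_bound hμ hone (A := 1) fun z _ => by simp)
    (Eventually.of_forall hmem) (tendsto_dirichletNormSq hμ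
      (Eventually.of_forall fun n => hone.sub (hdiff n)) hlim ?_
      (Eventually.of_forall fun n w hw => localDirichlet_le_of_bound (A := 1 + 1)
        (hone.sub (hdiff n)) (fun z hz => (norm_sub_le _ _).trans ?_) hw))
  · rw [lintegral_const]
    exact ENNReal.mul_ne_top ENNReal.ofReal_ne_top (measure_ne_top _ _)
  · exact add_le_add (by simp) (hψf n z hz)

lemma IsClosedInvariant.one_mem_of_outer (hμ : μ 𝔻ᶜ = 0) (hM : IsClosedInvariant μ M)
    (hf : f ∈ M) {α : ℂ} {h : ℂ → ℝ} (hα : α ≠ 0) (hh : Integrable h arcLength)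
    (hfh : ∀ z ∈ 𝔻, f z = α * Complex.exp (herglotz h z)) : (1 : ℂ → ℂ) ∈ M := by
  let m : ℕ → ℂ → ℝ := fun n ζ => max (h ζ) (-n)
  let ψ : ℕ → ℂ → ℂ := fun n z => α⁻¹ * Complex.exp (-herglotz (m n) z)
  have hm (n : ℕ) : Integrable (m n) arcLength := hh.sup (integrable_const _)
  have hk (n : ℕ) : Integrable (m n - h) arcLength := (hm n).sub hh
  have hk0 (n : ℕ) (ζ : ℂ) : 0 ≤ (m n - h) ζ := sub_nonneg.2 (le_max_left _ _)
  have hψf (n : ℕ) : EqOn (ψ n * f) (fun z => Complex.exp (-herglotz (m n - h) z)) 𝔻 := by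
    intro z hz
    simp only [Pi.mul_apply, ψ]
    rw [hfh z hz, herglotz_sub (hm n) hh hz, neg_sub, Complex.exp_sub, Complex.exp_neg]
    field_simp
  have hbdd (n : ℕ) : ∃ A, ∀ z ∈ 𝔻, ‖ψ n z‖ ≤ A := by
    refine ⟨‖α⁻¹‖ * Real.exp (- -n), fun z hz => ?_⟩
    rw [norm_mul]
    gcongr
    exact norm_exp_neg_herglotz_le (hm n) (fun ζ => le_max_right _ _) hz
  refine hM.one_mem_of_tendsto hμ hf (ψ := ψ)
    (fun n => (differentiableOn_herglotz (hm n)).neg.cexp.const_mul _) hbdd (fun n z hz => ?_) ?_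
  · rw [hψf n hz]
    simpa using norm_exp_neg_herglotz_le (hk n) (hk0 n) hz
  · refine (tendsto_hardyNorm_one_sub_exp_neg_herglotz hk hk0
      (tendsto_integral_max_neg_sub hh)).congr fun n => hardyNorm_congr fun z hz => ?_
    rw [Pi.sub_apply, Pi.sub_apply, hψf n hz]

theorem isCyclic_of_isOuter (hμ : μ 𝔻ᶜ = 0) (hf : f ∈ dirichletSpace μ) (houter : IsOuter f) :
    IsCyclic μ f := by
  obtain ⟨-, α, h, hα, hh, hfh⟩ := houter
  refine ⟨hf, le_antisymm (sInf_le ⟨isClosedInvariant_dirichletSpace hμ, hf⟩) ?_⟩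
  refine le_sInf fun M hM => hM.1.dirichletSpace_le_of_one_mem hμ ?_
  exact hM.1.one_mem_of_outer hμ hM.2 (norm_ne_zero_iff.1 (hα ▸ one_ne_zero)) hh hfh

end

/-! ### Polynomial multiples of cyclic functions -/

/-- The distance in `H²` from `g` to the set of polynomial multiples of `f`. -/
noncomputable def hardyDist (f g : ℂ → ℂ) : ℝ≥0∞ :=
  ⨅ p : Polynomial ℂ, hardyNorm 2 (g - fun z => p.eval z * f z)

section

variable {f g h : ℂ → ℂ}

lemma differentiableOn_sub_eval_mul (hf : DifferentiableOn ℂ f 𝔻) (hg : DifferentiableOn ℂ g 𝔻)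
    (p : Polynomial ℂ) : DifferentiableOn ℂ (g - fun z => p.eval z * f z) 𝔻 :=
  hg.sub (p.differentiable.differentiableOn.mul hf)

lemma hardyDist_self (f : ℂ → ℂ) : hardyDist f f = 0 :=
  le_bot_iff.1 (iInf_le_of_le 1 (by simp [hardyNorm]))

lemma hardyDist_zero (f : ℂ → ℂ) : hardyDist f 0 = 0 :=
  le_bot_iff.1 (iInf_le_of_le 0 (by simp [hardyNorm]))

lemma hardyDist_add_le (hf : DifferentiableOn ℂ f 𝔻) (hg : DifferentiableOn ℂ g 𝔻)
    (hh : DifferentiableOn ℂ h 𝔻) : hardyDist f (g + h) ≤ hardyDist f g + hardyDist f h := by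
  refine ENNReal.le_iInf_add_iInf fun p q => iInf_le_of_le (p + q) ?_
  refine le_of_eq_of_le (congrArg (hardyNorm 2) ?_) (hardyNorm_add_le one_le_two
    (differentiableOn_sub_eval_mul hf hg p) (differentiableOn_sub_eval_mul hf hh q))
  ext z
  simp only [Pi.sub_apply, Pi.add_apply, Polynomial.eval_add]
  ring

lemma hardyDist_le_hardyNorm (f g : ℂ → ℂ) : hardyDist f g ≤ hardyNorm 2 g :=
  iInf_le_of_le 0 (by simp [Pi.sub_def])

lemma hardyDist_eval_mul_le {q : Polynomial ℂ} {A : ℝ} (hq : ∀ z ∈ 𝔻, ‖q.eval z‖ ≤ A) :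
    hardyDist f (fun z => q.eval z * g z) ≤ ENNReal.ofReal A * hardyDist f g := by
  rw [hardyDist, hardyDist, ENNReal.mul_iInf (by simp)]
  refine le_iInf fun p => iInf_le_of_le (q * p) ?_
  refine le_of_eq_of_le (congrArg (hardyNorm 2) ?_) (hardyNorm_mul_le hq)
  ext z
  simp only [Pi.sub_apply, Pi.mul_apply, Polynomial.eval_mul]
  ring

end

/-- The elements of `𝓓_μ` that are limits in `H²` of polynomial multiples of `f`. -/
noncomputable def hardyClosure (μ : Measure ℂ) [SFinite μ] {f : ℂ → ℂ}
    (hf : DifferentiableOn ℂ f 𝔻) : Submodule ℂ (ℂ → ℂ) where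
  carrier := {g | g ∈ dirichletSpace μ ∧ hardyDist f g = 0}
  add_mem' := fun ⟨hg, hgf⟩ ⟨hh, hhf⟩ => ⟨add_mem hg hh,
    le_bot_iff.1 ((hardyDist_add_le hf hg.1.1 hh.1.1).trans_eq (by simp [hgf, hhf]))⟩
  zero_mem' := ⟨zero_mem _, hardyDist_zero f⟩
  smul_mem' := fun c g ⟨hg, hgf⟩ => ⟨Submodule.smul_mem _ c hg, le_bot_iff.1 <| by
    simpa [hgf, Pi.smul_def] using
      hardyDist_eval_mul_le (f := f) (g := g) (q := Polynomial.C c) (A := ‖c‖) (by simp)⟩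

section

variable {μ : Measure ℂ} [IsFiniteMeasure μ] {f : ℂ → ℂ}

lemma isClosedInvariant_hardyClosure (hμ : μ 𝔻ᶜ = 0) (hf : DifferentiableOn ℂ f 𝔻) :
    IsClosedInvariant μ (hardyClosure μ hf) where
  le := fun g hg => hg.1
  closed := by
    refine fun g hg hcl => ⟨hg, le_bot_iff.1 (le_of_forall_pos_le_add fun ε hε => ?_)⟩
    obtain ⟨u, ⟨hu, huf⟩, hgu⟩ := hcl (ε ^ 2) (ENNReal.pow_pos hε 2)
    have hnorm : hardyNorm 2 (g - u) ≤ ε :=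
      (ENNReal.pow_le_pow_left_iff two_ne_zero).1 (le_self_add.trans hgu.le)
    calc hardyDist f g = hardyDist f (g - u + u) := by rw [sub_add_cancel]
      _ ≤ hardyDist f (g - u) + hardyDist f u := hardyDist_add_le hf (hg.1.1.sub hu.1.1) hu.1.1
      _ ≤ ⊥ + ε := by
        rw [huf, add_zero, bot_eq_zero, zero_add]
        exact (hardyDist_le_hardyNorm f _).trans hnorm
  shift := fun g ⟨hg, hgf⟩ => ⟨shift_mem_dirichletSpace hμ hg, le_bot_iff.1 <| by
    simpa [hgf] using hardyDist_eval_mul_le (f := f) (g := g) (q := Polynomial.X) (A := 1)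
      fun z hz => by simpa using (mem_ball_zero_iff.1 hz).le⟩

lemma hardyDist_one_eq_zero_of_isCyclic (hμ : μ 𝔻ᶜ = 0) (hf : IsCyclic μ f) :
    hardyDist f 1 = 0 := by
  have hone : (1 : ℂ → ℂ) ∈ generatedSubspace μ f := by
    rw [hf.2]
    exact mem_dirichletSpace_of_bound hμ (differentiableOn_const _) (A := 1) fun z _ => by simp
  have hle : generatedSubspace μ f ≤ hardyClosure μ hf.1.1.1 :=
    sInf_le ⟨isClosedInvariant_hardyClosure hμ hf.1.1.1, hf.1, hardyDist_self f⟩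
  exact (hle hone).2

end

section

variable {f : ℂ → ℂ}

lemma exists_polynomial_of_hardyDist_eq_zero {g : ℂ → ℂ} (hfg : hardyDist f g = 0) {ε : ℝ≥0∞}
    (hε : 0 < ε) : ∃ p : Polynomial ℂ, hardyNorm 2 (g - fun z => p.eval z * f z) < ε :=
  iInf_lt_iff.1 (hfg.trans_lt hε)

lemma ne_zero_of_hardyDist_one_eq_zero (hf : DifferentiableOn ℂ f 𝔻) (hdist : hardyDist f 1 = 0)
    {w : ℂ} (hw : w ∈ 𝔻) : f w ≠ 0 := by
  intro hfw
  have hpos : 0 < 1 - ‖w‖ ^ 2 := one_sub_norm_sq_pos hw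
  obtain ⟨p, hp⟩ := exists_polynomial_of_hardyDist_eq_zero hdist
    (ENNReal.ofReal_pos.2 (Real.sqrt_pos.2 hpos))
  have heval := enorm_sq_mul_le_hardyNorm_sq
    (differentiableOn_sub_eval_mul hf (differentiableOn_const 1) p) hw
  simp only [Pi.sub_apply, hfw, mul_zero, sub_zero, enorm_one, one_pow, one_mul] at heval
  refine (ENNReal.pow_lt_pow_left two_ne_zero hp).not_ge (le_of_eq_of_le ?_ heval)
  rw [← ENNReal.ofReal_pow (Real.sqrt_nonneg _), Real.sq_sqrt hpos.le]

end

/-! ### Boundary functions -/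

/-- `F` is the boundary function of `f`: the limit, in `L¹(𝕋)` and almost everywhere, of the
dilations of `f` along the sequence of radii `r k → 1`. -/
structure IsBoundaryFunction (f F : ℂ → ℂ) (r : ℕ → ℝ) : Prop where
  radius_mem (k : ℕ) : r k ∈ Ioo (0 : ℝ) 1
  tendsto_radius : Tendsto r atTop (𝓝[<] 1)
  integrable : Integrable F arcLength
  ae_tendsto : ∀ᵐ ζ ∂arcLength, Tendsto (fun k => f (r k * ζ)) atTop (𝓝 (F ζ))
  tendsto_eLpNorm : Tendsto (fun k => eLpNorm (fun ζ => f (r k * ζ) - F ζ) 1 arcLength) atTop (𝓝 0)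

section

variable {f F : ℂ → ℂ} {r : ℕ → ℝ}

lemma memLp_dilation {p : ℝ≥0∞} (hf : MemHardy p f) {s : ℝ} (hs : s ∈ Ico (0 : ℝ) 1) :
    MemLp (fun ζ => f (s * ζ)) p arcLength :=
  ⟨aestronglyMeasurable_dilation hf.1 hs, (eLpNorm_dilation_le_hardyNorm p f hs).trans_lt hf.2⟩

lemma eLpNorm_dilation_sub_dilation_le (f : ℂ → ℂ) {s t : ℝ} (ht : t ∈ Ioo (0 : ℝ) 1) :
    eLpNorm (fun ζ => f (t * ζ) - f (s * ζ)) 2 arcLength ≤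
      hardyNorm 2 ((fun z => f ((s / t : ℝ) * z)) - f) := by
  rw [← Pi.sub_def, eLpNorm_sub_comm]
  refine le_of_eq_of_le ?_ (eLpNorm_dilation_le_hardyNorm 2 _ (Ioo_subset_Ico_self ht))
  congr 1
  ext ζ
  rw [Pi.sub_apply, Pi.sub_apply, ← mul_assoc, ← Complex.ofReal_mul, div_mul_cancel₀ _ ht.1.ne']

lemma cauchySeq_toLp_dilation (hf : MemHardy 2 f) (hr : ∀ k, r k ∈ Ioo (0 : ℝ) 1)
    (hmono : StrictMono r) (hlim : Tendsto r atTop (𝓝 1)) :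
    CauchySeq fun k => (memLp_dilation hf (Ioo_subset_Ico_self (hr k))).toLp := by
  refine EMetric.cauchySeq_iff'.2 fun ε hε => ?_
  obtain ⟨a, ha, hsub⟩ := (mem_nhdsLT_iff_exists_Ico_subset (a := (1 : ℝ))).1
    ((tendsto_hardyNorm_dilation_sub hf).eventually_lt_const hε)
  obtain ⟨N, hN⟩ := (hlim.eventually_const_le ha).exists
  refine ⟨N, fun n hn => ?_⟩
  obtain rfl | hlt := hn.eq_or_lt
  · simpa using hε
  rw [Lp.edist_toLp_toLp]
  refine (eLpNorm_dilation_sub_dilation_le f (hr n)).trans_lt (hsub ⟨hN.trans ?_, ?_⟩)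
  · exact le_div_self (hr N).1.le (hr n).1 (hr n).2.le
  · exact (div_lt_one (hr n).1).2 (hmono hlt)

theorem exists_isBoundaryFunction (hf : MemHardy 2 f) : ∃ F r, IsBoundaryFunction f F r := by
  obtain ⟨r, hmono, hr, hlim⟩ := exists_seq_strictMono_tendsto' (zero_lt_one (α := ℝ))
  have hLp (k : ℕ) := memLp_dilation hf (Ioo_subset_Ico_self (hr k))
  obtain ⟨F, hF⟩ := cauchySeq_tendsto_of_complete (cauchySeq_toLp_dilation hf hr hmono hlim)
  have hF2 : Tendsto (fun k => eLpNorm (fun ζ => f (r k * ζ) - F ζ) 2 arcLength) atTop (𝓝 0) :=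
    ((Lp.tendsto_Lp_iff_tendsto_eLpNorm' _ _).1 hF).congr fun k =>
      eLpNorm_congr_ae ((hLp k).coeFn_toLp.sub (ae_eq_refl _))
  obtain ⟨n, hn, hae⟩ := (tendstoInMeasure_of_tendsto_eLpNorm two_ne_zero
    (fun k => (hLp k).1) (Lp.memLp F).1 hF2).exists_seq_tendsto_ae
  refine ⟨F, r ∘ n, fun k => hr _, ?_, (Lp.memLp F).integrable one_le_two, hae, ?_⟩
  · exact tendsto_nhdsWithin_iff.2 ⟨hlim.comp hn.tendsto_atTop, .of_forall fun k => (hr _).2⟩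
  · exact tendsto_of_tendsto_of_tendsto_of_le_of_le tendsto_const_nhds
      (hF2.comp hn.tendsto_atTop) (fun _ => zero_le) fun k =>
        eLpNorm_le_eLpNorm_of_exponent_le one_le_two ((hLp _).1.sub (Lp.memLp F).1)

lemma eLpNorm_le_hardyNorm_of_tendsto {p : ℝ≥0∞} (hf : DifferentiableOn ℂ f 𝔻)
    (hr : ∀ k, r k ∈ Ico (0 : ℝ) 1)
    (hlim : ∀ᵐ ζ ∂arcLength, Tendsto (fun k => f (r k * ζ)) atTop (𝓝 (F ζ))) :
    eLpNorm F p arcLength ≤ hardyNorm p f :=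
  (Lp.eLpNorm_lim_le_liminf_eLpNorm (fun k => aestronglyMeasurable_dilation hf (hr k)) F hlim).trans
    (liminf_le_of_le (by isBoundedDefault) fun _ h => by
      obtain ⟨k, hk⟩ := h.exists
      exact hk.trans (eLpNorm_dilation_le_hardyNorm p f (hr k)))

end

section

variable {X : Type*} [MeasurableSpace X] {ν : Measure X} {a : ℕ → X → ℝ} {c : ℝ}

lemma lintegral_liminf_le_of_tendsto_integral (ha : ∀ k, Integrable (a k) ν)
    (hpos : ∀ k, 0 ≤ᵐ[ν] a k) (hlim : Tendsto (fun k => ∫ x, a k x ∂ν) atTop (𝓝 c)) :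
    ∫⁻ x, liminf (fun k => ENNReal.ofReal (a k x)) atTop ∂ν ≤ ENNReal.ofReal c := by
  refine (lintegral_liminf_le' fun k => (ha k).1.aemeasurable.ennreal_ofReal).trans_eq ?_
  simp only [← ofReal_integral_eq_lintegral_ofReal (ha _) (hpos _)]
  exact (ENNReal.tendsto_ofReal hlim).liminf_eq

lemma aemeasurable_liminf {b : ℕ → X → ℝ≥0∞} (hb : ∀ k, AEMeasurable (b k) ν) :
    AEMeasurable (fun x => liminf (fun k => b k x) atTop) ν := by
  refine ⟨_, .liminf fun k => (hb k).measurable_mk, ?_⟩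
  filter_upwards [ae_all_iff.2 fun k => (hb k).ae_eq_mk] with x hx
  simp only [hx]

lemma ae_not_tendsto_atTop_of_tendsto_integral (ha : ∀ k, Integrable (a k) ν)
    (hpos : ∀ k, 0 ≤ᵐ[ν] a k) (hlim : Tendsto (fun k => ∫ x, a k x ∂ν) atTop (𝓝 c)) :
    ∀ᵐ x ∂ν, ¬Tendsto (fun k => a k x) atTop atTop := by
  have hmeas : AEMeasurable (fun x => liminf (fun k => ENNReal.ofReal (a k x)) atTop) ν :=
    aemeasurable_liminf fun k => (ha k).1.aemeasurable.ennreal_ofReal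
  have hfin := ((lintegral_liminf_le_of_tendsto_integral ha hpos hlim).trans_lt
    ENNReal.ofReal_lt_top).ne
  filter_upwards [ae_lt_top' hmeas hfin] with x hx htop
  exact hx.ne (ENNReal.tendsto_ofReal_atTop.comp htop).liminf_eq

lemma integrable_and_integral_le_of_tendsto {A : X → ℝ} (ha : ∀ k, Integrable (a k) ν)
    (hpos : ∀ k, 0 ≤ᵐ[ν] a k) (hae : ∀ᵐ x ∂ν, Tendsto (fun k => a k x) atTop (𝓝 (A x)))
    (hlim : Tendsto (fun k => ∫ x, a k x ∂ν) atTop (𝓝 c)) :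
    Integrable A ν ∧ ∫ x, A x ∂ν ≤ c := by
  have hApos : 0 ≤ᵐ[ν] A := by
    filter_upwards [ae_all_iff.2 hpos, hae] with x hx hlimx
    exact ge_of_tendsto' hlimx hx
  have hc : 0 ≤ c := ge_of_tendsto' hlim fun k => integral_nonneg_of_ae (hpos k)
  have hle : ∫⁻ x, ENNReal.ofReal (A x) ∂ν ≤ ENNReal.ofReal c := by
    refine le_of_eq_of_le (lintegral_congr_ae ?_)
      (lintegral_liminf_le_of_tendsto_integral ha hpos hlim)
    filter_upwards [hae] with x hx
    exact (ENNReal.tendsto_ofReal hx).liminf_eq.symm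
  have hA : Integrable A ν := by
    refine ⟨aestronglyMeasurable_of_tendsto_ae atTop (fun k => (ha k).1) hae, ?_⟩
    rw [hasFiniteIntegral_iff_ofReal hApos]
    exact hle.trans_lt ENNReal.ofReal_lt_top
  refine ⟨hA, (ENNReal.ofReal_le_ofReal_iff hc).1 ?_⟩
  rwa [ofReal_integral_eq_lintegral_ofReal hA hApos]

end

section

variable {f F : ℂ → ℂ} {r : ℕ → ℝ} {w : ℂ}

lemma integrable_log_norm_dilation (hf : DifferentiableOn ℂ f 𝔻) (h0 : ∀ z ∈ 𝔻, f z ≠ 0) {s : ℝ}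
    (hs : s ∈ Ico (0 : ℝ) 1) : Integrable (fun ζ : ℂ => Real.log ‖f (s * ζ)‖) arcLength :=
  integrable_of_continuousOn_sphere <| (continuousOn_sphere_dilation hf hs.1 hs.2).norm.log
    fun ζ hζ => norm_ne_zero_iff.2 (h0 _ (ofReal_mul_mem_disc hs.1 hs.2 (by simpa using hζ.le)))

lemma integral_poisson_mul_log_norm (hf : DifferentiableOn ℂ f 𝔻) (h0 : ∀ z ∈ 𝔻, f z ≠ 0) {s : ℝ}
    (hs : s ∈ Ico (0 : ℝ) 1) (hw : w ∈ 𝔻) :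
    ∫ ζ, poisson w ζ * Real.log ‖f (s * ζ)‖ ∂arcLength = Real.log ‖f (s * w)‖ := by
  have hharm : InnerProductSpace.HarmonicOnNhd (fun z : ℂ => Real.log ‖f (s * z)‖)
      (Metric.closedBall 0 1) := by
    intro z hz
    have hmem : (s : ℂ) * z ∈ 𝔻 := ofReal_mul_mem_disc hs.1 hs.2 (by simpa using hz)
    have hana : AnalyticAt ℂ f (s * z) := hf.analyticAt (Metric.isOpen_ball.mem_nhds hmem)
    exact AnalyticAt.harmonicAt_log_norm (f := fun z : ℂ => f (s * z))
      (hana.comp (f := fun z : ℂ => (s : ℂ) * z) (analyticAt_const.mul analyticAt_id)) (h0 _ hmem)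
  rw [integral_arcLength_eq_circleAverage
      (integrable_poisson_mul (integrable_log_norm_dilation hf h0 hs) hw).1,
    ← InnerProductSpace.HarmonicOnNhd.circleAverage_poissonKernel_smul hharm hw]
  refine Real.circleAverage_congr_sphere fun ζ hζ => ?_
  simp [poisson_eq_poissonKernel (ζ := ζ) (by simpa using hζ)]

lemma IsBoundaryFunction.integrable_norm_dilation (hF : IsBoundaryFunction f F r)
    (hf : DifferentiableOn ℂ f 𝔻) (k : ℕ) :
    Integrable (fun ζ => ‖f (r k * ζ)‖) arcLength :=
  integrable_of_continuousOn_sphere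
    (continuousOn_sphere_dilation hf (hF.radius_mem k).1.le (hF.radius_mem k).2).norm

lemma IsBoundaryFunction.tendsto_integral_poisson_mul_norm (hF : IsBoundaryFunction f F r)
    (hf : DifferentiableOn ℂ f 𝔻) (hw : w ∈ 𝔻) :
    Tendsto (fun k => ∫ ζ, poisson w ζ * ‖f (r k * ζ)‖ ∂arcLength) atTop
      (𝓝 (∫ ζ, poisson w ζ * ‖F ζ‖ ∂arcLength)) := by
  obtain ⟨C, hC⟩ := (isCompact_sphere (0 : ℂ) 1).exists_bound_of_continuousOn
    (continuousOn_poisson hw)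
  refine tendsto_integral_of_L1 _ (integrable_poisson_mul hF.integrable.norm hw).1
    (.of_forall fun k => integrable_poisson_mul (hF.integrable_norm_dilation hf k) hw) ?_
  have hlim : Tendsto (fun k => ENNReal.ofReal C *
      eLpNorm (fun ζ => f (r k * ζ) - F ζ) 1 arcLength) atTop (𝓝 0) := by
    simpa using ENNReal.Tendsto.const_mul hF.tendsto_eLpNorm (.inr ENNReal.ofReal_ne_top)
  refine tendsto_of_tendsto_of_tendsto_of_le_of_le tendsto_const_nhds hlim (fun _ => zero_le)
    fun k => ?_
  simp only [eLpNorm_one_eq_lintegral_enorm]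
  rw [← lintegral_const_mul' _ _ ENNReal.ofReal_ne_top]
  refine lintegral_mono_ae ?_
  filter_upwards [ae_norm_eq_one] with ζ hζ
  rw [← mul_sub, enorm_mul]
  gcongr
  · rw [← ofReal_norm]
    exact ENNReal.ofReal_le_ofReal (hC ζ (by simpa using hζ))
  · exact enorm_le_iff_norm_le.2 (abs_norm_sub_norm_le _ _)

lemma IsBoundaryFunction.integrable_norm_sub_log_norm_dilation (hF : IsBoundaryFunction f F r)
    (hf : DifferentiableOn ℂ f 𝔻) (h0 : ∀ z ∈ 𝔻, f z ≠ 0) (k : ℕ) :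
    Integrable (fun ζ => ‖f (r k * ζ)‖ - Real.log ‖f (r k * ζ)‖) arcLength :=
  (hF.integrable_norm_dilation hf k).sub
    (integrable_log_norm_dilation hf h0 (Ioo_subset_Ico_self (hF.radius_mem k)))

lemma IsBoundaryFunction.tendsto_integral_poisson_mul_norm_sub_log_norm
    (hF : IsBoundaryFunction f F r) (hf : DifferentiableOn ℂ f 𝔻) (h0 : ∀ z ∈ 𝔻, f z ≠ 0)
    (hw : w ∈ 𝔻) :
    Tendsto (fun k => ∫ ζ, poisson w ζ * (‖f (r k * ζ)‖ - Real.log ‖f (r k * ζ)‖) ∂arcLength)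
      atTop (𝓝 (∫ ζ, poisson w ζ * ‖F ζ‖ ∂arcLength - Real.log ‖f w‖)) := by
  have hlog : Tendsto (fun k => Real.log ‖f (r k * w)‖) atTop (𝓝 (Real.log ‖f w‖)) :=
    ((hf.continuousOn.continuousAt (Metric.isOpen_ball.mem_nhds hw)).tendsto.comp
      ((tendsto_ofReal_mul w).comp hF.tendsto_radius)).norm.log (norm_ne_zero_iff.2 (h0 w hw))
  refine ((hF.tendsto_integral_poisson_mul_norm hf hw).sub hlog).congr fun k => ?_
  have hk := Ioo_subset_Ico_self (hF.radius_mem k)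
  rw [← integral_poisson_mul_log_norm hf h0 hk hw, ← integral_sub
    (integrable_poisson_mul (hF.integrable_norm_dilation hf k) hw)
    (integrable_poisson_mul (integrable_log_norm_dilation hf h0 hk) hw)]
  simp only [mul_sub]

lemma poisson_mul_norm_sub_log_norm_nonneg (hw : w ∈ 𝔻) (ζ u : ℂ) :
    0 ≤ poisson w ζ * (‖u‖ - Real.log ‖u‖) :=
  mul_nonneg (poisson_nonneg hw ζ) (sub_nonneg.2 (Real.log_le_self (norm_nonneg u)))

theorem IsBoundaryFunction.ae_ne_zero (hF : IsBoundaryFunction f F r)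
    (hf : DifferentiableOn ℂ f 𝔻) (h0 : ∀ z ∈ 𝔻, f z ≠ 0) : ∀ᵐ ζ ∂arcLength, F ζ ≠ 0 := by
  have hmem : (0 : ℂ) ∈ 𝔻 := by simp
  filter_upwards [ae_not_tendsto_atTop_of_tendsto_integral
    (fun k => integrable_poisson_mul (hF.integrable_norm_sub_log_norm_dilation hf h0 k) hmem)
    (fun k => ae_of_all _ fun ζ => poisson_mul_norm_sub_log_norm_nonneg hmem ζ _)
    (hF.tendsto_integral_poisson_mul_norm_sub_log_norm hf h0 hmem), hF.ae_tendsto,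
    ae_norm_eq_one] with ζ hbdd hlim hζ hFζ
  have hdisc (k : ℕ) : (r k : ℂ) * ζ ∈ 𝔻 :=
    ofReal_mul_mem_disc (hF.radius_mem k).1.le (hF.radius_mem k).2 hζ.le
  have hnorm : Tendsto (fun k => ‖f (r k * ζ)‖) atTop (𝓝[≠] 0) :=
    tendsto_nhdsWithin_iff.2 ⟨by simpa [hFζ] using hlim.norm,
      .of_forall fun k => norm_ne_zero_iff.2 (h0 _ (hdisc k))⟩
  refine hbdd (tendsto_atTop_mono (fun k => ?_)
    (tendsto_neg_atBot_atTop.comp (Real.tendsto_log_nhdsNE_zero.comp hnorm)))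
  simp [poisson, hζ]

lemma IsBoundaryFunction.integrable_and_integral_le (hF : IsBoundaryFunction f F r)
    (hf : DifferentiableOn ℂ f 𝔻) (h0 : ∀ z ∈ 𝔻, f z ≠ 0) (hw : w ∈ 𝔻) :
    Integrable (fun ζ => poisson w ζ * (‖F ζ‖ - Real.log ‖F ζ‖)) arcLength ∧
      ∫ ζ, poisson w ζ * (‖F ζ‖ - Real.log ‖F ζ‖) ∂arcLength ≤
        ∫ ζ, poisson w ζ * ‖F ζ‖ ∂arcLength - Real.log ‖f w‖ := by
  refine integrable_and_integral_le_of_tendsto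
    (fun k => integrable_poisson_mul (hF.integrable_norm_sub_log_norm_dilation hf h0 k) hw)
    (fun k => ae_of_all _ fun ζ => poisson_mul_norm_sub_log_norm_nonneg hw ζ _) ?_
    (hF.tendsto_integral_poisson_mul_norm_sub_log_norm hf h0 hw)
  filter_upwards [hF.ae_tendsto, hF.ae_ne_zero hf h0] with ζ hlim hne
  exact (hlim.norm.sub (hlim.norm.log (norm_ne_zero_iff.2 hne))).const_mul _

theorem IsBoundaryFunction.integrable_log_norm (hF : IsBoundaryFunction f F r)
    (hf : DifferentiableOn ℂ f 𝔻) (h0 : ∀ z ∈ 𝔻, f z ≠ 0) :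
    Integrable (fun ζ => Real.log ‖F ζ‖) arcLength := by
  refine (hF.integrable.norm.sub
    (hF.integrable_and_integral_le hf h0 (w := 0) (by simp)).1).congr ?_
  filter_upwards [ae_norm_eq_one] with ζ hζ
  simp [poisson, hζ]

theorem IsBoundaryFunction.log_norm_le_re_herglotz (hF : IsBoundaryFunction f F r)
    (hf : DifferentiableOn ℂ f 𝔻) (h0 : ∀ z ∈ 𝔻, f z ≠ 0) (hw : w ∈ 𝔻) :
    Real.log ‖f w‖ ≤ (herglotz (fun ζ => Real.log ‖F ζ‖) w).re := by
  have hlog := hF.integrable_log_norm hf h0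
  have hle := (hF.integrable_and_integral_le hf h0 hw).2
  simp only [mul_sub] at hle
  rw [integral_sub (integrable_poisson_mul hF.integrable.norm hw)
    (integrable_poisson_mul hlog hw)] at hle
  rw [re_herglotz hlog hw]
  linarith

theorem arcLength_radialZeroSet (hf : MemHardy 2 f) (h0 : ∀ z ∈ 𝔻, f z ≠ 0) :
    arcLength (radialZeroSet f) = 0 := by
  obtain ⟨F, r, hF⟩ := exists_isBoundaryFunction hf
  rw [measure_eq_zero_iff_ae_notMem]
  filter_upwards [hF.ae_tendsto, hF.ae_ne_zero hf.1 h0] with ζ hlim hne hζ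
  exact hne (tendsto_nhds_unique hlim (hζ.2.comp hF.tendsto_radius))

end

/-! ### Cyclic functions are outer -/

lemma integrable_log_norm_eval (p : Polynomial ℂ) :
    Integrable (fun ζ => Real.log ‖p.eval ζ‖) arcLength :=
  (integrable_arcLength_iff_circleIntegrable
    (Real.measurable_log.comp p.continuous.norm.measurable).aestronglyMeasurable).2
    ((circleIntegrable_def _ _ _).2 p.intervalIntegrable_mahlerMeasure)

lemma log_norm_eval_zero_le_integral (p : Polynomial ℂ) (h0 : p.eval 0 ≠ 0) :
    Real.log ‖p.eval 0‖ ≤ ∫ ζ, Real.log ‖p.eval ζ‖ ∂arcLength := by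
  rw [integral_arcLength_eq_circleAverage (integrable_log_norm_eval p).1,
    ← Polynomial.logMahlerMeasure_def, Polynomial.logMahlerMeasure_eq_log_MahlerMeasure]
  refine Real.log_le_log (norm_pos_iff.2 h0) ?_
  simpa [Polynomial.coeff_zero_eq_eval_zero] using p.norm_coeff_le_choose_mul_mahlerMeasure 0

lemma ae_eval_ne_zero {p : Polynomial ℂ} (hp : p ≠ 0) : ∀ᵐ ζ ∂arcLength, p.eval ζ ≠ 0 := by
  have hfin : {ζ : ℂ | p.eval ζ = 0}.Finite :=
    (p.roots.toFinset.finite_toSet).subset fun ζ hζ => by simpa [hp] using hζ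
  have hnull : volume (circleMap 0 1 ⁻¹' {ζ : ℂ | p.eval ζ = 0}) = 0 :=
    (hfin.countable.preimage_circleMap 0 one_ne_zero).measure_zero volume
  rw [ae_iff]
  simp only [not_not]
  rw [arcLength, Measure.map_apply (continuous_circleMap 0 1).measurable hfin.measurableSet,
    Measure.smul_apply, Measure.restrict_le_self.absolutelyContinuous hnull, smul_zero]

section

variable {f F : ℂ → ℂ} {r : ℕ → ℝ}

lemma hardyNorm_mono_exponent {p q : ℝ≥0∞} (hpq : p ≤ q) (hf : DifferentiableOn ℂ f 𝔻) :
    hardyNorm p f ≤ hardyNorm q f :=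
  iSup₂_mono fun _ hs => eLpNorm_le_eLpNorm_of_exponent_le hpq (aestronglyMeasurable_dilation hf hs)

lemma enorm_apply_zero_le_hardyNorm (hf : DifferentiableOn ℂ f 𝔻) : ‖f 0‖ₑ ≤ hardyNorm 2 f :=
  (ENNReal.pow_le_pow_left_iff two_ne_zero).1
    (by simpa using enorm_sq_mul_le_hardyNorm_sq hf (w := 0) (by simp))

lemma log_norm_le_norm_one_sub (u : ℂ) : Real.log ‖u‖ ≤ ‖1 - u‖ := by
  obtain rfl | hu := eq_or_ne u 0
  · simp
  · have htri := norm_sub_norm_le u 1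
    rw [norm_one, norm_sub_rev] at htri
    exact (Real.log_le_sub_one_of_pos (norm_pos_iff.2 hu)).trans htri

lemma IsBoundaryFunction.integrable_one_sub_eval_mul (hF : IsBoundaryFunction f F r)
    (p : Polynomial ℂ) : Integrable (fun ζ => 1 - p.eval ζ * F ζ) arcLength :=
  (integrable_const 1).sub
    (integrable_mul_of_continuousOn_sphere p.continuous.continuousOn hF.integrable)

lemma IsBoundaryFunction.integral_norm_one_sub_le (hF : IsBoundaryFunction f F r)
    (hf : DifferentiableOn ℂ f 𝔻) {p : Polynomial ℂ} {ε : ℝ} (hε : 0 ≤ ε)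
    (hp : hardyNorm 2 (1 - fun z => p.eval z * f z) ≤ ENNReal.ofReal ε) :
    ∫ ζ, ‖1 - p.eval ζ * F ζ‖ ∂arcLength ≤ ε := by
  have hd := differentiableOn_sub_eval_mul hf (differentiableOn_const 1) p
  rw [integral_norm_eq_lintegral_enorm (hF.integrable_one_sub_eval_mul p).1,
    ← eLpNorm_one_eq_lintegral_enorm]
  refine ENNReal.toReal_le_of_le_ofReal hε ((eLpNorm_le_hardyNorm_of_tendsto hd
    (fun k => Ioo_subset_Ico_self (hF.radius_mem k)) ?_).trans
      ((hardyNorm_mono_exponent one_le_two hd).trans hp))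
  filter_upwards [hF.ae_tendsto] with ζ hζ
  exact tendsto_const_nhds.sub ((p.continuous.continuousAt.tendsto.comp
    ((tendsto_ofReal_mul ζ).comp hF.tendsto_radius)).mul hζ)

lemma IsBoundaryFunction.integral_log_norm_eval_add_le (hF : IsBoundaryFunction f F r)
    (hf : DifferentiableOn ℂ f 𝔻) (h0 : ∀ z ∈ 𝔻, f z ≠ 0) {p : Polynomial ℂ} (hp0 : p ≠ 0) {ε : ℝ}
    (hε : 0 ≤ ε) (hp : hardyNorm 2 (1 - fun z => p.eval z * f z) ≤ ENNReal.ofReal ε) :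
    ∫ ζ, Real.log ‖p.eval ζ‖ ∂arcLength + ∫ ζ, Real.log ‖F ζ‖ ∂arcLength ≤ ε := by
  have hlogp := integrable_log_norm_eval p
  have hlogF := hF.integrable_log_norm hf h0
  rw [← integral_add hlogp hlogF]
  refine (integral_mono_ae (hlogp.add hlogF) (hF.integrable_one_sub_eval_mul p).norm ?_).trans
    (hF.integral_norm_one_sub_le hf hε hp)
  filter_upwards [hF.ae_ne_zero hf h0, ae_eval_ne_zero hp0] with ζ hFζ hpζ
  rw [Pi.add_apply, ← Real.log_mul (norm_ne_zero_iff.2 hpζ) (norm_ne_zero_iff.2 hFζ), ← norm_mul]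
  exact log_norm_le_norm_one_sub _

lemma IsBoundaryFunction.integral_log_norm_le_add (hF : IsBoundaryFunction f F r)
    (hf : DifferentiableOn ℂ f 𝔻) (h0 : ∀ z ∈ 𝔻, f z ≠ 0) {p : Polynomial ℂ} {ε : ℝ}
    (hε : ε ∈ Ioo (0 : ℝ) 1)
    (hp : hardyNorm 2 (1 - fun z => p.eval z * f z) ≤ ENNReal.ofReal ε) :
    ∫ ζ, Real.log ‖F ζ‖ ∂arcLength ≤ Real.log ‖f 0‖ + ε - Real.log (1 - ε) := by
  have happrox : ‖1 - p.eval 0 * f 0‖ ≤ ε := by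
    rw [← ENNReal.ofReal_le_ofReal_iff hε.1.le, ofReal_norm]
    exact (enorm_apply_zero_le_hardyNorm
      (differentiableOn_sub_eval_mul hf (differentiableOn_const 1) p)).trans hp
  have hlower : 1 - ε ≤ ‖p.eval 0‖ * ‖f 0‖ := by
    have htri := norm_sub_norm_le (1 : ℂ) (p.eval 0 * f 0)
    rw [norm_one, norm_mul] at htri
    linarith
  have hpne : p.eval 0 ≠ 0 :=
    norm_ne_zero_iff.1 (left_ne_zero_of_mul ((sub_pos.2 hε.2).trans_le hlower).ne')
  have hlog := Real.log_le_log (sub_pos.2 hε.2) hlower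
  rw [Real.log_mul (norm_ne_zero_iff.2 hpne) (norm_ne_zero_iff.2 (h0 0 (by simp)))] at hlog
  have hsum := hF.integral_log_norm_eval_add_le hf h0 (by rintro rfl; simp at hpne) hε.1.le hp
  linarith [log_norm_eval_zero_le_integral p hpne]

lemma IsBoundaryFunction.integral_log_norm_le (hF : IsBoundaryFunction f F r)
    (hf : DifferentiableOn ℂ f 𝔻) (hdist : hardyDist f 1 = 0) :
    ∫ ζ, Real.log ‖F ζ‖ ∂arcLength ≤ Real.log ‖f 0‖ := by
  have hcont : ContinuousAt (fun ε : ℝ => Real.log ‖f 0‖ + ε - Real.log (1 - ε)) 0 :=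
    ContinuousAt.sub (by fun_prop) (ContinuousAt.log (by fun_prop) (by norm_num))
  have hlim : Tendsto (fun ε : ℝ => Real.log ‖f 0‖ + ε - Real.log (1 - ε)) (𝓝[>] 0)
      (𝓝 (Real.log ‖f 0‖)) := by
    simpa using hcont.tendsto.mono_left nhdsWithin_le_nhds
  refine ge_of_tendsto hlim ?_
  filter_upwards [Ioo_mem_nhdsGT zero_lt_one] with ε hε
  obtain ⟨p, hp⟩ := exists_polynomial_of_hardyDist_eq_zero hdist (ENNReal.ofReal_pos.2 hε.1)
  exact hF.integral_log_norm_le_add hf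
    (fun _ => ne_zero_of_hardyDist_one_eq_zero hf hdist) hε hp.le

theorem isOuter_of_hardyDist_one_eq_zero (hf : MemHardy 2 f) (hdist : hardyDist f 1 = 0) :
    IsOuter f := by
  have h0 : ∀ z ∈ 𝔻, f z ≠ 0 := fun _ => ne_zero_of_hardyDist_one_eq_zero hf.1 hdist
  obtain ⟨F, r, hF⟩ := exists_isBoundaryFunction hf
  have hlog := hF.integrable_log_norm hf.1 h0
  set H := herglotz fun ζ => Real.log ‖F ζ‖ with hH
  -- The quotient of `f` by the outer function with boundary modulus `|F|` is bounded by `1`, and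
  -- it attains this bound at `0`.
  have hnorm (z : ℂ) : ‖f z * Complex.exp (-H z)‖ = ‖f z‖ * Real.exp (-(H z).re) := by
    rw [norm_mul, Complex.norm_exp, Complex.neg_re]
  have hle (z : ℂ) (hz : z ∈ 𝔻) : ‖f z * Complex.exp (-H z)‖ ≤ 1 := by
    rw [hnorm, Real.exp_neg, ← div_eq_mul_inv, div_le_one (Real.exp_pos _)]
    exact (Real.log_le_iff_le_exp (norm_pos_iff.2 (h0 z hz))).1
      (hF.log_norm_le_re_herglotz hf.1 h0 hz)
  have hmem : (0 : ℂ) ∈ 𝔻 := by simp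
  have hone : ‖f 0 * Complex.exp (-H 0)‖ = 1 := by
    refine (hle 0 hmem).antisymm ?_
    rw [hnorm, Real.exp_neg, ← div_eq_mul_inv, one_le_div (Real.exp_pos _)]
    refine (Real.le_log_iff_exp_le (norm_pos_iff.2 (h0 0 hmem))).1 ?_
    rw [hH, herglotz_zero, Complex.ofReal_re]
    exact hF.integral_log_norm_le hf.1 hdist
  have hconst := Complex.eqOn_of_isPreconnected_of_isMaxOn_norm
    (convex_ball (0 : ℂ) 1).isPreconnected Metric.isOpen_ball
    (hf.1.mul (differentiableOn_herglotz hlog).neg.cexp) hmem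
    fun z hz => (hle z hz).trans_eq hone.symm
  refine ⟨⟨hf.1, (hardyNorm_mono_exponent one_le_two hf.1).trans_lt hf.2⟩,
    f 0 * Complex.exp (-H 0), _, hone, hlog, fun z hz => ?_⟩
  have hz_const : f z * Complex.exp (-H z) = f 0 * Complex.exp (-H 0) := hconst hz
  change f z = _ * Complex.exp (H z)
  rw [← hz_const, mul_assoc, ← Complex.exp_add, neg_add_cancel, Complex.exp_zero, mul_one]

end

theorem isOuter_of_isCyclic {μ : Measure ℂ} [IsFiniteMeasure μ] (hμ : μ 𝔻ᶜ = 0) {f : ℂ → ℂ}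
    (hf : IsCyclic μ f) : IsOuter f :=
  isOuter_of_hardyDist_one_eq_zero hf.1.1 (hardyDist_one_eq_zero_of_isCyclic hμ hf)

lemma IsOuter.ne_zero {f : ℂ → ℂ} (hf : IsOuter f) : ∀ z ∈ 𝔻, f z ≠ 0 := by
  obtain ⟨-, α, h, hα, -, hfh⟩ := hf
  intro z hz
  rw [hfh z hz]
  exact mul_ne_zero (norm_ne_zero_iff.1 (hα ▸ one_ne_zero)) (Complex.exp_ne_zero _)

/-! ### Capacity -/

lemma arcLength_le_capacity (μ : Measure ℂ) (E : Set ℂ) : arcLength E ≤ capacity μ E := by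
  refine le_iInf₂ fun g _ => le_iInf fun ⟨U, hU, hEU, hg⟩ => ?_
  calc arcLength E ≤ arcLength U := measure_mono hEU
    _ = ∫⁻ ζ, U.indicator 1 ζ ∂arcLength := (lintegral_indicator_one hU.measurableSet).symm
    _ ≤ ∫⁻ ζ, ‖g ζ‖ₑ ^ 2 ∂arcLength := by
        refine lintegral_mono_ae (hg.mono fun ζ hζ => ?_)
        refine indicator_apply_le' (fun hζU => ?_) fun _ => zero_le
        exact one_le_pow₀ ((ENNReal.one_le_ofReal.2 (hζ hζU)).trans_eq (ofReal_norm _))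
    _ = eLpNorm g 2 arcLength ^ 2 := (eLpNorm_two_sq g).symm
    _ ≤ _ := le_self_add

/-- The density with respect to `arcLength` of the balayage of `μ` onto the unit circle. -/
noncomputable def sweep (μ : Measure ℂ) (ζ : ℂ) : ℝ≥0∞ := ∫⁻ w, ENNReal.ofReal (poisson w ζ) ∂μ

lemma measurable_ofReal_poisson :
    Measurable fun p : ℂ × ℂ => ENNReal.ofReal (poisson p.2 p.1) :=
  (measurable_poisson.comp measurable_swap).ennreal_ofReal

lemma measurable_sweep (μ : Measure ℂ) [SFinite μ] : Measurable (sweep μ) :=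
  measurable_ofReal_poisson.lintegral_prod_right'

lemma douglasKernel_comm (μ : Measure ℂ) (ζ l : ℂ) :
    douglasKernel μ ζ l = douglasKernel μ l ζ := by
  simp only [douglasKernel, mul_comm]

lemma measurable_douglasKernel (μ : Measure ℂ) [SFinite μ] :
    Measurable (Function.uncurry (douglasKernel μ)) := by
  refine Measurable.lintegral_prod_right' (f := fun q : (ℂ × ℂ) × ℂ => ENNReal.ofReal
    ((1 - ‖q.2‖ ^ 2) / ‖q.1.1 - q.2‖ ^ 2 * ((1 - ‖q.2‖ ^ 2) / ‖q.1.2 - q.2‖ ^ 2))) ?_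
  fun_prop

section

variable {μ : Measure ℂ}

lemma lintegral_sweep [SFinite μ] (hμ : μ 𝔻ᶜ = 0) : ∫⁻ ζ, sweep μ ζ ∂arcLength = μ univ := by
  unfold sweep
  rw [lintegral_lintegral_swap measurable_ofReal_poisson.aemeasurable, ← lintegral_one]
  refine lintegral_congr_ae ?_
  filter_upwards [mem_ae_iff.2 hμ] with w hw using lintegral_poisson hw

lemma lintegral_douglasKernel [SFinite μ] (hμ : μ 𝔻ᶜ = 0) (l : ℂ) :
    ∫⁻ ζ, douglasKernel μ ζ l ∂arcLength = sweep μ l := by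
  unfold douglasKernel
  rw [lintegral_lintegral_swap (by fun_prop)]
  refine lintegral_congr_ae ?_
  filter_upwards [mem_ae_iff.2 hμ] with w hw
  calc ∫⁻ ζ, ENNReal.ofReal (poisson w ζ * poisson w l) ∂arcLength
      = ∫⁻ ζ, ENNReal.ofReal (poisson w ζ) * ENNReal.ofReal (poisson w l) ∂arcLength :=
        lintegral_congr fun ζ => ENNReal.ofReal_mul (poisson_nonneg hw ζ)
    _ = ENNReal.ofReal (poisson w l) := by
        rw [lintegral_mul_const' _ _ ENNReal.ofReal_ne_top, lintegral_poisson hw, one_mul]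

lemma harmonicDirichletIntegral_indicator_le [SFinite μ] (hμ : μ 𝔻ᶜ = 0) {U : Set ℂ}
    (hU : MeasurableSet U) : harmonicDirichletIntegral μ (U.indicator 1) ≤
      2 * ∫⁻ ζ in U, sweep μ ζ ∂arcLength := by
  have hK := measurable_douglasKernel μ
  have hpoint (ζ l : ℂ) : ‖U.indicator (1 : ℂ → ℂ) ζ - U.indicator 1 l‖ₑ ^ 2 *
      douglasKernel μ ζ l ≤
        U.indicator (douglasKernel μ · l) ζ + U.indicator (douglasKernel μ ζ) l := by
    by_cases hζ : ζ ∈ U <;> by_cases hl : l ∈ U <;> simp [hζ, hl]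
  have hswap : ∫⁻ l, ∫⁻ ζ in U, douglasKernel μ ζ l ∂arcLength ∂arcLength =
      ∫⁻ ζ in U, sweep μ ζ ∂arcLength := by
    rw [lintegral_lintegral_swap (f := fun l ζ => douglasKernel μ ζ l)
      (hK.comp measurable_swap).aemeasurable]
    simp only [douglasKernel_comm μ _, ← lintegral_douglasKernel hμ]
  calc harmonicDirichletIntegral μ (U.indicator 1)
      ≤ ∫⁻ l, ∫⁻ ζ, U.indicator (douglasKernel μ · l) ζ + U.indicator (douglasKernel μ ζ) l
          ∂arcLength ∂arcLength :=
        lintegral_mono fun l => lintegral_mono fun ζ => hpoint ζ l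
    _ = ∫⁻ l, ((∫⁻ ζ in U, douglasKernel μ ζ l ∂arcLength) + U.indicator (sweep μ) l)
          ∂arcLength := by
        refine lintegral_congr fun l => ?_
        rw [lintegral_add_left (hK.of_uncurry_right.indicator hU),
          lintegral_indicator hU]
        by_cases hl : l ∈ U <;> simp [hl, lintegral_douglasKernel hμ]
    _ = 2 * ∫⁻ ζ in U, sweep μ ζ ∂arcLength := by
        rw [lintegral_add_right _ ((measurable_sweep μ).indicator hU), hswap,
          lintegral_indicator hU, two_mul]

lemma capacity_le_of_isOpen [IsFiniteMeasure μ] (hμ : μ 𝔻ᶜ = 0) {E U : Set ℂ} (hU : IsOpen U)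
    (hE : E ⊆ U) : capacity μ E ≤ arcLength U + 2 * ∫⁻ ζ in U, sweep μ ζ ∂arcLength := by
  have hD := harmonicDirichletIntegral_indicator_le hμ hU.measurableSet
  have hsweep : ∫⁻ ζ in U, sweep μ ζ ∂arcLength < ∞ :=
    (setLIntegral_le_lintegral _ _).trans_lt (lintegral_sweep hμ ▸ measure_lt_top μ _)
  have hnorm : eLpNorm (U.indicator (1 : ℂ → ℂ)) 2 arcLength ^ 2 = arcLength U := by
    rw [eLpNorm_two_sq, ← lintegral_indicator_one hU.measurableSet]
    exact lintegral_congr fun ζ => by by_cases hζ : ζ ∈ U <;> simp [hζ]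
  calc capacity μ E ≤ eLpNorm (U.indicator (1 : ℂ → ℂ)) 2 arcLength ^ 2 +
        harmonicDirichletIntegral μ (U.indicator 1) :=
        iInf₂_le_of_le _ ⟨(memLp_const (1 : ℂ)).indicator hU.measurableSet,
          hD.trans_lt (ENNReal.mul_lt_top ENNReal.ofNat_lt_top hsweep)⟩
          (iInf_le _ ⟨U, hU, hE, ae_of_all _ fun ζ hζ => by simp [hζ]⟩)
    _ ≤ _ := add_le_add hnorm.le hD

theorem capacity_eq_zero_iff [IsFiniteMeasure μ] (hμ : μ 𝔻ᶜ = 0) (E : Set ℂ) :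
    capacity μ E = 0 ↔ arcLength E = 0 := by
  refine ⟨fun h => nonpos_iff_eq_zero.1 (h ▸ arcLength_le_capacity μ E), fun h => ?_⟩
  set ν : Measure ℂ := arcLength.withDensity (1 + 2 * sweep μ) with hν
  have hν_apply {U : Set ℂ} (hU : MeasurableSet U) :
      ν U = arcLength U + 2 * ∫⁻ ζ in U, sweep μ ζ ∂arcLength := by
    rw [hν, withDensity_apply _ hU]
    simp only [Pi.add_apply, Pi.mul_apply, Pi.ofNat_apply]
    rw [lintegral_add_left measurable_const, setLIntegral_one,
      lintegral_const_mul _ (measurable_sweep μ)]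
  have : IsFiniteMeasure ν := ⟨by
    rw [hν_apply .univ, Measure.restrict_univ, lintegral_sweep hμ]
    exact ENNReal.add_lt_top.2 ⟨measure_lt_top _ _,
      ENNReal.mul_lt_top ENNReal.ofNat_lt_top (measure_lt_top μ _)⟩⟩
  have hνE : ν E = 0 := withDensity_absolutelyContinuous _ _ h
  refine nonpos_iff_eq_zero.1 (le_of_forall_gt fun ε hε => ?_)
  obtain ⟨U, hEU, hU, hUε⟩ := E.exists_isOpen_lt_of_lt (μ := ν) ε (by rwa [hνE])
  exact (capacity_le_of_isOpen hμ hU hEU).trans_lt (hν_apply hU.measurableSet ▸ hUε)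

end

end BrownShields

theorem corollary6p2 (μ : MeasureTheory.Measure ℂ) [MeasureTheory.IsFiniteMeasure μ]
    (hμ : μ (Metric.ball (0 : ℂ) 1)ᶜ = 0) :
    (∀ f ∈ BrownShields.dirichletSpace μ,
      (BrownShields.IsCyclic μ f ↔ BrownShields.IsOuter f)) ∧
    (∀ f ∈ BrownShields.dirichletSpace μ,
      (BrownShields.IsCyclic μ f ↔
        BrownShields.IsOuter f ∧ BrownShields.capacity μ (BrownShields.radialZeroSet f) = 0)) ∧
    (∀ E : Set ℂ, E ⊆ Metric.sphere 0 1 →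
      (BrownShields.capacity μ E = 0 ↔ BrownShields.arcLength E = 0)) := by
  have hcyclic (f : ℂ → ℂ) (hf : f ∈ BrownShields.dirichletSpace μ) :
      BrownShields.IsCyclic μ f ↔ BrownShields.IsOuter f :=
    ⟨BrownShields.isOuter_of_isCyclic hμ, BrownShields.isCyclic_of_isOuter hμ hf⟩
  have hnull (f : ℂ → ℂ) (hf : f ∈ BrownShields.dirichletSpace μ)
      (houter : BrownShields.IsOuter f) :
      BrownShields.capacity μ (BrownShields.radialZeroSet f) = 0 :=
    (BrownShields.capacity_eq_zero_iff hμ _).2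
      (BrownShields.arcLength_radialZeroSet hf.1 houter.ne_zero)
  refine ⟨hcyclic, fun f hf => ?_, fun E _ => BrownShields.capacity_eq_zero_iff hμ E⟩
  rw [hcyclic f hf]
  exact ⟨fun houter => ⟨houter, hnull f hf houter⟩, And.left⟩
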